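/- Let $n,l$ be non-negative integers with $2l>n$, and let $V(x)=\sum_{a}v_ae^{i\langle a,x\rangle}$ be a real trigonometric polynomial on $\mathbb R^n$ (finite sum over $a\in\mathbb Z^n$, $v_{-a}=\overline{v_a}$) with $v_0=0$. **Notation.** For $j\in\mathbb Z^n$, $t\in\mathbb R^n$ put $P_j(t)=j+t$, $p_j(t)=|P_j(t)|$. For a $2\pi$-periodic $W$ with Fourier coefficients $w_a=(2\pi)^{-n}\int_{[0,2\pi]^n}W(x)e^{-i\langle a,x\rangle}dx$ let $\|W\|_*=\sum_a|w_a|$. Let $H_0(t)+W$ be the operator $(-\Delta)^l+W$ on $[0,2\pi]^n$ with quasiperiodic boundary conditions of quasimomentum $t$, written in the basis $e^{i\langle P_m(t),x\rangle}$, $m\in\mathbb Z^n$, i.e. the matrix $p_m^{2l}(t)\delta_{mm'}+w_{m-m'}$ in $\ell^2(\mathbb Z^n)$. For a matrix $T$ indexed by $\mathbb Z^n$ (with scalar or vector entries) let $\|T\|_0=\frac12\sup_r\sum_p(|T_{pr}|+|T_{rp}|)$. *Resonant set.* Fix $q$ with $v_q\ne0$. For $k,\delta>0$ let $\chi_q(k,\delta)$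 be the set of $t\in[0,1)^n$ for which there is $j\in\mathbb Z^n$ with $p_j(t)=k$, $|p_{j-q}^2(t)-p_j^2(t)|<k^{-n+2-\delta}$, and, for all $i\ne j,j-q$, $|p_j^2(t)-p_i^2(t)|>2k^{-n+2-6\delta}$ and $|p_{j-q}^2(t)-p_i^2(t)|>2k^{-n+2-6\delta}$. *Model operator.* For such $j$, let $\hat\lambda^+(t)$ be the larger eigenvalue of $\begin{pmatrix}p_j^{2l}(t)&v_q\\ v_{-q}&p_{j-q}^{2l}(t)\end{pmatrix}$ and $\hat E^+(t)$ its spectral projection, extended by zero to a matrix indexed by $\mathbb Z^n$ (the block sits at the indices $j,j-q$). Put $d=|v_q|/10$. *Perturbed objects.* If $H_0(t)+W$ has exactly one eigenvalue in $[\hat\lambda^+(t)-d,\hat\lambda^+(t)+d]$, and this eigenvalue is simple and lies in the interior, denote it by $\lambda_W(t)$ and its spectral projection by $E_W(t)$. For $\sigma\in\mathbb R$, $A\in\mathbb C$ put $u_W(x)=A\sum_s(E_W(t))_{sj}e^{i\langle P_s(t),x\rangle}$, $W_0=V$, $W_{m+1}=V+\sigma|u_{W_m}|^2$. **Theorem.**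 There is a constant $C=C(V)>0$ (it may depend on $n,l,V$ only) such that for all $\delta>0$ with $9\delta<2l-n$ and all $\gamma_2>0$ there is $k_0=k_0(V,\delta,\gamma_2)$ for which the following holds for all $k>k_0$, all $q$ with $v_q\neq0$, all $\sigma\in\mathbb R$, $A\in\mathbb C$ with $|\sigma||A|^2<k^{-2l\gamma_2}$, every $t_0\in\chi_q(k,\delta)$ with any corresponding $j$, and every $t$ with $|t-t_0|<k^{-n+1-7\delta}$. The sequence $W_m=W_m(\cdot,t)$ is well defined, i.e. $H_0(t)+W_m$ has a unique, simple eigenvalue as above for every $m$; $W_m$ converges in $\|\cdot\|_*$ to a continuous $2\pi$-periodic potential $W=W(\cdot,t)$; and $H_0(t)+W$ has a unique, simple eigenvalue $\lambda_W(t)$ as above, with spectral projection $E_W(t)$. As functions of $t$ (with $W=W(\cdot,t)$ also varying, while $k,q,j,\sigma,A$ are fixed), $E_W-\hat E^+$ is differentiable with respect to $\|\cdot\|_0$, $\lambda_W$ and $\hat\lambda^+$ are differentiable, and, with $\gamma=\min\{\gamma_1,2l\gamma_2\}$, $2\gamma_1=2l-n-8\delta$, $$\|\nabla_t(E_W(t)-\hat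 E^+(t))\|_0<C\,k^{-\gamma+2l-1},\qquad |\nabla_t\lambda_W(t)-\nabla_t\hat\lambda^+(t)|<C\,k^{-\gamma+2l-1}.$$ Consequently $$\Big|\,|\nabla_t\lambda_W(t)|-2l\,k^{2l-1}\Big|\le 2l\,k^{2l-1}\cdot C\,k^{-\min\{\gamma,2\}},$$ that is, $|\nabla_t\lambda_W(t)|=2lk^{2l-1}\big(1+O(k^{-\min\{\gamma,2\}})\big)$; for $\gamma\le2$ the error is $O(k^{-\gamma})$. -/

import Mathlib

open Filter Topology MeasureTheory Metric
open scoped ENNReal ComplexConjugate Gradient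

noncomputable section

namespace Polyharmonic

/-- The lattice `ℤⁿ`, which indexes the plane waves. -/
abbrev Lat (n : ℕ) : Type := Fin n → ℤ

/-- Euclidean space `ℝⁿ`. -/
abbrev Sp (n : ℕ) : Type := EuclideanSpace ℝ (Fin n)

/-- `P_j(t) = j + t`. -/
def mom {n : ℕ} (j : Lat n) (t : Sp n) : Sp n :=
  WithLp.toLp 2 (fun s => (j s : ℝ) + t s)

/-- `p_j^{2l}(t) = |P_j(t)|^{2l}`, the eigenvalues of `(-Δ)^l` with quasimomentum `t`. -/
def freeEig {n : ℕ} (l : ℕ) (j : Lat n) (t : Sp n) : ℝ := ‖mom j t‖ ^ (2 * l)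

/-- The plane wave `exp(i⟨ξ, x⟩)`. -/
def planeWave {n : ℕ} (ξ x : Sp n) : ℂ := Complex.exp (Complex.I * ((inner ℝ ξ x : ℝ) : ℂ))

/-- The trigonometric polynomial `∑ v_a exp(i⟨a, x⟩)`. -/
def trigPoly {n : ℕ} (v : Lat n →₀ ℂ) (x : Sp n) : ℂ :=
  v.sum fun a c => c * planeWave (mom a 0) x

/-- The cell of periods `Q = [0, 2π]ⁿ`. -/
def cell (n : ℕ) : Set (Sp n) := {x | ∀ s, x s ∈ Set.Icc 0 (2 * Real.pi)}

/-- The Fourier coefficient `w_a = (2π)⁻ⁿ ∫_Q W(x) exp(-i⟨a, x⟩) dx`. -/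
def fourierCoef {n : ℕ} (W : Sp n → ℂ) (a : Lat n) : ℂ :=
  (((2 * Real.pi) ^ n)⁻¹ : ℝ) * ∫ x in cell n, W x * planeWave (-mom a 0) x

/-- `‖W‖_* = ∑_a |w_a|`. -/
def starNorm {n : ℕ} (W : Sp n → ℂ) : ℝ≥0∞ := ∑' a : Lat n, ‖fourierCoef W a‖ₑ

/-- `2π`-periodicity in every variable. -/
def IsPeriodic {n : ℕ} (W : Sp n → ℂ) : Prop :=
  ∀ (x : Sp n) (a : Lat n), W (x + (2 * Real.pi) • mom a 0) = W x

/-- `‖T‖₀ = (1/2) sup_r ∑_p (|T_{pr}| + |T_{rp}|)` for an infinite matrix; the entries may be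
numbers or vectors. -/
def norm0 {n : ℕ} {F : Type*} [NormedAddCommGroup F] (T : Lat n → Lat n → F) : ℝ≥0∞ :=
  (⨆ r, ∑' p, (‖T p r‖ₑ + ‖T r p‖ₑ)) / 2

/-- `G` is the gradient at `t` of the matrix-valued function `T`, where differentiability is
with respect to `‖·‖₀`; the entry `G_{pr}` is the vector `∇ T_{pr}(t)`. -/
def HasMatrixGradient {n : ℕ} (T : Sp n → Lat n → Lat n → ℂ)
    (G : Lat n → Lat n → EuclideanSpace ℂ (Fin n)) (t : Sp n) : Prop :=
  Tendsto
    (fun h : Sp n =>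
      norm0 (fun p r => T (t + h) p r - T t p r - ∑ s, ((h s : ℝ) : ℂ) * G p r s) / ‖h‖ₑ)
    (𝓝[≠] 0) (𝓝 0)

/-- The operator `H₀(t) + W` in the basis `exp(i⟨P_m(t), x⟩)`, `m ∈ ℤⁿ`. -/
def hamiltonian {n : ℕ} (l : ℕ) (W : Sp n → ℂ) (t : Sp n) (f : Lat n → ℂ) (m : Lat n) : ℂ :=
  (freeEig l m t : ℂ) * f m + ∑' a : Lat n, fourierCoef W (m - a) * f a

/-- `f ∈ ℓ²(ℤⁿ)` solves `(H₀(t) + W) f = μ f`. As `W` acts boundedly when `‖W‖_* < ∞`, such an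
`f` lies in the domain of `H₀(t)`. -/
def IsEigenSol {n : ℕ} (l : ℕ) (W : Sp n → ℂ) (t : Sp n) (μ : ℝ) (f : Lat n → ℂ) : Prop :=
  (Summable fun m => ‖f m‖ ^ 2) ∧ ∀ m, hamiltonian l W t f m = (μ : ℂ) * f m

/-- `μ` is the only eigenvalue of `H₀(t) + W` in `[c - d, c + d]`, it lies in the interior, it is
simple, and `E` is the matrix of the orthogonal projection on its eigenspace. -/
def IsSpectralPair {n : ℕ} (l : ℕ) (W : Sp n → ℂ) (t : Sp n) (c d : ℝ)
    (E : Lat n → Lat n → ℂ) (μ : ℝ) : Prop :=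
  |μ - c| < d ∧
  ∃ f : Lat n → ℂ,
    IsEigenSol l W t μ f ∧ (∑' m, ‖f m‖ ^ 2 = 1) ∧
    (∀ p r, E p r = f p * conj (f r)) ∧
    ∀ (ν : ℝ) (g : Lat n → ℂ), |ν - c| ≤ d → IsEigenSol l W t ν g → g ≠ 0 →
      ν = μ ∧ ∃ a : ℂ, ∀ m, g m = a * f m

open Classical in
/-- The spectral projection of `H₀(t) + W` for its single eigenvalue in `[c - d, c + d]`
(zero when there is no such eigenvalue). -/
def specProj {n : ℕ} (l : ℕ) (W : Sp n → ℂ) (t : Sp n) (c d : ℝ) : Lat n → Lat n → ℂ :=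
  if h : ∃ E : Lat n → Lat n → ℂ, ∃ μ : ℝ, IsSpectralPair l W t c d E μ then h.choose else 0

/-- `b`, where `2b = (4|v_q|² + (p_j^{2l} - p_{j-q}^{2l})²)^{1/2}`. -/
def halfGap {n : ℕ} (l : ℕ) (v : Lat n →₀ ℂ) (j q : Lat n) (t : Sp n) : ℝ :=
  Real.sqrt (4 * ‖v q‖ ^ 2 + (freeEig l j t - freeEig l (j - q) t) ^ 2) / 2

/-- The larger eigenvalue `λ⁺(t)` of the model matrix
`(p_j^{2l}, v_q; v_{-q}, p_{j-q}^{2l})`. -/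
def lamPlus {n : ℕ} (l : ℕ) (v : Lat n →₀ ℂ) (j q : Lat n) (t : Sp n) : ℝ :=
  (freeEig l j t + freeEig l (j - q) t) / 2 + halfGap l v j q t

/-- The eigenvector `(p_{j-q}^{2l} - λ⁺, -v_{-q})` of the model matrix for `λ⁺`, as a vector
indexed by `ℤⁿ` with support in `{j, j - q}`. -/
def modelVec {n : ℕ} (l : ℕ) (v : Lat n →₀ ℂ) (j q : Lat n) (t : Sp n) (m : Lat n) : ℂ :=
  if m = j then ((freeEig l (j - q) t - lamPlus l v j q t : ℝ) : ℂ)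
  else if m = j - q then -v (-q) else 0

/-- The spectral projection `E⁺(t)` of the model operator for `λ⁺(t)`. -/
def modelProj {n : ℕ} (l : ℕ) (v : Lat n →₀ ℂ) (j q : Lat n) (t : Sp n) (p r : Lat n) : ℂ :=
  modelVec l v j q t p * conj (modelVec l v j q t r) /
    ((‖modelVec l v j q t j‖ ^ 2 + ‖modelVec l v j q t (j - q)‖ ^ 2 : ℝ) : ℂ)

/-- Radius `d = |v_q| / 10` of the circle around `λ⁺(t)`. -/
def radius {n : ℕ} (v : Lat n →₀ ℂ) (q : Lat n) : ℝ := ‖v q‖ / 10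

/-- `u_W(x) = A ∑_s (E_W(t))_{sj} exp(i⟨P_s(t), x⟩)`, where `E_W(t)` is the spectral projection of
`H₀(t) + W` for its eigenvalue near `λ⁺(t)`. -/
def solU {n : ℕ} (l : ℕ) (v : Lat n →₀ ℂ) (j q : Lat n) (A : ℂ) (t : Sp n)
    (W : Sp n → ℂ) (x : Sp n) : ℂ :=
  A * ∑' s : Lat n,
    specProj l W t (lamPlus l v j q t) (radius v q) s j * planeWave (mom s t) x

/-- The map `W ↦ V + σ |u_W|²`. -/
def potMap {n : ℕ} (l : ℕ) (v : Lat n →₀ ℂ) (j q : Lat n) (σ : ℝ) (A : ℂ) (t : Sp n)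
    (W : Sp n → ℂ) (x : Sp n) : ℂ :=
  trigPoly v x + ((σ * ‖solU l v j q A t W x‖ ^ 2 : ℝ) : ℂ)

/-- The successive approximations `W_0 = V`, `W_{m+1} = V + σ |u_{W_m}|²`. -/
def iterPot {n : ℕ} (l : ℕ) (v : Lat n →₀ ℂ) (j q : Lat n) (σ : ℝ) (A : ℂ) (t : Sp n) :
    ℕ → Sp n → ℂ
  | 0 => trigPoly v
  | m + 1 => potMap l v j q σ A t (iterPot l v j q σ A t m)

/-- The part of the resonant set that belongs to `j`: all `t ∈ K = [0, 1)ⁿ` with `|P_j(t)| = k`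
such that `p_j²` and `p_{j-q}²` are close to each other and far from all other `p_i²`. -/
def resonantSet {n : ℕ} (k δ : ℝ) (q j : Lat n) : Set (Sp n) :=
  {t | (∀ s, t s ∈ Set.Ico (0 : ℝ) 1) ∧
    ‖mom j t‖ = k ∧
    |‖mom (j - q) t‖ ^ 2 - ‖mom j t‖ ^ 2| < k ^ (-(n : ℝ) + 2 - δ) ∧
    ∀ i : Lat n, i ≠ j → i ≠ j - q →
      2 * k ^ (-(n : ℝ) + 2 - 6 * δ) < |‖mom j t‖ ^ 2 - ‖mom i t‖ ^ 2| ∧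
      2 * k ^ (-(n : ℝ) + 2 - 6 * δ) < |‖mom (j - q) t‖ ^ 2 - ‖mom i t‖ ^ 2|}

/-- `γ = min {γ₁, 2 l γ₂}` with `2 γ₁ = 2 l - n - 8 δ`. -/
def gam (n l : ℕ) (δ γ₂ : ℝ) : ℝ := min ((2 * (l : ℝ) - n - 8 * δ) / 2) (2 * l * γ₂)

end Polyharmonic

end

/-! Everything is transferred to Fourier coefficients in `ℓ¹(ℤⁿ)`: convolution models multiplication
of functions, and the `ℓ¹` norm is `‖·‖_*`. On the resonant pair `j, j - q` the model matrix is
diagonalised by orthonormal vectors `e₊, e₋` with eigenvalues `λ⁺` and `λ⁻ = λ⁺ - 2b`, where `b ≥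
|v_q|`. For the potential `V + S`, an eigenvector is sought as `e₊ + α e₋ + g` with `g` off the
pair, and the eigenvalue as `λ⁺ + μ`. The eigenvalue equation then becomes a fixed point equation
for `(μ, α, g)` (`eigMap`). Substituting for `S` the density `σ|u|²` of the trial vector itself
turns the nonlinear problem into a single fixed point equation as well (`nlMap`).

Two small quantities drive the contraction. All other unperturbed eigenvalues are at distance at
least `k^γ` from `λ⁺`, so the reduced resolvent has norm at most `k^(-γ)`; the coupling `|σ||A|²` is
also at most `k^(-γ)`. Although `V` is not small, outside the pair it acts only through the
resolvent. Hence `(μ, α, g) = O(k^(-γ))`.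

The derivative bounds come from the calculus of `BL`: a function of size `a` whose Lipschitz
constant is at most `a * M`, with one common `M`. This class is stable under sums, bilinear maps and
limits. Since all data vary at rate `M = O(k^(2l-1))`, the fixed point, being a limit of iterates,
has size `O(k^(-γ))` and Lipschitz constant `O(k^(-γ+2l-1))`. Differentiability follows from an
implicit function argument (`differentiableAt_of_fixedPoint`), and the Lipschitz constant then
bounds the gradient. With the unknown or the potential as parameter, the same calculus supplies the
contraction estimates (`Frame.exists_nl`, `Frame.tendsto_iterate`).

That the fixed point is the only eigenvalue in the window is shown for arbitrary `ℓ²` solutions: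
components off `e₊` are at most a quarter of the supremum, the `e₊` component is removed by Green's
identity or by subtraction, and the supremum is halved until it vanishes (`Gaps.isSpectralPair`).
Finally `∇λ⁺` is a convex combination of the gradients at `j` and `j - q`, and the resonance
condition fixes its length up to a relative error `O(k⁻²)` (`NearRes.norm_gradient_lamPlus`). -/

noncomputable section

namespace Polyharmonic

/-! ### Summable sequences: convolution, involution and pairing -/

/-- The space `ℓ¹(ι)` of absolutely summable families of complex numbers. -/
abbrev L1 (ι : Type*) : Type _ := lp (fun _ : ι => ℂ) 1

namespace L1
variable {ι κ : Type*}

lemma hasSum_norm (f : L1 ι) : HasSum (fun i => ‖f i‖) ‖f‖ := by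
  simpa using lp.hasSum_norm (p := 1) (by simp) f

lemma summable_norm (f : L1 ι) : Summable fun i => ‖f i‖ := (hasSum_norm f).summable

lemma norm_eq (f : L1 ι) : ‖f‖ = ∑' i, ‖f i‖ := (hasSum_norm f).tsum_eq.symm

lemma norm_apply_le (f : L1 ι) (i : ι) : ‖f i‖ ≤ ‖f‖ :=
  lp.norm_apply_le_norm (by simp) f i

/-- A summable family as an element of `ℓ¹`. -/
def mk (f : ι → ℂ) (hf : Summable fun i => ‖f i‖) : L1 ι :=
  ⟨f, memℓp_gen (by simpa using hf)⟩

@[simp] lemma mk_apply (f : ι → ℂ) (hf) (i : ι) : mk f hf i = f i := rfl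

@[simp] lemma add_apply (f g : L1 ι) (i : ι) : (f + g) i = f i + g i := rfl
@[simp] lemma sub_apply (f g : L1 ι) (i : ι) : (f - g) i = f i - g i := rfl
@[simp] lemma neg_apply (f : L1 ι) (i : ι) : (-f) i = -f i := rfl
@[simp] lemma zero_apply (i : ι) : (0 : L1 ι) i = 0 := rfl
@[simp] lemma smul_apply (c : ℂ) (f : L1 ι) (i : ι) : (c • f) i = c * f i := rfl
@[simp] lemma rsmul_apply (c : ℝ) (f : L1 ι) (i : ι) : (c • f) i = c * f i := by
  rw [show (c • f) i = c • f i from rfl, Complex.real_smul]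

lemma ext {f g : L1 ι} (h : ∀ i, f i = g i) : f = g := lp.ext (funext h)

lemma tens_summable (f : L1 ι) (g : L1 κ) : Summable fun x : ι × κ => ‖f x.1 * g x.2‖ := by
  simpa only [norm_mul] using (summable_norm f).mul_of_nonneg (summable_norm g)
    (fun _ => norm_nonneg _) (fun _ => norm_nonneg _)

lemma norm_mk_tens (f : L1 ι) (g : L1 κ) :
    ‖mk (fun x : ι × κ => f x.1 * g x.2) (tens_summable f g)‖ = ‖f‖ * ‖g‖ := by
  rw [norm_eq, norm_eq f, norm_eq g]
  simp only [mk_apply, norm_mul]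
  rw [(summable_norm f).tsum_mul_tsum (summable_norm g)]
  exact (summable_norm f).mul_of_nonneg (summable_norm g)
    (fun _ => norm_nonneg _) (fun _ => norm_nonneg _)

/-- The outer product `(f ⊗ g)_{(a, b)} = f_a g_b`. -/
def tens : L1 ι →L[ℝ] L1 κ →L[ℝ] L1 (ι × κ) :=
  LinearMap.mkContinuous₂
    (LinearMap.mk₂ ℝ (fun f g => mk (fun x : ι × κ => f x.1 * g x.2) (tens_summable f g))
      (fun f f' g => by apply ext; intro i; simp; ring)
      (fun c f g => by apply ext; intro i; simp; ring)
      (fun f g g' => by apply ext; intro i; simp; ring)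
      (fun c f g => by apply ext; intro i; simp; ring)) 1
    (fun f g => by rw [one_mul]; exact (norm_mk_tens f g).le)

@[simp] lemma tens_apply (f : L1 ι) (g : L1 κ) (x : ι × κ) : tens f g x = f x.1 * g x.2 := rfl

lemma norm_tens_le (f : L1 ι) (g : L1 κ) : ‖tens f g‖ ≤ ‖f‖ * ‖g‖ := (norm_mk_tens f g).le

section
variable [AddCommGroup ι]

/-- The substitution `(m, a) ↦ (m - a, a)`. -/
def shear (ι : Type*) [AddCommGroup ι] : ι × ι ≃ ι × ι where
  toFun x := (x.1 - x.2, x.2)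
  invFun x := (x.1 + x.2, x.2)
  left_inv x := by simp
  right_inv x := by simp

lemma shear_summable (F : L1 (ι × ι)) : Summable fun x : ι × ι => ‖F (x.1 - x.2, x.2)‖ :=
  ((shear ι).summable_iff (f := fun x => ‖F x‖)).2 (summable_norm F)

lemma shear_tsum (F : L1 (ι × ι)) : ∑' x : ι × ι, ‖F (x.1 - x.2, x.2)‖ = ‖F‖ := by
  rw [norm_eq]
  exact (shear ι).tsum_eq (f := fun x => ‖F x‖)

lemma fiber_summable (F : L1 (ι × ι)) (m : ι) : Summable fun a => ‖F (m - a, a)‖ :=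
  (shear_summable F).prod_factor m

lemma antidiag_summable (F : L1 (ι × ι)) : Summable fun m => ‖∑' a, F (m - a, a)‖ :=
  Summable.of_nonneg_of_le (fun _ => norm_nonneg _)
    (fun m => norm_tsum_le_tsum_norm (fiber_summable F m)) (shear_summable F).prod

lemma norm_mk_antidiag_le (F : L1 (ι × ι)) :
    ‖mk (fun m => ∑' a, F (m - a, a)) (antidiag_summable F)‖ ≤ ‖F‖ := by
  rw [norm_eq, ← shear_tsum F, (shear_summable F).tsum_prod]
  exact (antidiag_summable F).tsum_le_tsum (fun m => norm_tsum_le_tsum_norm (fiber_summable F m))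
    (shear_summable F).prod

/-- Summation over the antidiagonals: `F ↦ (m ↦ ∑_a F_{(m - a, a)})`. -/
def antidiag : L1 (ι × ι) →L[ℝ] L1 ι :=
  LinearMap.mkContinuous
    { toFun := fun F => mk (fun m => ∑' a, F (m - a, a)) (antidiag_summable F)
      map_add' := fun F G => by
        apply ext; intro m
        simp only [mk_apply, add_apply]
        exact (fiber_summable F m).of_norm.tsum_add (fiber_summable G m).of_norm
      map_smul' := fun c F => by
        apply ext; intro m
        simp only [mk_apply, rsmul_apply, RingHom.id_apply]
        exact tsum_mul_left } 1
    (fun F => by rw [one_mul]; exact norm_mk_antidiag_le F)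

lemma norm_antidiag_le (F : L1 (ι × ι)) : ‖antidiag F‖ ≤ ‖F‖ := norm_mk_antidiag_le F

/-- The convolution `(f ∗ g)_m = ∑_a f_{m-a} g_a`. -/
def conv : L1 ι →L[ℝ] L1 ι →L[ℝ] L1 ι :=
  (ContinuousLinearMap.compL ℝ (L1 ι) (L1 (ι × ι)) (L1 ι) antidiag).comp tens

lemma conv_apply (f g : L1 ι) (m : ι) : conv f g m = ∑' a, f (m - a) * g a := rfl

lemma norm_conv_le (f g : L1 ι) : ‖conv f g‖ ≤ ‖f‖ * ‖g‖ :=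
  (norm_antidiag_le _).trans (norm_tens_le f g)

lemma refl_summable (f : L1 ι) : Summable fun a => ‖conj (f (-a))‖ := by
  simpa [Function.comp_def] using
    ((Equiv.neg ι).summable_iff (f := fun x => ‖f x‖)).2 (summable_norm f)

lemma norm_mk_refl (f : L1 ι) : ‖mk (fun a => conj (f (-a))) (refl_summable f)‖ = ‖f‖ := by
  rw [norm_eq, norm_eq]
  simp only [mk_apply, RCLike.norm_conj]
  exact (Equiv.neg ι).tsum_eq (f := fun x => ‖f x‖)

/-- The involution `f ↦ (a ↦ conj f_{-a})`. -/
def refl : L1 ι →L[ℝ] L1 ι :=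
  LinearMap.mkContinuous
    { toFun := fun f => mk (fun a => conj (f (-a))) (refl_summable f)
      map_add' := fun f g => by apply ext; intro m; simp
      map_smul' := fun c f => by apply ext; intro m; simp } 1
    (fun f => by rw [one_mul]; exact (norm_mk_refl f).le)

@[simp] lemma refl_apply (f : L1 ι) (a : ι) : refl f a = conj (f (-a)) := rfl

lemma norm_refl (f : L1 ι) : ‖refl f‖ = ‖f‖ := norm_mk_refl f

end

lemma cj_summable (f : L1 ι) : Summable fun a => ‖conj (f a)‖ := by simpa using summable_norm f

lemma norm_mk_cj (f : L1 ι) : ‖mk (fun a => conj (f a)) (cj_summable f)‖ = ‖f‖ := by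
  rw [norm_eq, norm_eq]; simp

/-- Entrywise complex conjugation. -/
def cj : L1 ι →L[ℝ] L1 ι :=
  LinearMap.mkContinuous
    { toFun := fun f => mk (fun a => conj (f a)) (cj_summable f)
      map_add' := fun f g => by apply ext; intro m; simp
      map_smul' := fun c f => by apply ext; intro m; simp } 1
    (fun f => by rw [one_mul]; exact (norm_mk_cj f).le)

@[simp] lemma cj_apply (f : L1 ι) (a : ι) : cj f a = conj (f a) := rfl

lemma norm_cj (f : L1 ι) : ‖cj f‖ = ‖f‖ := norm_mk_cj f

/-- The coordinate functional `f ↦ f_i`. -/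
def coord (i : ι) : L1 ι →L[ℝ] ℂ := (lp.evalCLM ℝ (fun _ : ι => ℂ) 1 i)

@[simp] lemma coord_apply (i : ι) (f : L1 ι) : coord i f = f i := rfl

/-- The sesquilinear pairing `⟨f, g⟩ = ∑_i conj f_i g_i`, conjugate linear in the first entry. -/
def pair [AddCommGroup ι] : L1 ι →L[ℝ] L1 ι →L[ℝ] ℂ :=
  -- The pairing is the coefficient at 0 of `refl f ∗ g`, so continuity and the norm bound are
  -- inherited from `conv`.
  ((ContinuousLinearMap.compL ℝ (L1 ι) (L1 ι) ℂ (coord 0)).comp conv).comp refl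

lemma pair_apply [AddCommGroup ι] (f g : L1 ι) : pair f g = ∑' i, conj (f i) * g i := by
  change conv (refl f) g 0 = _
  rw [conv_apply]; simp

lemma norm_pair_le [AddCommGroup ι] (f g : L1 ι) : ‖pair f g‖ ≤ ‖f‖ * ‖g‖ := by
  change ‖conv (refl f) g 0‖ ≤ _
  refine (norm_apply_le _ _).trans ((norm_conv_le _ _).trans ?_)
  rw [norm_refl]

lemma pair_conj [AddCommGroup ι] (f g : L1 ι) : conj (pair f g) = pair g f := by
  rw [pair_apply, pair_apply, Complex.conj_tsum]; simp [mul_comm]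

lemma pair_self [AddCommGroup ι] (f : L1 ι) : pair f f = ((∑' i, ‖f i‖ ^ 2 : ℝ) : ℂ) := by
  rw [pair_apply, Complex.ofReal_tsum]
  congr 1; ext i; rw [Complex.conj_mul']; simp

lemma summable_sq (f : L1 ι) : Summable fun i => ‖f i‖ ^ 2 := by
  refine Summable.of_nonneg_of_le (fun _ => by positivity) (fun i => ?_) ((summable_norm f).mul_left ‖f‖)
  rw [sq]; gcongr; exact norm_apply_le f i

/-- Multiplication by a bounded real sequence. -/
def mulB [TopologicalSpace ι] : BoundedContinuousFunction ι ℝ →L[ℝ] L1 ι →L[ℝ] L1 ι :=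
  have key : ∀ (r : BoundedContinuousFunction ι ℝ) (f : L1 ι) i, ‖(r i : ℂ) * f i‖ ≤ ‖r‖ * ‖f i‖ :=
    fun r f i => by
      rw [norm_mul, Complex.norm_real]; gcongr; exact r.norm_coe_le_norm i
  have key2 : ∀ (r : BoundedContinuousFunction ι ℝ) (f : L1 ι), Summable fun i => ‖(r i : ℂ) * f i‖ :=
    fun r f => Summable.of_nonneg_of_le (fun _ => norm_nonneg _) (key r f)
      ((summable_norm f).mul_left _)
  LinearMap.mkContinuous₂
    (LinearMap.mk₂ ℝ (fun r f => mk (fun i => (r i : ℂ) * f i) (key2 r f))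
      (fun f f' g => by apply ext; intro i; simp; ring)
      (fun c f g => by apply ext; intro i; simp; ring)
      (fun f g g' => by apply ext; intro i; simp; ring)
      (fun c f g => by apply ext; intro i; simp; ring)) 1
    (fun r f => by
      rw [norm_eq, one_mul, norm_eq f, ← tsum_mul_left]
      exact (key2 r f).tsum_le_tsum (key r f) ((summable_norm f).mul_left _))

@[simp] lemma mulB_apply [TopologicalSpace ι] (r : BoundedContinuousFunction ι ℝ) (f : L1 ι) (i : ι) :
    mulB r f i = (r i : ℂ) * f i := rfl

lemma norm_mulB_le [TopologicalSpace ι] (r : BoundedContinuousFunction ι ℝ) (f : L1 ι) :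
    ‖mulB r f‖ ≤ ‖r‖ * ‖f‖ := by
  rw [norm_eq, norm_eq f, ← tsum_mul_left]
  refine (summable_norm _).tsum_le_tsum (fun i => ?_) ((summable_norm f).mul_left _)
  rw [mulB_apply, norm_mul, Complex.norm_real]; gcongr; exact r.norm_coe_le_norm i

/-- The unit vector at `i`. -/
def unit [DecidableEq ι] (i : ι) : L1 ι := lp.single 1 i (1 : ℂ)

lemma unit_apply [DecidableEq ι] (i k : ι) : unit i k = if k = i then 1 else 0 := by
  rw [unit, lp.single_apply]; simp [Pi.single_apply]

@[simp] lemma norm_unit [DecidableEq ι] (i : ι) : ‖unit i‖ = 1 := by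
  rw [unit, lp.norm_single (by simp)]; simp

end L1

/-! ### Absolutely convergent Fourier series -/

section PlaneWaves
variable {n : ℕ}

lemma mom_apply (a : Lat n) (t : Sp n) (s : Fin n) : mom a t s = a s + t s := rfl

lemma mom_add (a b : Lat n) (t u : Sp n) : mom (a + b) (t + u) = mom a t + mom b u := by
  ext s; simp [mom_apply]; ring

lemma mom_neg (a : Lat n) : mom (-a) 0 = -mom a 0 := by
  ext s; simp [mom_apply]

lemma mom_eq (a : Lat n) (t : Sp n) : mom a t = mom a 0 + t := by
  ext s; simp [mom_apply]

lemma norm_planeWave (ξ x : Sp n) : ‖planeWave ξ x‖ = 1 := by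
  rw [planeWave, Complex.norm_exp]; simp

lemma planeWave_add (ξ η x : Sp n) : planeWave (ξ + η) x = planeWave ξ x * planeWave η x := by
  simp only [planeWave, inner_add_left, ← Complex.exp_add]; push_cast; ring_nf

lemma conj_planeWave (ξ x : Sp n) : conj (planeWave ξ x) = planeWave (-ξ) x := by
  simp only [planeWave, ← Complex.exp_conj]; simp

lemma continuous_planeWave (ξ : Sp n) : Continuous (planeWave ξ) := by
  unfold planeWave; fun_prop

lemma inner_mom_eq (a : Lat n) (x : Sp n) : inner ℝ (mom a 0) x = ∑ s, (a s : ℝ) * x s := by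
  rw [PiLp.inner_apply]; simp [mom_apply, mul_comm]

lemma planeWave_periodic (a b : Lat n) (x : Sp n) :
    planeWave (mom a 0) (x + (2 * Real.pi) • mom b 0) = planeWave (mom a 0) x := by
  have : inner ℝ (mom a 0) (x + (2 * Real.pi) • mom b 0)
      = inner ℝ (mom a 0) x + ((∑ s, a s * b s : ℤ) : ℝ) * (2 * Real.pi) := by
    rw [inner_add_right, inner_smul_right, inner_mom_eq a (mom b 0)]
    simp [mom_apply]; ring
  rw [planeWave, this, planeWave]
  rw [Complex.exp_eq_exp_iff_exists_int]
  exact ⟨∑ s, a s * b s, by push_cast; ring⟩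

/-- The function `∑_a f_a exp(i⟨a, x⟩)`. -/
def ser (f : L1 (Lat n)) (x : Sp n) : ℂ := ∑' a, f a * planeWave (mom a 0) x

lemma norm_ser_term (f : L1 (Lat n)) (x : Sp n) (a : Lat n) :
    ‖f a * planeWave (mom a 0) x‖ = ‖f a‖ := by rw [norm_mul, norm_planeWave, mul_one]

lemma ser_summable (f : L1 (Lat n)) (x : Sp n) :
    Summable fun a => f a * planeWave (mom a 0) x := by
  refine Summable.of_norm ?_
  simpa only [norm_ser_term] using L1.summable_norm f

lemma ser_add (f g : L1 (Lat n)) (x : Sp n) : ser (f + g) x = ser f x + ser g x := by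
  rw [ser, ser, ser, ← (ser_summable f x).tsum_add (ser_summable g x)]
  simp [add_mul]

lemma ser_sub (f g : L1 (Lat n)) (x : Sp n) : ser (f - g) x = ser f x - ser g x := by
  rw [ser, ser, ser, ← (ser_summable f x).tsum_sub (ser_summable g x)]
  simp [sub_mul]

lemma ser_smul (c : ℂ) (f : L1 (Lat n)) (x : Sp n) : ser (c • f) x = c * ser f x := by
  rw [ser, ser, ← tsum_mul_left]
  simp [mul_assoc]

lemma ser_refl (f : L1 (Lat n)) (x : Sp n) : ser (L1.refl f) x = conj (ser f x) := by
  rw [ser, ser, Complex.conj_tsum, ← (Equiv.neg (Lat n)).tsum_eq]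
  congr 1; ext a
  simp [conj_planeWave, mom_neg]

/-- Absorbing the plane waves at `x` into the coefficients reduces the claim to `x`-free families,
where it is Fubini for the outer product summed along antidiagonals. -/
lemma ser_conv (f g : L1 (Lat n)) (x : Sp n) : ser (L1.conv f g) x = ser f x * ser g x := by
  set f' : L1 (Lat n) := L1.mk (fun a => f a * planeWave (mom a 0) x)
    (by simpa only [norm_ser_term] using L1.summable_norm f)
  set g' : L1 (Lat n) := L1.mk (fun a => g a * planeWave (mom a 0) x)
    (by simpa only [norm_ser_term] using L1.summable_norm g)
  have h1 : ser (L1.conv f g) x = ∑' m, L1.conv f' g' m := by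
    rw [ser]; congr 1; ext m
    rw [L1.conv_apply, L1.conv_apply, ← tsum_mul_right]
    congr 1; ext a
    have : mom m 0 = mom (m - a) 0 + mom a (0 : Sp n) := by rw [← mom_add]; simp
    simp only [f', g', L1.mk_apply]
    rw [this, planeWave_add]; ring
  have h2 : ser f x * ser g x = ∑' y, L1.tens f' g' y := by
    rw [ser, ser]
    exact tsum_mul_tsum_of_summable_norm (L1.summable_norm f') (L1.summable_norm g')
  rw [h1, h2, ← (L1.shear (Lat n)).tsum_eq]
  exact ((L1.shear_summable (L1.tens f' g')).of_norm.tsum_prod).symm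

lemma continuous_ser (f : L1 (Lat n)) : Continuous (ser f) := by
  refine continuous_tsum (fun a => continuous_const.mul (continuous_planeWave _))
    (L1.summable_norm f) (fun a x => (norm_ser_term f x a).le)

lemma isPeriodic_ser (f : L1 (Lat n)) : IsPeriodic (ser f) := by
  intro x a; simp only [ser, planeWave_periodic]

lemma cell_eq : cell n = WithLp.ofLp ⁻¹' (Set.univ.pi fun _ : Fin n => Set.Icc 0 (2 * Real.pi)) := by
  ext x; simp [cell, Pi.le_def, forall_and]

lemma integral_exp_int (a : ℤ) :
    ∫ y in Set.Icc 0 (2 * Real.pi), Complex.exp (Complex.I * ((a : ℝ) * y : ℝ))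
      = if a = 0 then (2 * Real.pi : ℂ) else 0 := by
  rw [integral_Icc_eq_integral_Ioc, ← intervalIntegral.integral_of_le (by positivity)]
  split_ifs with h
  · simp [h]
  · have hc : Complex.I * a ≠ 0 := mul_ne_zero Complex.I_ne_zero (by exact_mod_cast h)
    have h2 := integral_exp_mul_complex (a := 0) (b := 2 * Real.pi) hc
    have h3 : Complex.exp (Complex.I * a * (2 * Real.pi : ℝ)) = 1 := by
      rw [Complex.exp_eq_one_iff]; exact ⟨a, by push_cast; ring⟩
    rw [h3] at h2
    simp only [Complex.ofReal_zero, mul_zero, Complex.exp_zero, sub_self, zero_div] at h2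
    rw [← h2]; congr 1; ext y; push_cast; ring_nf

lemma integral_planeWave (a : Lat n) :
    ∫ x in cell n, planeWave (mom a 0) x = if a = 0 then ((2 * Real.pi) ^ n : ℂ) else 0 := by
  have h1 : ∀ x : Sp n, planeWave (mom a 0) x =
      ∏ s, Complex.exp (Complex.I * ((a s : ℝ) * (WithLp.ofLp x) s : ℝ)) := by
    intro x
    rw [planeWave, inner_mom_eq, ← Complex.exp_sum]; push_cast; rw [Finset.mul_sum]
  simp_rw [h1]
  rw [cell_eq, (PiLp.volume_preserving_ofLp (Fin n)).setIntegral_preimage_emb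
    (MeasurableEquiv.toLp 2 (Fin n → ℝ)).symm.measurableEmbedding
    (fun y => ∏ s, Complex.exp (Complex.I * ((a s : ℝ) * y s : ℝ)))]
  rw [volume_pi, Measure.restrict_pi_pi]
  rw [integral_fintype_prod_eq_prod (𝕜 := ℂ) (E := fun _ : Fin n => ℝ)
    (fun s y => Complex.exp (Complex.I * ((a s : ℝ) * y : ℝ)))]
  simp_rw [integral_exp_int]
  split_ifs with h
  · simp [h]
  · obtain ⟨s, hs⟩ : ∃ s, a s ≠ 0 := by
      by_contra! hc; exact h (funext hc)
    exact Finset.prod_eq_zero (Finset.mem_univ s) (by simp [hs])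

lemma measure_cell_lt_top : volume (cell n) < ∞ := by
  rw [cell_eq, (PiLp.volume_preserving_ofLp (Fin n)).measure_preimage_emb
    (MeasurableEquiv.toLp 2 (Fin n → ℝ)).symm.measurableEmbedding]
  rw [volume_pi_pi]
  simp only [Real.volume_Icc, Finset.prod_const]
  exact ENNReal.pow_lt_top ENNReal.ofReal_lt_top

/-- Absolute summability permits integration term by term, and orthogonality of the characters
leaves one term. This lets the operator with potential `ser f` be treated as a matrix with entries
from `f`. -/
lemma fourierCoef_ser (f : L1 (Lat n)) (a : Lat n) : fourierCoef (ser f) a = f a := by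
  have hfin : IsFiniteMeasure (volume.restrict (cell n)) :=
    ⟨by simpa using measure_cell_lt_top⟩
  have hnorm : ∀ b x, ‖f b * planeWave (mom b 0) x * planeWave (-mom a 0) x‖ = ‖f b‖ := by
    intro b x; simp [norm_planeWave]
  have h1 : ∀ b, Integrable (fun x => f b * planeWave (mom b 0) x * planeWave (-mom a 0) x)
      (volume.restrict (cell n)) := by
    intro b
    refine Integrable.of_bound (C := ‖f b‖) ?_ (ae_of_all _ fun x => (hnorm b x).le)
    exact ((continuous_const.mul (continuous_planeWave _)).mul
      (continuous_planeWave _)).aestronglyMeasurable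
  have h2 : Summable fun b => ∫ x in cell n,
      ‖f b * planeWave (mom b 0) x * planeWave (-mom a 0) x‖ := by
    simp only [hnorm, setIntegral_const]
    exact (L1.summable_norm f).const_smul _
  have h3 := integral_tsum_of_summable_integral_norm h1 h2
  have h4 : ∀ b, ∫ x in cell n, f b * planeWave (mom b 0) x * planeWave (-mom a 0) x
      = if b = a then f b * ((2 * Real.pi) ^ n : ℂ) else 0 := by
    intro b
    have : ∀ x, f b * planeWave (mom b 0) x * planeWave (-mom a 0) x
        = f b * planeWave (mom (b - a) 0) x := by
      intro x
      rw [mul_assoc, ← planeWave_add, ← mom_neg, ← mom_add]; simp [sub_eq_add_neg]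
    simp_rw [this]
    rw [integral_const_mul, integral_planeWave]
    simp [sub_eq_zero]
  rw [fourierCoef]
  simp_rw [ser, ← tsum_mul_right]
  rw [← h3]
  simp_rw [h4]
  rw [tsum_ite_eq]
  have : ((2 * Real.pi) ^ n : ℂ) ≠ 0 := by
    have := Real.pi_ne_zero
    exact pow_ne_zero _ (by exact_mod_cast (by positivity))
  push_cast
  field_simp

lemma starNorm_ser (f : L1 (Lat n)) : starNorm (ser f) = ENNReal.ofReal ‖f‖ := by
  rw [starNorm, L1.norm_eq, ENNReal.ofReal_tsum_of_nonneg (fun _ => norm_nonneg _)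
    (L1.summable_norm f)]
  simp_rw [fourierCoef_ser, ofReal_norm]

/-- A finitely supported family as an element of `ℓ¹`. -/
def coefs (v : Lat n →₀ ℂ) : L1 (Lat n) :=
  L1.mk v (summable_of_hasFiniteSupport (v.hasFiniteSupport.subset (by intro a; simp)))

@[simp] lemma coefs_apply (v : Lat n →₀ ℂ) (a : Lat n) : coefs v a = v a := rfl

lemma trigPoly_eq (v : Lat n →₀ ℂ) : trigPoly v = ser (coefs v) := by
  ext x
  rw [trigPoly, ser, Finsupp.sum, tsum_eq_sum (s := v.support)]
  · simp
  · intro a ha; simp only [Finsupp.mem_support_iff, not_not] at ha; simp [ha]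

/-- The quasiperiodic factor `exp(i⟨t, x⟩)` has modulus one and drops out, so the density is
periodic with coefficients `ψ ∗ refl ψ`. -/
lemma normSq_planeWave_series (A : ℂ) (ψ : L1 (Lat n)) (t x : Sp n) :
    ((‖A * ∑' s, ψ s * planeWave (mom s t) x‖ ^ 2 : ℝ) : ℂ)
      = ((‖A‖ ^ 2 : ℝ) : ℂ) * ser (L1.conv ψ (L1.refl ψ)) x := by
  have h : ∑' s, ψ s * planeWave (mom s t) x = ser ψ x * planeWave t x := by
    rw [ser, ← tsum_mul_right]
    congr 1; ext s; rw [mom_eq, planeWave_add]; ring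
  rw [h, norm_mul, norm_mul, norm_planeWave, mul_one, ser_conv, ser_refl, Complex.mul_conj']
  push_cast; ring

end PlaneWaves

/-! ### Calculus of functions with proportional size and Lipschitz constant -/

/-- `f` is bounded by `a` on `U` and Lipschitz there with constant `a * M`. -/
structure BL {T F : Type*} [PseudoMetricSpace T] [NormedAddCommGroup F] (U : Set T) (M a : ℝ)
    (f : T → F) : Prop where
  hM : 0 ≤ M
  ha : 0 ≤ a
  bound : ∀ t ∈ U, ‖f t‖ ≤ a
  lip : ∀ t ∈ U, ∀ t' ∈ U, ‖f t - f t'‖ ≤ a * M * dist t t'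

namespace BL
variable {T E F G : Type*} [PseudoMetricSpace T] [NormedAddCommGroup E] [NormedAddCommGroup F]
  [NormedAddCommGroup G] {U : Set T} {M a b : ℝ}

lemma const {c : F} (hM : 0 ≤ M) (hc : ‖c‖ ≤ a) : BL U M a (fun _ : T => c) where
  hM := hM
  ha := (norm_nonneg _).trans hc
  bound _ _ := hc
  lip t _ t' _ := by
    have := (norm_nonneg c).trans hc
    rw [sub_self, norm_zero]; positivity

lemma mono {f : T → F} (h : BL U M a f) (hab : a ≤ b) : BL U M b f where
  hM := h.hM
  ha := h.ha.trans hab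
  bound t ht := (h.bound t ht).trans hab
  lip t ht t' ht' := (h.lip t ht t' ht').trans (by have := h.hM; gcongr)

lemma congr {f g : T → F} (h : BL U M a f) (hfg : ∀ t ∈ U, g t = f t) : BL U M a g where
  hM := h.hM
  ha := h.ha
  bound t ht := by rw [hfg t ht]; exact h.bound t ht
  lip t ht t' ht' := by rw [hfg t ht, hfg t' ht']; exact h.lip t ht t' ht'

lemma add {f g : T → F} (hf : BL U M a f) (hg : BL U M b g) :
    BL U M (a + b) (fun t => f t + g t) where
  hM := hf.hM
  ha := add_nonneg hf.ha hg.ha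
  bound t ht := (norm_add_le _ _).trans (add_le_add (hf.bound t ht) (hg.bound t ht))
  lip t ht t' ht' := by
    calc ‖f t + g t - (f t' + g t')‖ = ‖(f t - f t') + (g t - g t')‖ := by congr 1; abel
      _ ≤ a * M * dist t t' + b * M * dist t t' :=
        (norm_add_le _ _).trans (add_le_add (hf.lip t ht t' ht') (hg.lip t ht t' ht'))
      _ = _ := by ring

lemma map {f : T → F} (hf : BL U M a f) (L : F →+ G) (hL : ∀ x, ‖L x‖ ≤ ‖x‖) :
    BL U M a (fun t => L (f t)) where
  hM := hf.hM
  ha := hf.ha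
  bound t ht := (hL _).trans (hf.bound t ht)
  lip t ht t' ht' := by
    rw [← map_sub]; exact (hL _).trans (hf.lip t ht t' ht')

lemma neg {f : T → F} (hf : BL U M a f) : BL U M a (fun t => -f t) :=
  hf.map (-AddMonoidHom.id F) (fun x => by simp)

lemma sub {f g : T → F} (hf : BL U M a f) (hg : BL U M b g) :
    BL U M (a + b) (fun t => f t - g t) := by
  simpa only [sub_eq_add_neg] using hf.add hg.neg

/-- By the product rule each factor contributes `a * b * M` to the Lipschitz constant, whence the
factor 2. With `M` fixed, sizes multiply as in an algebra. -/
lemma bilin {f : T → E} {g : T → F} (hf : BL U M a f) (hg : BL U M b g) (B : E →+ F →+ G)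
    (hB : ∀ x y, ‖B x y‖ ≤ ‖x‖ * ‖y‖) : BL U M (2 * a * b) (fun t => B (f t) (g t)) where
  hM := hf.hM
  ha := by have := hf.ha; have := hg.ha; positivity
  bound t ht := by
    have := hf.ha
    have := hg.ha
    calc ‖B (f t) (g t)‖ ≤ ‖f t‖ * ‖g t‖ := hB _ _
      _ ≤ a * b := by gcongr; exacts [hf.bound t ht, hg.bound t ht]
      _ ≤ 2 * a * b := by nlinarith [mul_nonneg hf.ha hg.ha]
  lip t ht t' ht' := by
    have := hf.ha
    have := hg.ha
    have := hf.hM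
    calc ‖B (f t) (g t) - B (f t') (g t')‖
        = ‖B (f t - f t') (g t) + B (f t') (g t - g t')‖ := by
          congr 1; simp only [map_sub, AddMonoidHom.sub_apply]; abel
      _ ≤ ‖f t - f t'‖ * ‖g t‖ + ‖f t'‖ * ‖g t - g t'‖ :=
          (norm_add_le _ _).trans (add_le_add (hB _ _) (hB _ _))
      _ ≤ (a * M * dist t t') * b + a * (b * M * dist t t') := by
          gcongr
          exacts [hf.lip t ht t' ht', hg.bound t ht, hf.bound t' ht', hg.lip t ht t' ht']
      _ = 2 * a * b * M * dist t t' := by ring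

lemma clm₂ [NormedSpace ℝ E] [NormedSpace ℝ F] [NormedSpace ℝ G] {f : T → E} {g : T → F}
    (hf : BL U M a f) (hg : BL U M b g) (B : E →L[ℝ] F →L[ℝ] G)
    (hB : ∀ x y, ‖B x y‖ ≤ ‖x‖ * ‖y‖) : BL U M (2 * a * b) (fun t => B (f t) (g t)) :=
  hf.bilin hg (AddMonoidHom.mk' (fun x => ((B x : F →L[ℝ] G) : F →+ G))
    (fun x y => by ext z; simp)) hB

lemma clm [NormedSpace ℝ F] [NormedSpace ℝ G] {f : T → F} (hf : BL U M a f) (L : F →L[ℝ] G)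
    (hL : ∀ x, ‖L x‖ ≤ ‖x‖) : BL U M a (fun t => L (f t)) :=
  hf.map (L : F →+ G) hL

lemma smul {𝕜 : Type*} [NormedField 𝕜] [NormedSpace 𝕜 F] {f : T → 𝕜} {g : T → F}
    (hf : BL U M a f) (hg : BL U M b g) : BL U M (2 * a * b) (fun t => f t • g t) :=
  hf.bilin hg (AddMonoidHom.mk' (fun x => AddMonoidHom.mk' (fun y => x • y) (smul_add x))
    (fun x y => by ext z; exact add_smul x y z)) (fun x y => (norm_smul x y).le)

lemma prodMk {f : T → E} {g : T → F} (hf : BL U M a f) (hg : BL U M a g) :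
    BL U M a (fun t => (f t, g t)) where
  hM := hf.hM
  ha := hf.ha
  bound t ht := norm_prod_le_iff.2 ⟨hf.bound t ht, hg.bound t ht⟩
  lip t ht t' ht' := norm_prod_le_iff.2 ⟨hf.lip t ht t' ht', hg.lip t ht t' ht'⟩

lemma fst {f : T → E × F} (hf : BL U M a f) : BL U M a (fun t => (f t).1) :=
  hf.map (AddMonoidHom.fst E F) norm_fst_le

lemma snd {f : T → E × F} (hf : BL U M a f) : BL U M a (fun t => (f t).2) :=
  hf.map (AddMonoidHom.snd E F) norm_snd_le

/-- The constant `c` must dominate both `m⁻¹`, for the size, and `a / m ^ 2`, for the Lipschitz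
constant. -/
lemma inv {f : T → ℝ} {m c : ℝ} (hf : BL U M a f) (hm : 0 < m) (h : ∀ t ∈ U, m ≤ f t)
    (h1 : m⁻¹ ≤ c) (h2 : a / m ^ 2 ≤ c) : BL U M c (fun t => (f t)⁻¹) where
  hM := hf.hM
  ha := (inv_nonneg.2 hm.le).trans h1
  bound t ht := by
    have := h t ht
    rw [Real.norm_of_nonneg (inv_nonneg.2 (hm.le.trans this))]
    exact (inv_anti₀ hm this).trans h1
  lip t ht t' ht' := by
    have i1 := h t ht
    have i2 := h t' ht'
    have p1 := hm.trans_le i1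
    have p2 := hm.trans_le i2
    have hM := hf.hM
    have e : (f t)⁻¹ - (f t')⁻¹ = -(f t - f t') / (f t * f t') := by field_simp; ring
    rw [e, norm_div, norm_neg, Real.norm_of_nonneg (mul_pos p1 p2).le]
    calc ‖f t - f t'‖ / (f t * f t') ≤ (a * M * dist t t') / (m * m) := by
          have := hf.ha
          gcongr
          exact hf.lip t ht t' ht'
      _ = (a / m ^ 2) * M * dist t t' := by ring
      _ ≤ c * M * dist t t' := by gcongr

/-- Uniform bounds for all iterates survive in the limit; this carries size and Lipschitz constant
over to fixed points. -/
lemma of_tendsto {f : ℕ → T → F} {g : T → F} (hf : ∀ m, BL U M a (f m))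
    (h : ∀ t ∈ U, Tendsto (fun m => f m t) atTop (𝓝 (g t))) : BL U M a g where
  hM := (hf 0).hM
  ha := (hf 0).ha
  bound t ht := le_of_tendsto (h t ht).norm (Eventually.of_forall fun m => (hf m).bound t ht)
  lip t ht t' ht' := le_of_tendsto ((h t ht).sub (h t' ht')).norm
    (Eventually.of_forall fun m => (hf m).lip t ht t' ht')

lemma fderiv_le [NormedSpace ℝ E] [NormedSpace ℝ F] {U : Set E} {f : E → F} (hf : BL U M a f)
    {t : E} (hU : U ∈ 𝓝 t) : ‖fderiv ℝ f t‖ ≤ a * M := by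
  refine norm_fderiv_le_of_lip' ℝ (mul_nonneg hf.ha hf.hM) ?_
  filter_upwards [hU] with x hx
  simpa [dist_eq_norm] using hf.lip x hx t (mem_of_mem_nhds hU)

end BL

/-! ### Fixed points and their dependence on a parameter -/

/-- Banach's fixed point theorem on a closed ball. -/
lemma exists_fixedPoint_closedBall {F : Type*} [NormedAddCommGroup F] [CompleteSpace F] {r M a : ℝ}
    {φ : F → F} (hφ : BL (closedBall 0 r) M a φ) (har : a ≤ r) (haM : a * M < 1) :
    ∃ x, ‖x‖ ≤ a ∧ φ x = x ∧ Tendsto (fun m => φ^[m] 0) atTop (𝓝 x) ∧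
      ∀ y, ‖y‖ ≤ r → φ y = y → y = x := by
  have h0 : 0 ≤ a * M := mul_nonneg hφ.ha hφ.hM
  have hr : 0 ≤ r := hφ.ha.trans har
  have hmaps : Set.MapsTo φ (closedBall 0 r) (closedBall 0 r) := fun x hx =>
    mem_closedBall_zero_iff.2 ((hφ.bound x hx).trans har)
  have hc : ContractingWith ⟨a * M, h0⟩ (hmaps.restrict φ _ _) := by
    refine ⟨by exact_mod_cast haM, LipschitzWith.of_dist_le_mul fun x y => ?_⟩
    rw [Subtype.dist_eq, Subtype.dist_eq, dist_eq_norm]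
    exact hφ.lip x x.2 y y.2
  obtain ⟨x, hx, hfix, htend, -⟩ := hc.exists_fixedPoint' (isClosed_closedBall.isComplete) hmaps
    (x := 0) (mem_closedBall_self hr) (edist_ne_top _ _)
  have hfix' : φ x = x := hfix
  refine ⟨x, ?_, hfix, htend, ?_⟩
  · rw [← hfix']; exact hφ.bound x hx
  · intro y hy hyf
    have := hφ.lip y (mem_closedBall_zero_iff.2 hy) x hx
    rw [hyf, hfix', dist_eq_norm] at this
    have h2 := norm_nonneg (y - x)
    have h3 : ‖y - x‖ = 0 := by nlinarith
    exact sub_eq_zero.1 (norm_eq_zero.1 h3)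

/-- Differentiability of the solution of `x = Θ(t, x)`. -/
lemma differentiableAt_of_fixedPoint {E F : Type*} [NormedAddCommGroup E] [NormedSpace ℝ E]
    [NormedAddCommGroup F] [NormedSpace ℝ F] [CompleteSpace F] {Θ : E × F → F} {x : E → F} {t₀ : E}
    {K L : ℝ} (hΘ : DifferentiableAt ℝ Θ (t₀, x t₀)) (hfix : ∀ᶠ t in 𝓝 t₀, Θ (t, x t) = x t)
    (hlip : ∀ᶠ t in 𝓝 t₀, ‖x t - x t₀‖ ≤ L * ‖t - t₀‖) (hK0 : 0 ≤ K) (hK : K < 1)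
    (hcontr : ∀ᶠ y in 𝓝 (x t₀), ‖Θ (t₀, y) - Θ (t₀, x t₀)‖ ≤ K * ‖y - x t₀‖) :
    DifferentiableAt ℝ x t₀ := by
  set D := fderiv ℝ Θ (t₀, x t₀)
  have hD : HasFDerivAt Θ D (t₀, x t₀) := hΘ.hasFDerivAt
  set A : F →L[ℝ] F := D.comp (ContinuousLinearMap.inr ℝ E F)
  have hA : HasFDerivAt (fun y => Θ (t₀, y)) A (x t₀) :=
    HasFDerivAt.comp (x t₀) hD (hasFDerivAt_prodMk_right t₀ (x t₀))
  -- The partial derivative in the unknown inherits the Lipschitz constant `K < 1`, so `1 - A` is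
  -- invertible by the Neumann series.
  have hAK : ‖A‖ < 1 := (hA.le_of_lip' hK0 hcontr).trans_lt hK
  set J : (F →L[ℝ] F)ˣ := Units.oneSub A hAK
  have hJ : ∀ y, (↑J⁻¹ : F →L[ℝ] F) (y - A y) = y := by
    intro y
    have h1 : (↑J⁻¹ : F →L[ℝ] F) * (J : F →L[ℝ] F) = 1 := J.inv_mul
    have h2 := congrArg (fun Z : F →L[ℝ] F => Z y) h1
    simpa [J, Units.val_oneSub] using h2
  have hbig : (fun t => x t - x t₀) =O[𝓝 t₀] fun t => t - t₀ := Asymptotics.IsBigO.of_bound L hlip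
  have hsub : Tendsto (fun t : E => t - t₀) (𝓝 t₀) (𝓝 0) := by
    have : ContinuousAt (fun t : E => t - t₀) t₀ := by fun_prop
    simpa [ContinuousAt] using this
  have hcont : Tendsto (fun t => (t, x t)) (𝓝 t₀) (𝓝 (t₀, x t₀)) := by
    refine tendsto_id.prodMk_nhds ?_
    have := hbig.trans_tendsto hsub
    simpa using this.add_const (x t₀)
  have hlit := hD.isLittleO.comp_tendsto hcont
  have hO : ((fun p : E × F => p - (t₀, x t₀)) ∘ fun t => (t, x t)) =O[𝓝 t₀] fun t => t - t₀ := by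
    simpa [Function.comp_def] using (Asymptotics.isBigO_refl _ _).prod_left hbig
  -- The assumed Lipschitz bound on `x` turns the remainder of `Θ` along `(t, x t)` into `o(t -
  -- t₀)`.
  have h1 := hlit.trans_isBigO hO
  -- Formal differentiation of `x = Θ(t, x)` gives `x' = (1 - A)⁻¹ ∂ₜΘ`.
  refine (HasFDerivAt.of_isLittleO (f' := (↑J⁻¹ : F →L[ℝ] F).comp
    (D.comp (ContinuousLinearMap.inl ℝ E F))) ?_).differentiableAt
  refine (Asymptotics.IsBigO.trans_isLittleO ((↑J⁻¹ : F →L[ℝ] F).isBigO_comp _ _) h1).congr' ?_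
    EventuallyEq.rfl
  filter_upwards [hfix] with t ht
  have h2 : D (t - t₀, x t - x t₀) = D (t - t₀, 0) + A (x t - x t₀) := by
    simp [A, ← map_add]
  simp only [Function.comp_apply, ht, hfix.self_of_nhds, Prod.mk_sub_mk, h2,
    ContinuousLinearMap.comp_apply, ContinuousLinearMap.inl_apply]
  have h3 := hJ (x t - x t₀)
  rw [show x t - x t₀ - (D (t - t₀, 0) + A (x t - x t₀))
    = (x t - x t₀ - A (x t - x t₀)) - D (t - t₀, 0) by abel, map_sub, h3]

/-! ### The reduced fixed point equations -/

section Reduced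
set_option linter.unusedSectionVars false

variable {ι : Type*} [AddCommGroup ι] [TopologicalSpace ι]

/-- The unknowns `(μ, α, g)` of the reduced eigenvalue problem. -/
abbrev Unk (ι : Type*) : Type _ := ℝ × ℂ × L1 ι

/-- The trial eigenvector `e₊ + α e₋ + g`. -/
def trial (ep em : L1 ι) (x : Unk ι) : L1 ι := ep + x.2.1 • em + x.2.2

/-- The part of the eigenvector off the resonant block. -/
def offUpd (ep em : L1 ι) (R : BoundedContinuousFunction ι ℝ) (v S : L1 ι) (x : Unk ι) : L1 ι :=
  L1.mulB R (x.1 • x.2.2 - L1.conv (v + S) (trial ep em x))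

/-- The action of the perturbation on the trial eigenvector, within the resonant block. -/
def resid (ep em : L1 ι) (R : BoundedContinuousFunction ι ℝ) (v S : L1 ι) (x : Unk ι) : L1 ι :=
  L1.conv S (trial ep em x) + L1.conv v (offUpd ep em R v S x)

/-- The map whose fixed points are the eigenpairs with potential `v + S`. -/
def eigMap (ep em : L1 ι) (R : BoundedContinuousFunction ι ℝ) (β : ℝ) (v S : L1 ι) (x : Unk ι) :
    Unk ι :=
  ((L1.pair ep (resid ep em R v S x)).re,
    β • (L1.pair em (resid ep em R v S x) - x.1 • x.2.1), offUpd ep em R v S x)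

/-- `|f|²`, the squared `ℓ²` norm. -/
def mass (f : L1 ι) : ℝ := (L1.pair f f).re

/-- The column `E_{·j}` of the projection on `f`. -/
def column (j : ι) (f : L1 ι) : L1 ι := (mass f)⁻¹ • conj (f j) • f

/-- The Fourier coefficients of `τ |u|²`, where `u` has the coefficients `E_{·j}`. -/
def density (j : ι) (τ : ℝ) (f : L1 ι) : L1 ι := τ • L1.conv (column j f) (L1.refl (column j f))

/-- The map whose fixed points are the eigenpairs of the nonlinear problem. -/
def nlMap (ep em : L1 ι) (R : BoundedContinuousFunction ι ℝ) (β : ℝ) (v : L1 ι) (j : ι) (τ : ℝ)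
    (x : Unk ι) : Unk ι :=
  eigMap ep em R β v (density j τ (trial ep em x)) x

lemma mass_eq (f : L1 ι) : mass f = ∑' i, ‖f i‖ ^ 2 := by
  rw [mass, L1.pair_self, Complex.ofReal_re]

/-- Expanding `|e₊ - f|² ≥ 0` gives `|f|² ≥ 2 Re⟨e₊, f⟩ - 1`. Here `⟨e₊, f⟩ = 1 + ⟨e₊, g⟩` with
`|⟨e₊, g⟩| ≤ 2 · 1/8`, so the bound is `2 · 3/4 - 1`. -/
lemma half_le_mass_trial {ep em : L1 ι} {x : Unk ι} (hp : ‖ep‖ ≤ 2) (h1 : L1.pair ep ep = 1)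
    (h0 : L1.pair ep em = 0) (hx : ‖x‖ ≤ 1 / 8) : 1 / 2 ≤ mass (trial ep em x) := by
  set f := trial ep em x
  have hg : ‖x.2.2‖ ≤ 1 / 8 := (norm_snd_le _).trans ((norm_snd_le _).trans hx)
  have e1 : L1.pair ep f = 1 + L1.pair ep x.2.2 := by
    have : L1.pair ep (x.2.1 • em) = x.2.1 * L1.pair ep em := by
      rw [L1.pair_apply, L1.pair_apply, ← tsum_mul_left]
      congr 1; ext i; simp; ring
    simp only [f, trial, map_add, h1, this, h0]; ring
  have e2 : ‖L1.pair ep x.2.2‖ ≤ 1 / 4 := by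
    refine (L1.norm_pair_le _ _).trans ?_
    nlinarith [norm_nonneg ep, norm_nonneg x.2.2]
  have e3 : 3 / 4 ≤ (L1.pair ep f).re := by
    rw [e1, Complex.add_re, Complex.one_re]
    have := (abs_le.1 (Complex.abs_re_le_norm (L1.pair ep x.2.2))).1
    linarith
  have e4 : 0 ≤ (L1.pair (ep - f) (ep - f)).re := by
    rw [L1.pair_self, Complex.ofReal_re]; positivity
  have e5 : (L1.pair f ep).re = (L1.pair ep f).re := by
    rw [← L1.pair_conj, Complex.conj_re]
  simp only [map_sub, sub_apply, Complex.sub_re, h1, e5, Complex.one_re] at e4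
  change 1 / 2 ≤ (L1.pair f f).re
  linarith

variable {T : Type*} [PseudoMetricSpace T] {U : Set T} {M ε b s ρ V : ℝ}

/-- Bounds for the data of the reduced problem, as functions of a parameter. -/
structure Frame (U : Set T) (M ε b : ℝ) (ep em : T → L1 ι)
    (R : T → BoundedContinuousFunction ι ℝ) (β : T → ℝ) : Prop where
  hp : BL U M 2 ep
  hm : BL U M 2 em
  hR : BL U M ε R
  hβ : BL U M b β
  one : ∀ t ∈ U, L1.pair (ep t) (ep t) = 1
  orth : ∀ t ∈ U, L1.pair (ep t) (em t) = 0

variable {ep em S v' : T → L1 ι} {R : T → BoundedContinuousFunction ι ℝ} {β : T → ℝ} {v : L1 ι}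
  {x : T → Unk ι}

/-- With `t` frozen, the parameter may be the unknown or the potential itself, and the `BL`
estimates turn into contraction estimates. -/
lemma Frame.const {T' : Type*} [PseudoMetricSpace T'] (U' : Set T') {M' : ℝ} (hM : 0 ≤ M')
    (h : Frame U M ε b ep em R β) {t : T} (ht : t ∈ U) :
    Frame U' M' ε b (fun _ => ep t) (fun _ => em t) (fun _ => R t) (fun _ => β t) where
  hp := .const hM (h.hp.bound t ht)
  hm := .const hM (h.hm.bound t ht)
  hR := .const hM (h.hR.bound t ht)
  hβ := .const hM (h.hβ.bound t ht)
  one _ _ := h.one t ht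
  orth _ _ := h.orth t ht

lemma bl_trial (hp : BL U M 2 ep) (hm : BL U M 2 em) (hx : BL U M ρ x) (hρ : ρ ≤ 1) :
    BL U M 7 (fun t => trial (ep t) (em t) (x t)) :=
  ((hp.add (hx.snd.fst.smul hm)).add hx.snd.snd).mono (by linarith)

/-- Constant in the bound for `offUpd`. -/
def offConst (V : ℝ) : ℝ := 2 * (2 + 14 * (V + 1))

/-- Constant in the bound for `eigMap`. -/
def eigConst (V b : ℝ) : ℝ := (4 + 8 * b) * (14 + 2 * V * offConst V) + offConst V

/-- Constant in the bound for `density`. -/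
def densConst : ℝ := 4 * 76832 ^ 2

lemma offConst_pos (hV : 0 ≤ V) : 0 < offConst V := by unfold offConst; positivity

lemma eigConst_pos (hV : 0 ≤ V) (hb : 0 ≤ b) : 0 < eigConst V b := by
  have := offConst_pos hV
  unfold eigConst; positivity

lemma Frame.bl_offUpd (h : Frame U M ε b ep em R β) (hv : ‖v‖ ≤ V) (hS : BL U M s S)
    (hx : BL U M ρ x) (hs : s ≤ 1) (hρ : ρ ≤ 1) :
    BL U M (offConst V * ε) (fun t => offUpd (ep t) (em t) (R t) v (S t) (x t)) := by
  have h1 := (bl_trial h.hp h.hm hx hρ)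
  have h2 := ((BL.const (c := v) hx.hM hv).add hS).clm₂ h1 L1.conv L1.norm_conv_le
  have h3 := h.hR.clm₂ ((hx.fst.smul hx.snd.snd).sub h2) L1.mulB L1.norm_mulB_le
  refine h3.mono ?_
  have hε := h.hR.ha
  have hV := (norm_nonneg _).trans hv
  have : 2 * ρ * ρ + 2 * (V + s) * 7 ≤ 2 + 14 * (V + 1) := by nlinarith [hx.ha, hS.ha]
  unfold offConst
  nlinarith

lemma Frame.bl_resid (h : Frame U M ε b ep em R β) (hv : ‖v‖ ≤ V) (hS : BL U M s S)
    (hx : BL U M ρ x) (hs : s ≤ 1) (hρ : ρ ≤ 1) :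
    BL U M ((14 + 2 * V * offConst V) * (s + ε))
      (fun t => resid (ep t) (em t) (R t) v (S t) (x t)) := by
  have h1 := (bl_trial h.hp h.hm hx hρ)
  have h2 := (hS.clm₂ h1 L1.conv L1.norm_conv_le).add
    ((BL.const (c := v) hx.hM hv).clm₂ (h.bl_offUpd hv hS hx hs hρ) L1.conv L1.norm_conv_le)
  refine h2.mono ?_
  have hε := h.hR.ha
  have hs0 := hS.ha
  have hV := (norm_nonneg _).trans hv
  have := mul_nonneg (mul_nonneg hV (offConst_pos hV).le) hs0
  nlinarith

lemma Frame.bl_eigMap (h : Frame U M ε b ep em R β) (hv : ‖v‖ ≤ V) (hS : BL U M s S)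
    (hx : BL U M ρ x) (hs : s ≤ 1) (hρ : ρ ≤ 1) (hbρ : 8 * b * ρ ≤ 1) :
    BL U M (eigConst V b * (s + ε) + ρ / 2)
      (fun t => eigMap (ep t) (em t) (R t) (β t) v (S t) (x t)) := by
  have hε := h.hR.ha
  have hs0 := hS.ha
  have hb := h.hβ.ha
  have hρ0 := hx.ha
  have hV := (norm_nonneg _).trans hv
  have hO := offConst_pos hV
  have hr := h.bl_resid hv hS hx hs hρ
  set c := 14 + 2 * V * offConst V with hc
  have hc0 : 0 ≤ c := by positivity
  have hcs : 0 ≤ c * (s + ε) := by positivity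
  have h1 := (h.hp.clm₂ hr L1.pair L1.norm_pair_le).clm Complex.reCLM
    (fun z => Complex.abs_re_le_norm z)
  -- The quadratic term `μ α` contributes `2 b · 2ρ²`, which `hbρ` bounds by `ρ / 2`. This is the
  -- source of the self-referential term in the bound.
  have h2 := h.hβ.smul ((h.hm.clm₂ hr L1.pair L1.norm_pair_le).sub (hx.fst.smul hx.snd.fst))
  have h3 := h.bl_offUpd hv hS hx hs hρ
  have e : eigConst V b * (s + ε) = 4 * (c * (s + ε)) + 8 * b * (c * (s + ε))
    + offConst V * (s + ε) := by unfold eigConst; ring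
  have p1 : 0 ≤ b * (c * (s + ε)) := by positivity
  have p2 : 0 ≤ offConst V * s := by positivity
  have p3 : 0 ≤ offConst V * ε := by positivity
  refine BL.prodMk (h1.mono ?_) (BL.prodMk (h2.mono ?_) (h3.mono ?_))
  · rw [e]; nlinarith
  · rw [e]; nlinarith
  · rw [e]; nlinarith

/-- The constants multiply up as follows: `98 = 2 · 7 · 7` for the mass, `392 = 98 / (1/2)²` for its
reciprocal, and `76832 = 2 · 392 · 98` for the column. -/
lemma bl_density (j : ι) {τ : ℝ} {f : T → L1 ι} (hf : BL U M 7 f)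
    (hm : ∀ t ∈ U, 1 / 2 ≤ mass (f t)) : BL U M (densConst * |τ|) (fun t => density j τ (f t)) := by
  have h1 : BL U M (2 * 7 * 7) (fun t => mass (f t)) :=
    (hf.clm₂ hf L1.pair L1.norm_pair_le).clm Complex.reCLM (fun z => Complex.abs_re_le_norm z)
  have h2 : BL U M 392 (fun t => (mass (f t))⁻¹) :=
    h1.inv (m := 1 / 2) (by norm_num) hm (by norm_num) (by norm_num)
  have h3 : BL U M 7 (fun t => conj (f t j)) :=
    (hf.clm (L1.coord j) (L1.norm_apply_le · j)).clm (Complex.conjCLE : ℂ →L[ℝ] ℂ) (fun z => by simp)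
  have h4 : BL U M 76832 (fun t => column j (f t)) := (h2.smul (h3.smul hf)).mono (by norm_num)
  have h5 := (BL.const (T := T) (U := U) (c := τ) (a := |τ|) hf.hM le_rfl).smul
    (h4.clm₂ (h4.clm L1.refl (fun z => (L1.norm_refl z).le)) L1.conv L1.norm_conv_le)
  exact h5.mono (by unfold densConst; linarith)

/-- The smallness conditions on the data of the reduced problem. -/
structure Small (V b ε r s₀ τ : ℝ) : Prop where
  hV : 0 ≤ V
  hb : 0 ≤ b
  r_pos : 0 < r
  r_le : r ≤ 1 / 8
  br : 8 * b * r ≤ 1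
  s_pos : 0 < s₀
  s_le : s₀ ≤ 1
  ε_le : eigConst V b * (s₀ + ε) ≤ r / 4
  τ_le : densConst * |τ| ≤ s₀ / 2

variable {r s₀ τ : ℝ}

lemma Frame.half_le_mass (h : Frame U M ε b ep em R β) (hr : r ≤ 1 / 8) {t : T} (ht : t ∈ U)
    {y : Unk ι} (hy : ‖y‖ ≤ r) : 1 / 2 ≤ mass (trial (ep t) (em t) y) :=
  half_le_mass_trial (h.hp.bound t ht) (h.one t ht) (h.orth t ht) (hy.trans hr)

lemma Frame.bl_density (h : Frame U M ε b ep em R β) (hS : Small V b ε r s₀ τ) (j : ι)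
    (hx : BL U M ρ x) (hρ : ρ ≤ r) :
    BL U M (densConst * |τ|) (fun t => density j τ (trial (ep t) (em t) (x t))) :=
  Polyharmonic.bl_density j (bl_trial h.hp h.hm hx (hρ.trans (by linarith [hS.r_le])))
    (fun t ht => h.half_le_mass hS.r_le ht ((hx.bound t ht).trans hρ))

lemma Frame.bl_nlMap (h : Frame U M ε b ep em R β) (hS : Small V b ε r s₀ τ) (hv : ‖v‖ ≤ V) (j : ι)
    (hx : BL U M ρ x) (hρ : ρ ≤ r) :
    BL U M (eigConst V b * (densConst * |τ| + ε) + ρ / 2)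
      (fun t => nlMap (ep t) (em t) (R t) (β t) v j τ (x t)) := by
  have h1 := h.bl_density hS j hx hρ
  have hρ1 : ρ ≤ 1 := hρ.trans (by linarith [hS.r_le])
  refine h.bl_eigMap hv h1 hx (by linarith [hS.s_pos, hS.s_le, hS.τ_le]) hρ1 ?_
  have := hS.hb
  have := hS.br
  nlinarith [hx.ha]

/-- With `M = r⁻¹`, a map of size `a` in the sense of `BL` has Lipschitz constant `a / r`; any size
below `r` is therefore a contraction. -/
lemma BL.id_ball {F : Type*} [NormedAddCommGroup F] {r : ℝ} (hr : 0 < r) :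
    BL (closedBall (0 : F) r) r⁻¹ r (fun y => y) where
  hM := by positivity
  ha := hr.le
  bound y hy := mem_closedBall_zero_iff.1 hy
  lip y _ y' _ := by rw [mul_inv_cancel₀ hr.ne', one_mul, dist_eq_norm]

lemma Small.eig_le (hS : Small V b ε r s₀ τ) (hs : s ≤ s₀) :
    eigConst V b * (s + ε) ≤ r / 4 := by
  have := eigConst_pos hS.hV hS.hb
  exact le_trans (by gcongr) hS.ε_le

lemma Small.dens_le (hS : Small V b ε r s₀ τ) : densConst * |τ| ≤ s₀ := by
  linarith [hS.τ_le, hS.s_pos]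

/-- Existence and uniqueness for the eigenvalue problem with a given potential. -/
lemma Frame.exists_eig (h : Frame U M ε b ep em R β) (hS : Small V b ε r s₀ τ) (hv : ‖v‖ ≤ V)
    {t : T} (ht : t ∈ U) {S : L1 ι} (hs : ‖S‖ ≤ s₀) :
    ∃ y, ‖y‖ ≤ r ∧ eigMap (ep t) (em t) (R t) (β t) v S y = y ∧
      Tendsto (fun m => (eigMap (ep t) (em t) (R t) (β t) v S)^[m] 0) atTop (𝓝 y) ∧
      ∀ y', ‖y'‖ ≤ r → eigMap (ep t) (em t) (R t) (β t) v S y' = y' → y' = y := by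
  have hr := hS.r_pos
  have hM : (0 : ℝ) ≤ r⁻¹ := by positivity
  have h1 := (h.const (closedBall (0 : Unk ι) r) hM ht).bl_eigMap hv (.const hM hs) (BL.id_ball hr)
    hS.s_le (by linarith [hS.r_le]) hS.br
  have h2 := hS.eig_le le_rfl
  -- The size is at most `r / 4 + r / 2`, so the ball is preserved and the contraction factor is at
  -- most `3 / 4`.
  obtain ⟨y, hy, hy1, hy2, hy3⟩ := exists_fixedPoint_closedBall (r := r) h1 (by linarith) (by
    rw [← div_eq_mul_inv, div_lt_one hr]; linarith)
  exact ⟨y, hy.trans (by linarith), hy1, hy2, hy3⟩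

/-- Existence and uniqueness for the nonlinear problem. -/
lemma Frame.exists_nl (h : Frame U M ε b ep em R β) (hS : Small V b ε r s₀ τ) (hv : ‖v‖ ≤ V) (j : ι)
    {t : T} (ht : t ∈ U) :
    ∃ y, ‖y‖ < r ∧ nlMap (ep t) (em t) (R t) (β t) v j τ y = y ∧
      Tendsto (fun m => (nlMap (ep t) (em t) (R t) (β t) v j τ)^[m] 0) atTop (𝓝 y) ∧
      ∀ y', ‖y'‖ ≤ r → nlMap (ep t) (em t) (R t) (β t) v j τ y' = y' → y' = y := by
  have hr := hS.r_pos
  have hM : (0 : ℝ) ≤ r⁻¹ := by positivity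
  have h1 := (h.const (closedBall (0 : Unk ι) r) hM ht).bl_nlMap hS hv j (BL.id_ball hr) le_rfl
  have h2 := hS.eig_le hS.dens_le
  obtain ⟨y, hy, hy1, hy2, hy3⟩ := exists_fixedPoint_closedBall (r := r) h1 (by linarith) (by
    rw [← div_eq_mul_inv, div_lt_one hr]; linarith)
  exact ⟨y, by linarith, hy1, hy2, hy3⟩

/-- The bounds of the data pass to the solution of the eigenvalue problem. -/
lemma Frame.eig_bl (h : Frame U M ε b ep em R β) (hS : Small V b ε r s₀ τ) (hv : ‖v‖ ≤ V)
    (hs : BL U M s S) (hss : s ≤ s₀) {y : T → Unk ι} (hy : ∀ t ∈ U, Tendsto (fun m =>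
      (eigMap (ep t) (em t) (R t) (β t) v (S t))^[m] 0) atTop (𝓝 (y t))) :
    BL U M (2 * (eigConst V b * (s + ε))) y := by
  have h2 := hS.eig_le hss
  have h3 : 0 ≤ eigConst V b * (s + ε) :=
    mul_nonneg (eigConst_pos hS.hV hS.hb).le (add_nonneg hs.ha h.hR.ha)
  refine BL.of_tendsto (fun m => ?_) hy
  induction m with
  | zero => exact BL.const hs.hM (by simpa using h3)
  | succ m ih =>
    simp only [Function.iterate_succ_apply']
    -- With `c = eigConst V b * (s + ε)`, the bound `2 * c` reproduces itself, as `c + (2 * c) / 2 =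
    -- 2 * c`.
    refine (h.bl_eigMap hv hs ih (hss.trans hS.s_le) (by linarith [hS.r_le]) ?_).mono (by linarith)
    have := hS.br
    have := hS.hb
    nlinarith

/-- The bounds of the data pass to the solution of the nonlinear problem. -/
lemma Frame.nl_bl (h : Frame U M ε b ep em R β) (hM : 0 ≤ M) (hS : Small V b ε r s₀ τ)
    (hv : ‖v‖ ≤ V) (j : ι)
    {y : T → Unk ι} (hy : ∀ t ∈ U, Tendsto (fun m =>
      (nlMap (ep t) (em t) (R t) (β t) v j τ)^[m] 0) atTop (𝓝 (y t))) :
    BL U M (2 * (eigConst V b * (densConst * |τ| + ε))) y := by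
  have h2 := hS.eig_le hS.dens_le
  have h3 : 0 ≤ eigConst V b * (densConst * |τ| + ε) :=
    mul_nonneg (eigConst_pos hS.hV hS.hb).le
      (add_nonneg (by unfold densConst; positivity) h.hR.ha)
  refine BL.of_tendsto (fun m => ?_) hy
  induction m with
  | zero => exact BL.const hM (by simpa using h3)
  | succ m ih =>
    simp only [Function.iterate_succ_apply']
    exact (h.bl_nlMap hS hv j ih (by linarith [hS.r_pos])).mono (by linarith)

/-- Convergence of the successive approximations. -/
lemma Frame.tendsto_iterate (h : Frame U M ε b ep em R β) (hS : Small V b ε r s₀ τ) (hv : ‖v‖ ≤ V)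
    (j : ι) {t : T} (ht : t ∈ U) {Y : L1 ι → Unk ι}
    (hY : ∀ S, ‖S‖ ≤ s₀ → ‖Y S‖ ≤ r ∧ eigMap (ep t) (em t) (R t) (β t) v S (Y S) = Y S)
    {y : Unk ι} (hy : ‖y‖ ≤ r) (hy2 : nlMap (ep t) (em t) (R t) (β t) v j τ y = y) :
    (∀ m, ‖(fun S => density j τ (trial (ep t) (em t) (Y S)))^[m] 0‖ ≤ s₀) ∧
    ‖density j τ (trial (ep t) (em t) y)‖ ≤ s₀ ∧
    Y (density j τ (trial (ep t) (em t) y)) = y ∧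
    Tendsto (fun m => (fun S => density j τ (trial (ep t) (em t) (Y S)))^[m] 0) atTop
      (𝓝 (density j τ (trial (ep t) (em t) y))) := by
  have hs0 := hS.s_pos
  have hM : (0 : ℝ) ≤ s₀⁻¹ := by positivity
  have hbl : BL (closedBall (0 : L1 ι) s₀) s₀⁻¹ (2 * (eigConst V b * (s₀ + ε))) Y := by
    refine (h.const (closedBall (0 : L1 ι) s₀) hM ht).eig_bl hS hv (BL.id_ball hs0) le_rfl ?_
    intro S hSb
    have hSb' := mem_closedBall_zero_iff.1 hSb
    obtain ⟨z, -, -, hz3, hz4⟩ := h.exists_eig hS hv ht hSb'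
    rw [hz4 _ (hY S hSb').1 (hY S hSb').2]
    exact hz3
  have h2 := hS.eig_le le_rfl
  have hd := (h.const (closedBall (0 : L1 ι) s₀) hM ht).bl_density hS j hbl (by linarith [hS.r_pos])
  have h3 := hS.τ_le
  -- By `τ_le` the step from a potential to the next one has contraction factor at most `1 / 2`.
  obtain ⟨S', hS', hfix, htend, huniq⟩ := exists_fixedPoint_closedBall (r := s₀) hd hS.dens_le (by
    rw [← div_eq_mul_inv, div_lt_one hs0]; linarith)
  have hS'' : ‖S'‖ ≤ s₀ := hS'.trans hS.dens_le
  -- A potential fixed by the iteration carries an eigenpair that solves the nonlinear problem;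
  -- uniqueness there identifies it with `y`.
  have hfix2 : nlMap (ep t) (em t) (R t) (β t) v j τ (Y S') = Y S' := by
    rw [nlMap, hfix]; exact (hY S' hS'').2
  obtain ⟨z, -, -, -, hz⟩ := h.exists_nl hS hv j ht
  have hYy : Y S' = y := (hz _ (hY S' hS'').1 hfix2).trans (hz _ hy hy2).symm
  have hlim : density j τ (trial (ep t) (em t) y) = S' := by rw [← hYy]; exact hfix
  refine ⟨fun m => ?_, hlim ▸ hS'', hlim ▸ hYy, hlim ▸ htend⟩
  induction m with
  | zero => simpa using hs0.le
  | succ m ih =>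
    rw [Function.iterate_succ_apply']
    exact (hd.bound _ (mem_closedBall_zero_iff.2 ih)).trans hS.dens_le

end Reduced

/-! ### Differentiability of the solution and of its projection -/

section ReducedDiff
set_option linter.unusedSectionVars false

variable {ι : Type*} [AddCommGroup ι] [TopologicalSpace ι]
  {E : Type*} [NormedAddCommGroup E] [NormedSpace ℝ E]

lemma differentiableAt_trial {ep em : E → L1 ι} {x : E → Unk ι} {t : E}
    (hp : DifferentiableAt ℝ ep t) (hm : DifferentiableAt ℝ em t) (hx : DifferentiableAt ℝ x t) :
    DifferentiableAt ℝ (fun s => trial (ep s) (em s) (x s)) t := by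
  unfold trial; fun_prop

lemma differentiableAt_mass {f : E → L1 ι} {t : E} (hf : DifferentiableAt ℝ f t) :
    DifferentiableAt ℝ (fun s => mass (f s)) t :=
  Complex.reCLM.differentiableAt.comp t
    (f := fun s => L1.pair (f s) (f s)) (by fun_prop)

lemma differentiableAt_density (j : ι) (τ : ℝ) {f : E → L1 ι} {t : E}
    (hf : DifferentiableAt ℝ f t) (h0 : mass (f t) ≠ 0) :
    DifferentiableAt ℝ (fun s => density j τ (f s)) t := by
  have h1 := (differentiableAt_mass hf).inv h0
  have h2 : DifferentiableAt ℝ (fun s => conj (f s j)) t :=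
    (Complex.conjCLE : ℂ →L[ℝ] ℂ).differentiableAt.comp t
      (f := fun s => L1.coord j (f s)) (by fun_prop)
  have h3 : DifferentiableAt ℝ (fun s => column j (f s)) t := by
    unfold column
    exact h1.smul (h2.smul hf)
  unfold density
  fun_prop

lemma differentiableAt_nlMap {ep em : E → L1 ι} {R : E → BoundedContinuousFunction ι ℝ}
    {β : E → ℝ} {x : E → Unk ι} {t : E} (v : L1 ι) (j : ι) (τ : ℝ)
    (hp : DifferentiableAt ℝ ep t) (hm : DifferentiableAt ℝ em t) (hR : DifferentiableAt ℝ R t)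
    (hβ : DifferentiableAt ℝ β t) (hx : DifferentiableAt ℝ x t)
    (h0 : mass (trial (ep t) (em t) (x t)) ≠ 0) :
    DifferentiableAt ℝ (fun s => nlMap (ep s) (em s) (R s) (β s) v j τ (x s)) t := by
  have hf := differentiableAt_trial hp hm hx
  have hd := differentiableAt_density j τ hf h0
  have ho : DifferentiableAt ℝ (fun s => offUpd (ep s) (em s) (R s) v
      (density j τ (trial (ep s) (em s) (x s))) (x s)) t := by
    unfold offUpd; fun_prop
  have hr : DifferentiableAt ℝ (fun s => resid (ep s) (em s) (R s) v
      (density j τ (trial (ep s) (em s) (x s))) (x s)) t := by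
    unfold resid; fun_prop
  unfold nlMap eigMap
  refine DifferentiableAt.prodMk ?_ (DifferentiableAt.prodMk ?_ ho)
  · exact Complex.reCLM.differentiableAt.comp t (f := fun s => L1.pair (ep s) (resid (ep s) (em s)
      (R s) v (density j τ (trial (ep s) (em s) (x s))) (x s)))
      (by fun_prop)
  · fun_prop

variable {U : Set E} {M ε b r s₀ τ V ρ : ℝ} {ep em : E → L1 ι}
  {R : E → BoundedContinuousFunction ι ℝ} {β : E → ℝ} {v : L1 ι} {x : E → Unk ι}

/-- The solution of the nonlinear problem depends differentiably on the parameter. -/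
lemma Frame.differentiableAt (h : Frame U M ε b ep em R β) (hS : Small V b ε r s₀ τ) (hv : ‖v‖ ≤ V)
    (j : ι) {t : E} (hU : U ∈ 𝓝 t) (hp : DifferentiableAt ℝ ep t) (hm : DifferentiableAt ℝ em t)
    (hR : DifferentiableAt ℝ R t) (hβ : DifferentiableAt ℝ β t)
    (hx : ∀ s ∈ U, ‖x s‖ < r ∧ nlMap (ep s) (em s) (R s) (β s) v j τ (x s) = x s)
    (hbl : BL U M ρ x) : DifferentiableAt ℝ x t := by
  have ht : t ∈ U := mem_of_mem_nhds hU
  have hr := hS.r_pos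
  have hM : (0 : ℝ) ≤ r⁻¹ := by positivity
  refine differentiableAt_of_fixedPoint (K := 3 / 4) (L := ρ * M)
    (Θ := fun p : E × Unk ι => nlMap (ep p.1) (em p.1) (R p.1) (β p.1) v j τ p.2)
    ?_ ?_ ?_ (by norm_num) (by norm_num) ?_
  · refine differentiableAt_nlMap (x := fun p : E × Unk ι => p.2) v j τ
      (DifferentiableAt.comp (t, x t) (g := ep) hp differentiableAt_fst)
      (DifferentiableAt.comp (t, x t) (g := em) hm differentiableAt_fst)
      (DifferentiableAt.comp (t, x t) (g := R) hR differentiableAt_fst)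
      (DifferentiableAt.comp (t, x t) (g := β) hβ differentiableAt_fst) differentiableAt_snd ?_
    have := h.half_le_mass hS.r_le ht (hx t ht).1.le
    exact ne_of_gt (lt_of_lt_of_le (by norm_num) this)
  · filter_upwards [hU] with s hs using (hx s hs).2
  · filter_upwards [hU] with s hs
    simpa [dist_eq_norm] using hbl.lip s hs t ht
  -- In the unknown alone, the contraction factor is `3 / 4`, as in the existence proof.
  · have h1 := (h.const (closedBall (0 : Unk ι) r) hM ht).bl_nlMap hS hv j (BL.id_ball hr) le_rfl
    have h2 := hS.eig_le hS.dens_le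
    filter_upwards [isOpen_ball.mem_nhds (mem_ball_zero_iff.2 (hx t ht).1)] with y hy
    refine (h1.lip y (ball_subset_closedBall hy) (x t)
      (mem_closedBall_zero_iff.2 (hx t ht).1.le)).trans ?_
    rw [dist_eq_norm]
    gcongr
    rw [← div_eq_mul_inv, div_le_iff₀ hr]; linarith

/-- The matrix `f f^* / |f|²` of the projection on `f`. -/
def projMat (f : L1 ι) : L1 (ι × ι) := (mass f)⁻¹ • L1.tens f (L1.cj f)

lemma projMat_apply (f : L1 ι) (p q : ι) :
    projMat f (p, q) = ((mass f)⁻¹ : ℝ) * (f p * conj (f q)) := by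
  simp [projMat]

lemma differentiableAt_projMat {f : E → L1 ι} {t : E} (hf : DifferentiableAt ℝ f t)
    (h0 : mass (f t) ≠ 0) : DifferentiableAt ℝ (fun s => projMat (f s)) t := by
  have h1 := (differentiableAt_mass hf).inv h0
  unfold projMat
  exact h1.smul (by fun_prop)

/-- With `f = e₊ + y` one has `f f^*/|f|² - e₊ e₊^* = |f|⁻² (f f^* - e₊ e₊^*) - |f|⁻² (|f|² - 1) e₊
e₊^*`, and both increments are of the order of `y`, hence of `ρ`. The constant is `70560 · (1 + 16)`
with `70560 = 2 · 392 · 90`. -/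
lemma bl_projMat_sub {T : Type*} [PseudoMetricSpace T] {U : Set T} {ep em : T → L1 ι}
    {R : T → BoundedContinuousFunction ι ℝ} {β : T → ℝ} {x : T → Unk ι}
    (h : Frame U M ε b ep em R β) (hx : BL U M ρ x) (hρ : ρ ≤ 1 / 8) :
    BL U M (1199520 * ρ) (fun t => projMat (trial (ep t) (em t) (x t)) - projMat (ep t)) := by
  have hf := bl_trial h.hp h.hm hx (by linarith)
  set f := fun t => trial (ep t) (em t) (x t) with hfdef
  have hy : BL U M (5 * ρ) (fun t => (x t).2.1 • em t + (x t).2.2) :=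
    ((hx.snd.fst.smul h.hm).add hx.snd.snd).mono (by linarith)
  set y := fun t => (x t).2.1 • em t + (x t).2.2 with hydef
  have hfy : ∀ t, f t = ep t + y t := fun t => by simp only [hfdef, hydef, trial]; abel
  have hcj : ∀ z : L1 ι, ‖L1.cj z‖ ≤ ‖z‖ := fun z => (L1.norm_cj z).le
  have h1 : BL U M (90 * ρ)
      (fun t => L1.tens (y t) (L1.cj (f t)) + L1.tens (ep t) (L1.cj (y t))) :=
    ((hy.clm₂ (hf.clm L1.cj hcj) L1.tens L1.norm_tens_le).add
      (h.hp.clm₂ (hy.clm L1.cj hcj) L1.tens L1.norm_tens_le)).mono (by linarith)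
  have h2 : BL U M (90 * ρ) (fun t => (L1.pair (y t) (f t) + L1.pair (ep t) (y t)).re) :=
    (((hy.clm₂ hf L1.pair L1.norm_pair_le).add
      (h.hp.clm₂ hy L1.pair L1.norm_pair_le)).clm Complex.reCLM
        (fun z => Complex.abs_re_le_norm z)).mono (by linarith)
  have h3 : BL U M (2 * 7 * 7) (fun t => mass (f t)) :=
    (hf.clm₂ hf L1.pair L1.norm_pair_le).clm Complex.reCLM (fun z => Complex.abs_re_le_norm z)
  have hmass : ∀ t ∈ U, 1 / 2 ≤ mass (f t) :=
    fun t ht => h.half_le_mass le_rfl ht ((hx.bound t ht).trans hρ)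
  have h4 : BL U M 392 (fun t => (mass (f t))⁻¹) :=
    h3.inv (m := 1 / 2) (by norm_num) hmass (by norm_num) (by norm_num)
  have h5 : BL U M (2 * 2 * 2) (fun t => L1.tens (ep t) (L1.cj (ep t))) :=
    h.hp.clm₂ (h.hp.clm L1.cj hcj) L1.tens L1.norm_tens_le
  refine (((h4.smul h1).sub ((h4.smul h2).smul h5)).congr ?_).mono (by linarith)
  intro t ht
  have hm := hmass t ht
  have hone : mass (ep t) = 1 := by rw [mass, h.one t ht, Complex.one_re]
  have hm1 : mass (f t) - 1 = (L1.pair (y t) (f t) + L1.pair (ep t) (y t)).re := by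
    rw [mass, ← hone, mass, ← Complex.sub_re, hfy t]
    congr 1; simp only [map_add, add_apply]; ring
  have hm2 : (mass (f t))⁻¹ • (mass (f t) - 1) = 1 - (mass (f t))⁻¹ := by
    rw [smul_eq_mul, mul_sub, inv_mul_cancel₀ (by linarith), mul_one]
  have ht1 : L1.tens (f t) (L1.cj (f t)) = L1.tens (ep t) (L1.cj (ep t))
      + (L1.tens (y t) (L1.cj (f t)) + L1.tens (ep t) (L1.cj (y t))) := by
    rw [hfy t]; simp only [map_add, add_apply]; abel
  change projMat (f t) - projMat (ep t) = _
  rw [← hm1, hm2, projMat, projMat, hone, ht1, inv_one, one_smul, smul_add, sub_smul, one_smul]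
  abel

end ReducedDiff

/-! ### Two-level systems in terms of the mixing angle -/

section TwoLevel

lemma abs_sub_le_of_deriv {f f' : ℝ → ℝ} (hf : ∀ x, HasDerivAt f (f' x) x) (hb : ∀ x, |f' x| ≤ 1)
    (x y : ℝ) : |f x - f y| ≤ |x - y| := by
  have := Convex.norm_image_sub_le_of_norm_hasDerivWithin_le (f := f) (f' := f') (s := Set.univ)
    (C := 1) (x := y) (y := x) (fun z _ => (hf z).hasDerivWithinAt) (fun z _ => hb z) convex_univ
    (Set.mem_univ _) (Set.mem_univ _)
  simpa using this

lemma abs_cos_sub_le (x y : ℝ) : |Real.cos x - Real.cos y| ≤ |x - y| :=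
  abs_sub_le_of_deriv (fun z => Real.hasDerivAt_cos z)
    (fun z => by rw [abs_neg]; exact Real.abs_sin_le_one z) x y

lemma abs_sin_sub_le (x y : ℝ) : |Real.sin x - Real.sin y| ≤ |x - y| :=
  abs_sub_le_of_deriv (fun z => Real.hasDerivAt_sin z) (fun z => Real.abs_cos_le_one z) x y

lemma abs_arctan_sub_le (x y : ℝ) : |Real.arctan x - Real.arctan y| ≤ |x - y| :=
  abs_sub_le_of_deriv (fun z => Real.hasDerivAt_arctan z) (fun z => by
    rw [abs_of_nonneg (by positivity), div_le_one (by positivity)]; nlinarith [sq_nonneg z]) x y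

/-- The mixing angle of a two-level system with half-difference `D` and coupling `w`. -/
def angle (w D : ℝ) : ℝ := (Real.pi / 2 - Real.arctan (D / w)) / 2

/-- Half the distance of the eigenvalues of a two-level system. -/
def split (w D : ℝ) : ℝ := √(w ^ 2 + D ^ 2)

variable {w : ℝ}

lemma split_pos (hw : 0 < w) (D : ℝ) : 0 < split w D := Real.sqrt_pos.2 (by positivity)

lemma le_split (w D : ℝ) : w ≤ split w D := Real.le_sqrt_of_sq_le (by nlinarith [sq_nonneg D])

lemma abs_le_split (D : ℝ) : |D| ≤ split w D := Real.abs_le_sqrt (by nlinarith [sq_nonneg w])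

lemma split_le (hw : 0 < w) (D : ℝ) : split w D ≤ |D| + w := by
  refine Real.sqrt_le_iff.2 ⟨by positivity, ?_⟩
  nlinarith [abs_nonneg D, sq_abs D]

lemma split_eq (hw : 0 < w) (D : ℝ) : split w D = w * √(1 + (D / w) ^ 2) := by
  rw [split, ← Real.sqrt_sq hw.le, ← Real.sqrt_mul (sq_nonneg w), Real.sqrt_sq hw.le]
  congr 1; field_simp

lemma cos_two_angle (hw : 0 < w) (D : ℝ) : split w D * Real.cos (2 * angle w D) = D := by
  rw [angle, mul_div_cancel₀ _ two_ne_zero, Real.cos_pi_div_two_sub, Real.sin_arctan, split_eq hw]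
  have : 0 < √(1 + (D / w) ^ 2) := Real.sqrt_pos.2 (by positivity)
  field_simp

lemma sin_two_angle (hw : 0 < w) (D : ℝ) : split w D * Real.sin (2 * angle w D) = w := by
  rw [angle, mul_div_cancel₀ _ two_ne_zero, Real.sin_pi_div_two_sub, Real.cos_arctan, split_eq hw]
  have : 0 < √(1 + (D / w) ^ 2) := Real.sqrt_pos.2 (by positivity)
  field_simp

lemma cos_angle_pos (D : ℝ) : 0 < Real.cos (angle w D) := by
  have h1 := Real.neg_pi_div_two_lt_arctan (D / w)
  have h2 := Real.arctan_lt_pi_div_two (D / w)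
  have h3 := Real.pi_pos
  exact Real.cos_pos_of_mem_Ioo ⟨by unfold angle; linarith, by unfold angle; linarith⟩

/-- The addition formula `cos 2θ cos θ + sin 2θ sin θ = cos θ`. Together with `eig_sin` it says that
`(cos θ, sin θ)` is an eigenvector of `(D, w; w, -D)` for `split w D`. -/
lemma eig_cos (hw : 0 < w) (D : ℝ) :
    D * Real.cos (angle w D) + w * Real.sin (angle w D) = split w D * Real.cos (angle w D) := by
  have h1 := cos_two_angle hw D
  have h2 := sin_two_angle hw D
  set θ := angle w D
  calc D * Real.cos θ + w * Real.sin θ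
      = split w D * (Real.cos (2 * θ) * Real.cos θ + Real.sin (2 * θ) * Real.sin θ) := by
        rw [← h1]; nth_rewrite 2 [← h2]; rw [h1]; linear_combination -(Real.cos θ) * h1
    _ = _ := by rw [← Real.cos_sub]; congr 2; ring

lemma eig_sin (hw : 0 < w) (D : ℝ) :
    w * Real.cos (angle w D) - D * Real.sin (angle w D) = split w D * Real.sin (angle w D) := by
  have h1 := cos_two_angle hw D
  have h2 := sin_two_angle hw D
  set θ := angle w D
  have h3 : Real.sin (2 * θ) * Real.cos θ - Real.cos (2 * θ) * Real.sin θ = Real.sin θ := by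
    rw [← Real.sin_sub]; congr 1; ring
  linear_combination split w D * h3 - Real.cos θ * h2 + Real.sin θ * h1

/-- The eigenvectors rotate faster the weaker the coupling is; this is where the summand `w⁻¹` in
the rate `M` comes from. -/
lemma abs_angle_sub_le (hw : 0 < w) (D D' : ℝ) :
    |angle w D - angle w D'| ≤ |D - D'| / (2 * w) := by
  have h := abs_arctan_sub_le (D / w) (D' / w)
  rw [← sub_div, abs_div, abs_of_pos hw] at h
  have : angle w D - angle w D' = -(Real.arctan (D / w) - Real.arctan (D' / w)) / 2 := by
    unfold angle; ring
  rw [this, abs_div, abs_neg, abs_two]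
  calc _ ≤ |D - D'| / w / 2 := by gcongr
    _ = _ := by rw [div_div, mul_comm w]

/-- Difference of squares: the sum of the two square roots dominates `|D + D'|`. -/
lemma abs_split_sub_le (hw : 0 < w) (D D' : ℝ) : |split w D - split w D'| ≤ |D - D'| := by
  have p1 := split_pos hw D
  have p2 := split_pos hw D'
  have e1 : split w D ^ 2 = w ^ 2 + D ^ 2 := Real.sq_sqrt (by positivity)
  have e2 : split w D' ^ 2 = w ^ 2 + D' ^ 2 := Real.sq_sqrt (by positivity)
  have h1 : |split w D - split w D'| * (split w D + split w D') = |D - D'| * |D + D'| := by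
    rw [← abs_mul (D - D')]
    nth_rewrite 1 [← abs_of_pos (add_pos p1 p2)]
    rw [← abs_mul]
    congr 1; linear_combination e1 - e2
  have h2 : |D + D'| ≤ split w D + split w D' :=
    (abs_add_le _ _).trans (add_le_add (abs_le_split D) (abs_le_split D'))
  have h3 : |split w D - split w D'| * (split w D + split w D')
      ≤ |D - D'| * (split w D + split w D') := by rw [h1]; gcongr
  exact le_of_mul_le_mul_right h3 (add_pos p1 p2)

end TwoLevel

/-! ### The model operator on the resonant pair -/

section Model
variable {n l : ℕ} {v : Lat n →₀ ℂ} {j q : Lat n}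

/-- Half the difference of the diagonal entries of the model matrix. -/
def halfDiff (l : ℕ) (j q : Lat n) (t : Sp n) : ℝ := (freeEig l j t - freeEig l (j - q) t) / 2

lemma halfGap_eq (t : Sp n) : halfGap l v j q t = split ‖v q‖ (halfDiff l j q t) := by
  rw [halfGap, split, halfDiff]
  have : 4 * ‖v q‖ ^ 2 + (freeEig l j t - freeEig l (j - q) t) ^ 2
      = 2 ^ 2 * (‖v q‖ ^ 2 + ((freeEig l j t - freeEig l (j - q) t) / 2) ^ 2) := by ring
  rw [this, Real.sqrt_mul (by positivity), Real.sqrt_sq (by norm_num)]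
  ring

/-- The phase of `v_{-q}`. -/
def phase (v : Lat n →₀ ℂ) (q : Lat n) : ℂ := conj (v q) / ‖v q‖

lemma norm_phase (hq : v q ≠ 0) : ‖phase v q‖ = 1 := by
  rw [phase, norm_div, RCLike.norm_conj, Complex.norm_real, norm_norm]
  exact div_self (norm_ne_zero_iff.2 hq)

lemma norm_mul_phase (hq : v q ≠ 0) : (‖v q‖ : ℂ) * phase v q = conj (v q) := by
  rw [phase, mul_div_cancel₀]; exact_mod_cast norm_ne_zero_iff.2 hq

lemma mul_phase (hq : v q ≠ 0) : v q * phase v q = ‖v q‖ := by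
  have h0 : (‖v q‖ : ℂ) ≠ 0 := by exact_mod_cast norm_ne_zero_iff.2 hq
  rw [phase, mul_div_assoc', Complex.mul_conj', sq, mul_div_assoc, div_self h0, mul_one]

/-- The normalised eigenvector of the model matrix for the larger eigenvalue. -/
def vecPlus (l : ℕ) (v : Lat n →₀ ℂ) (j q : Lat n) (t : Sp n) : L1 (Lat n) :=
  Real.cos (angle ‖v q‖ (halfDiff l j q t)) • L1.unit j +
    Real.sin (angle ‖v q‖ (halfDiff l j q t)) • phase v q • L1.unit (j - q)

/-- The normalised eigenvector of the model matrix for the smaller eigenvalue. -/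
def vecMinus (l : ℕ) (v : Lat n →₀ ℂ) (j q : Lat n) (t : Sp n) : L1 (Lat n) :=
  (-Real.sin (angle ‖v q‖ (halfDiff l j q t))) • L1.unit j +
    Real.cos (angle ‖v q‖ (halfDiff l j q t)) • phase v q • L1.unit (j - q)

lemma pair_block (hq0 : q ≠ 0) (a b : ℝ) (z : ℂ) (f : L1 (Lat n)) :
    L1.pair (a • L1.unit j + b • z • L1.unit (j - q)) f
      = a * f j + b * conj z * f (j - q) := by
  have hne : j - q ≠ j := by simpa using hq0
  rw [L1.pair_apply, tsum_eq_sum (s := {j, j - q})]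
  · rw [Finset.sum_pair hne.symm]
    simp [L1.unit_apply, hne, hne.symm]
  · intro m hm
    simp only [Finset.mem_insert, Finset.mem_singleton, not_or] at hm
    simp [L1.unit_apply, hm.1, hm.2]

lemma pair_vecPlus (hq0 : q ≠ 0) (t : Sp n) (f : L1 (Lat n)) :
    L1.pair (vecPlus l v j q t) f = Real.cos (angle ‖v q‖ (halfDiff l j q t)) * f j
      + Real.sin (angle ‖v q‖ (halfDiff l j q t)) * conj (phase v q) * f (j - q) :=
  pair_block hq0 _ _ _ f

lemma pair_vecMinus (hq0 : q ≠ 0) (t : Sp n) (f : L1 (Lat n)) :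
    L1.pair (vecMinus l v j q t) f = -Real.sin (angle ‖v q‖ (halfDiff l j q t)) * f j
      + Real.cos (angle ‖v q‖ (halfDiff l j q t)) * conj (phase v q) * f (j - q) := by
  rw [vecMinus, pair_block hq0]; push_cast; ring

lemma vecPlus_apply_j (hq0 : q ≠ 0) (t : Sp n) :
    vecPlus l v j q t j = Real.cos (angle ‖v q‖ (halfDiff l j q t)) := by
  have hne : j - q ≠ j := by simpa using hq0
  simp [vecPlus, L1.unit_apply, hne.symm]

lemma vecPlus_apply_jq (hq0 : q ≠ 0) (t : Sp n) :
    vecPlus l v j q t (j - q) = Real.sin (angle ‖v q‖ (halfDiff l j q t)) * phase v q := by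
  have hne : j - q ≠ j := by simpa using hq0
  simp [vecPlus, L1.unit_apply, hq0]

lemma vecPlus_apply_ne (t : Sp n) {i : Lat n} (h1 : i ≠ j) (h2 : i ≠ j - q) :
    vecPlus l v j q t i = 0 := by
  simp [vecPlus, L1.unit_apply, h1, h2]

lemma vecMinus_apply_j (hq0 : q ≠ 0) (t : Sp n) :
    vecMinus l v j q t j = -Real.sin (angle ‖v q‖ (halfDiff l j q t)) := by
  have hne : j - q ≠ j := by simpa using hq0
  simp [vecMinus, L1.unit_apply, hne.symm]

lemma vecMinus_apply_jq (hq0 : q ≠ 0) (t : Sp n) :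
    vecMinus l v j q t (j - q) = Real.cos (angle ‖v q‖ (halfDiff l j q t)) * phase v q := by
  have hne : j - q ≠ j := by simpa using hq0
  simp [vecMinus, L1.unit_apply, hq0]

lemma vecMinus_apply_ne (t : Sp n) {i : Lat n} (h1 : i ≠ j) (h2 : i ≠ j - q) :
    vecMinus l v j q t i = 0 := by
  simp [vecMinus, L1.unit_apply, h1, h2]

lemma phase_mul_conj (hq : v q ≠ 0) : conj (phase v q) * phase v q = 1 := by
  rw [Complex.conj_mul', norm_phase hq]; simp

lemma pair_plus_plus (hq0 : q ≠ 0) (hq : v q ≠ 0) (t : Sp n) :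
    L1.pair (vecPlus l v j q t) (vecPlus l v j q t) = 1 := by
  rw [pair_vecPlus hq0, vecPlus_apply_j hq0, vecPlus_apply_jq hq0]
  set θ := angle ‖v q‖ (halfDiff l j q t)
  have h1 : (Real.cos θ : ℂ) ^ 2 + (Real.sin θ : ℂ) ^ 2 = 1 := by
    exact_mod_cast Real.cos_sq_add_sin_sq θ
  linear_combination h1 + (Real.sin θ : ℂ) ^ 2 * phase_mul_conj hq

lemma pair_plus_minus (hq0 : q ≠ 0) (hq : v q ≠ 0) (t : Sp n) :
    L1.pair (vecPlus l v j q t) (vecMinus l v j q t) = 0 := by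
  rw [pair_vecPlus hq0, vecMinus_apply_j hq0, vecMinus_apply_jq hq0]
  set θ := angle ‖v q‖ (halfDiff l j q t)
  linear_combination (Real.sin θ : ℂ) * Real.cos θ * phase_mul_conj hq

/-- The projection on `vecPlus` is the model projection. -/
lemma projMat_vecPlus (hreal : ∀ a, v (-a) = conj (v a)) (hq0 : q ≠ 0) (hq : v q ≠ 0) (t : Sp n)
    (p r : Lat n) : projMat (vecPlus l v j q t) (p, r) = modelProj l v j q t p r := by
  have hw : 0 < ‖v q‖ := norm_pos_iff.2 hq
  have hne : j - q ≠ j := by simpa using hq0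
  set D := halfDiff l j q t with hD
  have hmass : mass (vecPlus l v j q t) = 1 := by
    rw [mass, pair_plus_plus hq0 hq, Complex.one_re]
  have hlam : freeEig l (j - q) t - lamPlus l v j q t = -(D + split ‖v q‖ D) := by
    rw [lamPlus, halfGap_eq, hD, halfDiff]; ring
  have hc := cos_angle_pos (w := ‖v q‖) D
  have hB := split_pos hw D
  have e1 := cos_two_angle hw D
  have e2 := sin_two_angle hw D
  rw [Real.cos_two_mul] at e1
  rw [Real.sin_two_mul] at e2
  -- By the double angle formulas `-(D + B) = κ cos θ` and `-|v_q| = κ sin θ`, where `B` is the half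
  -- gap, so the unnormalised model eigenvector is `κ` times `vecPlus`. Positivity of `cos θ` makes
  -- `κ` nonzero.
  set κ : ℝ := -(2 * split ‖v q‖ D * Real.cos (angle ‖v q‖ D)) with hκ
  have hκ0 : κ ≠ 0 := by
    have : 0 < 2 * split ‖v q‖ D * Real.cos (angle ‖v q‖ D) := by positivity
    rw [hκ]; exact (neg_lt_zero.2 this).ne
  have hvec : ∀ m, modelVec l v j q t m = κ * vecPlus l v j q t m := by
    intro m
    unfold modelVec
    split_ifs with h1 h2
    · rw [h1, vecPlus_apply_j hq0, hlam, ← Complex.ofReal_mul]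
      congr 1; rw [hκ]; linear_combination e1
    · rw [h2, vecPlus_apply_jq hq0, hreal, ← norm_mul_phase hq]
      have e3 : (‖v q‖ : ℂ) = -κ * Real.sin (angle ‖v q‖ D) := by
        rw [← Complex.ofReal_neg, ← Complex.ofReal_mul]; congr 1; rw [hκ]; linear_combination -e2
      rw [e3]; ring
    · rw [vecPlus_apply_ne t h1 h2, mul_zero]
  have hn : ‖modelVec l v j q t j‖ ^ 2 + ‖modelVec l v j q t (j - q)‖ ^ 2 = κ ^ 2 := by
    rw [hvec, hvec, vecPlus_apply_j hq0, vecPlus_apply_jq hq0]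
    simp only [norm_mul, Complex.norm_real, norm_phase hq, Real.norm_eq_abs, mul_pow, sq_abs]
    have := Real.cos_sq_add_sin_sq (angle ‖v q‖ D)
    linear_combination κ ^ 2 * this
  rw [modelProj, hn, hvec, hvec, projMat_apply, hmass]
  have : (κ : ℂ) ≠ 0 := by exact_mod_cast hκ0
  simp only [map_mul, Complex.conj_ofReal]
  push_cast
  field_simp

variable {U : Set (Sp n)} {L ε : ℝ}

lemma norm_block_le (a b : ℝ) (z : ℂ) (hz : ‖z‖ = 1) :
    ‖a • L1.unit j + b • z • L1.unit (j - q)‖ ≤ |a| + |b| := by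
  refine (norm_add_le _ _).trans ?_
  rw [norm_smul, norm_smul, norm_smul, hz]; simp

/-- The unperturbed eigenvalues on the resonant block vary with speed at most `L`. -/
structure BlockLip (l : ℕ) (j q : Lat n) (U : Set (Sp n)) (L : ℝ) : Prop where
  hL : 0 ≤ L
  lip_j : ∀ t ∈ U, ∀ t' ∈ U, |freeEig l j t - freeEig l j t'| ≤ L * dist t t'
  lip_jq : ∀ t ∈ U, ∀ t' ∈ U, |freeEig l (j - q) t - freeEig l (j - q) t'| ≤ L * dist t t'

lemma BlockLip.halfDiff (h : BlockLip l j q U L) {t t' : Sp n} (ht : t ∈ U) (ht' : t' ∈ U) :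
    |halfDiff l j q t - halfDiff l j q t'| ≤ L * dist t t' := by
  have h1 := abs_le.1 (h.lip_j t ht t' ht')
  have h2 := abs_le.1 (h.lip_jq t ht t' ht')
  unfold Polyharmonic.halfDiff
  rw [abs_le]; constructor <;> linarith [h1.1, h1.2, h2.1, h2.2]

lemma BlockLip.lamPlus (h : BlockLip l j q U L) (hq : v q ≠ 0) {t t' : Sp n} (ht : t ∈ U)
    (ht' : t' ∈ U) : |lamPlus l v j q t - lamPlus l v j q t'| ≤ 2 * L * dist t t' := by
  have h1 := abs_le.1 (h.lip_j t ht t' ht')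
  have h2 := abs_le.1 (h.lip_jq t ht t' ht')
  have h3 := abs_le.1 ((abs_split_sub_le (norm_pos_iff.2 hq) _ _).trans (h.halfDiff ht ht'))
  unfold Polyharmonic.lamPlus
  rw [halfGap_eq, halfGap_eq, abs_le]
  constructor <;> linarith [h1.1, h1.2, h2.1, h2.2, h3.1, h3.2]

variable {w M b : ℝ}

lemma BlockLip.angle (h : BlockLip l j q U L) (hw : 0 < w) (hwq : w ≤ ‖v q‖)
    (hM : L * (3 + w⁻¹) ≤ M) {t t' : Sp n} (ht : t ∈ U) (ht' : t' ∈ U) :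
    |angle ‖v q‖ (Polyharmonic.halfDiff l j q t) - angle ‖v q‖ (Polyharmonic.halfDiff l j q t')|
      ≤ M * dist t t' := by
  have hL := h.hL
  calc _ ≤ |Polyharmonic.halfDiff l j q t - Polyharmonic.halfDiff l j q t'| / (2 * ‖v q‖) :=
        abs_angle_sub_le (hw.trans_le hwq) _ _
    _ ≤ (L * dist t t') / (1 * w) := by
        gcongr
        · exact h.halfDiff ht ht'
        · norm_num
    _ = (L * w⁻¹) * dist t t' := by rw [one_mul]; field_simp
    _ ≤ M * dist t t' := by gcongr; nlinarith

lemma BlockLip.vecPlus (h : BlockLip l j q U L) (hw : 0 < w) (hwq : w ≤ ‖v q‖) (hM0 : 0 ≤ M)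
    (hM : L * (3 + w⁻¹) ≤ M) : BL U M 2 (vecPlus l v j q) where
  hM := hM0
  ha := by norm_num
  bound t ht := by
    refine (norm_block_le _ _ _ (norm_phase (norm_pos_iff.1 (hw.trans_le hwq)))).trans ?_
    linarith [Real.abs_cos_le_one (Polyharmonic.angle ‖v q‖ (Polyharmonic.halfDiff l j q t)),
      Real.abs_sin_le_one (Polyharmonic.angle ‖v q‖ (Polyharmonic.halfDiff l j q t))]
  lip t ht t' ht' := by
    have h1 := h.angle hw hwq hM ht ht'
    unfold Polyharmonic.vecPlus
    rw [add_sub_add_comm, ← sub_smul, ← sub_smul]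
    refine (norm_block_le _ _ _ (norm_phase (norm_pos_iff.1 (hw.trans_le hwq)))).trans ?_
    linarith [(abs_cos_sub_le _ _).trans h1, (abs_sin_sub_le _ _).trans h1]

lemma BlockLip.vecMinus (h : BlockLip l j q U L) (hw : 0 < w) (hwq : w ≤ ‖v q‖) (hM0 : 0 ≤ M)
    (hM : L * (3 + w⁻¹) ≤ M) : BL U M 2 (vecMinus l v j q) where
  hM := hM0
  ha := by norm_num
  bound t ht := by
    refine (norm_block_le _ _ _ (norm_phase (norm_pos_iff.1 (hw.trans_le hwq)))).trans ?_
    rw [abs_neg]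
    linarith [Real.abs_cos_le_one (Polyharmonic.angle ‖v q‖ (Polyharmonic.halfDiff l j q t)),
      Real.abs_sin_le_one (Polyharmonic.angle ‖v q‖ (Polyharmonic.halfDiff l j q t))]
  lip t ht t' ht' := by
    have h1 := h.angle hw hwq hM ht ht'
    unfold Polyharmonic.vecMinus
    rw [add_sub_add_comm, ← sub_smul, ← sub_smul]
    refine (norm_block_le _ _ _ (norm_phase (norm_pos_iff.1 (hw.trans_le hwq)))).trans ?_
    rw [neg_sub_neg, abs_sub_comm (Real.sin _)]
    linarith [(abs_cos_sub_le _ _).trans h1, (abs_sin_sub_le _ _).trans h1]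

/-- The reciprocal of the distance of the eigenvalues of the model matrix. -/
def invGap (l : ℕ) (v : Lat n →₀ ℂ) (j q : Lat n) (t : Sp n) : ℝ := (2 * halfGap l v j q t)⁻¹

/-- The summand `w⁻¹` covers the size and `w⁻²` the Lipschitz constant of the reciprocal. -/
lemma BlockLip.invGap (h : BlockLip l j q U L) (hw : 0 < w) (hwq : w ≤ ‖v q‖) (hM0 : 0 ≤ M)
    (hM : L * (3 + w⁻¹) ≤ M) : BL U M (w⁻¹ + (w⁻¹) ^ 2) (invGap l v j q) where
  hM := hM0
  ha := by positivity
  bound t ht := by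
    have h1 := (hwq.trans (le_split ‖v q‖ (Polyharmonic.halfDiff l j q t)))
    have h0 := split_pos (hw.trans_le hwq) (Polyharmonic.halfDiff l j q t)
    rw [Polyharmonic.invGap, halfGap_eq, Real.norm_of_nonneg (by positivity)]
    have : (2 * split ‖v q‖ (Polyharmonic.halfDiff l j q t))⁻¹ ≤ w⁻¹ :=
      inv_anti₀ hw (by linarith)
    have := sq_nonneg w⁻¹
    linarith
  lip t ht t' ht' := by
    have hL := h.hL
    have hw' := hw.trans_le hwq
    have h1 := (hwq.trans (le_split ‖v q‖ (Polyharmonic.halfDiff l j q t)))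
    have h2 := (hwq.trans (le_split ‖v q‖ (Polyharmonic.halfDiff l j q t')))
    have h3 := (abs_split_sub_le hw' _ _).trans (h.halfDiff ht ht')
    rw [Polyharmonic.invGap, Polyharmonic.invGap, halfGap_eq, halfGap_eq]
    set B := split ‖v q‖ (Polyharmonic.halfDiff l j q t)
    set B' := split ‖v q‖ (Polyharmonic.halfDiff l j q t')
    have p1 : 0 < B := hw.trans_le h1
    have p2 : 0 < B' := hw.trans_le h2
    have e : (2 * B)⁻¹ - (2 * B')⁻¹ = -(B - B') / (2 * (B * B')) := by field_simp; ring
    rw [e, norm_div, norm_neg, Real.norm_eq_abs, Real.norm_of_nonneg (by positivity)]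
    have hiw : 0 < w⁻¹ := by positivity
    calc |B - B'| / (2 * (B * B')) ≤ (L * dist t t') / (1 * (w * w)) := by
          gcongr
          norm_num
      _ = w⁻¹ ^ 2 * L * dist t t' := by field_simp
      _ ≤ (w⁻¹ + w⁻¹ ^ 2) * M * dist t t' := by
          have : L ≤ M := by nlinarith
          gcongr
          linarith

end Model

/-! ### The reduced resolvent and its dependence on the quasimomentum -/

section Resolvent
variable {n l : ℕ} {v : Lat n →₀ ℂ} {j q : Lat n}

open Classical in
/-- The entries of the reduced resolvent of the model operator at `λ⁺(t)`. -/
def resEntry (l : ℕ) (v : Lat n →₀ ℂ) (j q : Lat n) (t : Sp n) (i : Lat n) : ℝ :=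
  if i = j ∨ i = j - q then 0 else (freeEig l i t - lamPlus l v j q t)⁻¹

open Classical in
/-- The reduced resolvent of the model operator at `λ⁺(t)` as a bounded sequence (zero when the
entries are unbounded). -/
def res (l : ℕ) (v : Lat n →₀ ℂ) (j q : Lat n) (t : Sp n) : BoundedContinuousFunction (Lat n) ℝ :=
  if h : ∃ C : ℝ, ∀ i, ‖resEntry l v j q t i‖ ≤ C then
    BoundedContinuousFunction.ofNormedAddCommGroupDiscrete (resEntry l v j q t) h.choose
      h.choose_spec
  else 0

/-- Lower bounds for the distances of `λ⁺` to the unperturbed eigenvalues off the block. -/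
structure Gaps (l : ℕ) (v : Lat n →₀ ℂ) (j q : Lat n) (U : Set (Sp n)) (L ε : ℝ) : Prop
    extends BlockLip l j q U L where
  hε : 0 < ε
  hε1 : ε ≤ 1
  gap : ∀ t ∈ U, ∀ i, i ≠ j → i ≠ j - q → ε⁻¹ ≤ |freeEig l i t - lamPlus l v j q t|
  lip : ∀ t ∈ U, ∀ t' ∈ U, ∀ i, i ≠ j → i ≠ j - q →
    |freeEig l i t - freeEig l i t'| ≤ L * |freeEig l i t - lamPlus l v j q t| * dist t t'
  coer : ∃ c : ℝ, 0 < c ∧ ∀ t ∈ U, ∀ i, i ≠ j → i ≠ j - q →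
    c * (1 + ‖mom i t‖ ^ 2) ^ l ≤ |freeEig l i t - lamPlus l v j q t|

variable {U : Set (Sp n)} {L ε w M : ℝ}

lemma Gaps.gap_pos (h : Gaps l v j q U L ε) {t : Sp n} (ht : t ∈ U) {i : Lat n} (h1 : i ≠ j)
    (h2 : i ≠ j - q) : 0 < |freeEig l i t - lamPlus l v j q t| :=
  (inv_pos.2 h.hε).trans_le (h.gap t ht i h1 h2)

lemma Gaps.norm_resEntry_le (h : Gaps l v j q U L ε) {t : Sp n} (ht : t ∈ U) (i : Lat n) :
    ‖resEntry l v j q t i‖ ≤ ε := by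
  unfold resEntry
  split_ifs with hi
  · simpa using h.hε.le
  · push Not at hi
    rw [norm_inv, Real.norm_eq_abs]
    exact inv_le_of_inv_le₀ h.hε (h.gap t ht i hi.1 hi.2)

lemma Gaps.res_apply (h : Gaps l v j q U L ε) {t : Sp n} (ht : t ∈ U) (i : Lat n) :
    res l v j q t i = resEntry l v j q t i := by
  have : ∃ C : ℝ, ∀ i, ‖resEntry l v j q t i‖ ≤ C := ⟨ε, h.norm_resEntry_le ht⟩
  rw [res, dif_pos this]; rfl

/-- The unperturbed eigenvalues move with unbounded speed as `i` grows, but by `Gaps.lip` only in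
proportion to their distance from `λ⁺`. In `a⁻¹ - a'⁻¹ = -(a - a') / (a a')` this factor cancels and
`|a'|⁻¹ ≤ ε` remains. -/
lemma Gaps.bl_res (h : Gaps l v j q U L ε) (hq : v q ≠ 0) (hM : 3 * L ≤ M) :
    BL U M ε (res l v j q) where
  hM := (mul_nonneg (by norm_num) h.hL).trans hM
  ha := h.hε.le
  bound t ht := (BoundedContinuousFunction.norm_le h.hε.le).2 fun i => by
    rw [h.res_apply ht]; exact h.norm_resEntry_le ht i
  lip t ht t' ht' := by
    have hL := h.hL
    have hε := h.hε
    have hM0 := (mul_nonneg (by norm_num) h.hL).trans hM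
    refine (BoundedContinuousFunction.norm_le (by positivity)).2 fun i => ?_
    rw [BoundedContinuousFunction.sub_apply, h.res_apply ht, h.res_apply ht']
    unfold resEntry
    split_ifs with hi
    · rw [sub_zero, norm_zero]; positivity
    · push Not at hi
      have g1 := h.gap_pos ht hi.1 hi.2
      have g2 := h.gap_pos ht' hi.1 hi.2
      have g3 := inv_le_of_inv_le₀ hε (h.gap t' ht' i hi.1 hi.2)
      have g4 : 1 ≤ |freeEig l i t - lamPlus l v j q t| :=
        ((one_le_inv₀ hε).2 h.hε1).trans (h.gap t ht i hi.1 hi.2)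
      have b1 := h.lip t ht t' ht' i hi.1 hi.2
      have b2 := h.toBlockLip.lamPlus hq ht ht'
      set a := freeEig l i t - lamPlus l v j q t
      set a' := freeEig l i t' - lamPlus l v j q t'
      have e : a⁻¹ - a'⁻¹ = -(a - a') / (a * a') := by
        have := abs_pos.1 g1
        have := abs_pos.1 g2
        field_simp; ring
      -- The eigenvalue contributes `L` and `λ⁺` contributes `2 * L`; since `|a| ≥ 1` the latter can
      -- also carry the factor `|a|`.
      have b3 : |a - a'| ≤ 3 * L * |a| * dist t t' := by
        have : a - a' = (freeEig l i t - freeEig l i t')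
          - (lamPlus l v j q t - lamPlus l v j q t') := by simp only [a, a']; ring
        rw [this]
        refine (abs_sub _ _).trans ?_
        have : 2 * L * dist t t' ≤ 2 * L * |a| * dist t t' := by
          have := mul_nonneg (mul_nonneg zero_le_two hL) (dist_nonneg (x := t) (y := t'))
          nlinarith
        linarith
      rw [e, norm_div, norm_neg, Real.norm_eq_abs, Real.norm_eq_abs, abs_mul]
      calc |a - a'| / (|a| * |a'|) ≤ (3 * L * |a| * dist t t') / (|a| * |a'|) := by gcongr
        _ = 3 * L * dist t t' * |a'|⁻¹ := by field_simp
        _ ≤ M * dist t t' * ε := by gcongr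
        _ = _ := by ring

/-- The data of the model operator form a frame. -/
lemma Gaps.frame (h : Gaps l v j q U L ε) (hq0 : q ≠ 0) (hw : 0 < w) (hwq : w ≤ ‖v q‖)
    (hM : L * (3 + w⁻¹) ≤ M) :
    Frame U M ε (w⁻¹ + (w⁻¹) ^ 2) (vecPlus l v j q) (vecMinus l v j q) (res l v j q)
      (invGap l v j q) := by
  have hq : v q ≠ 0 := norm_pos_iff.1 (hw.trans_le hwq)
  have hL := h.hL
  have hM1 : 3 * L ≤ M := by
    have : 0 ≤ L * w⁻¹ := by positivity
    linarith
  have hM0 : 0 ≤ M := by linarith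
  exact ⟨h.toBlockLip.vecPlus hw hwq hM0 hM, h.toBlockLip.vecMinus hw hwq hM0 hM, h.bl_res hq hM1,
    h.toBlockLip.invGap hw hwq hM0 hM, fun t _ => pair_plus_plus hq0 hq t,
    fun t _ => pair_plus_minus hq0 hq t⟩

/-! ### Differentiability of the data in the quasimomentum -/

section Differentiability

lemma freeEig_eq (i : Lat n) (t : Sp n) : freeEig l i t = (‖mom i t‖ ^ 2) ^ l := by
  rw [freeEig, pow_mul]

lemma differentiable_freeEig (i : Lat n) : Differentiable ℝ (freeEig l i) := by
  have : freeEig l i = fun t : Sp n => (‖mom i 0 + t‖ ^ 2) ^ l := by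
    ext t; rw [freeEig_eq, mom_eq]
  rw [this]
  exact ((differentiable_id.const_add _).norm_sq ℝ).pow _

lemma differentiable_halfDiff : Differentiable ℝ (halfDiff (n := n) l j q) := by
  have h1 := differentiable_freeEig (l := l) j
  have h2 := differentiable_freeEig (l := l) (j - q)
  unfold halfDiff
  fun_prop

lemma differentiable_halfGap (hq : v q ≠ 0) : Differentiable ℝ (halfGap l v j q) := by
  have h1 := differentiable_halfDiff (l := l) (j := j) (q := q)
  have : halfGap l v j q = fun t => √(‖v q‖ ^ 2 + halfDiff l j q t ^ 2) := by
    ext t; rw [halfGap_eq, split]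
  rw [this]
  have hw := norm_pos_iff.2 hq
  refine Differentiable.sqrt (by fun_prop) (fun t => by positivity)

lemma differentiable_lamPlus (hq : v q ≠ 0) : Differentiable ℝ (lamPlus l v j q) := by
  have h1 := differentiable_freeEig (l := l) j
  have h2 := differentiable_freeEig (l := l) (j - q)
  have h3 := differentiable_halfGap (l := l) (j := j) hq
  unfold lamPlus
  fun_prop

lemma differentiable_angle : Differentiable ℝ (fun t => angle ‖v q‖ (halfDiff l j q t)) := by
  have h1 := differentiable_halfDiff (l := l) (j := j) (q := q)
  unfold angle
  have h2 : Differentiable ℝ (fun t => Real.arctan (halfDiff l j q t / ‖v q‖)) :=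
    Differentiable.arctan (by fun_prop)
  fun_prop

lemma differentiable_vecPlus : Differentiable ℝ (vecPlus l v j q) := by
  have h := differentiable_angle (l := l) (v := v) (j := j) (q := q)
  unfold vecPlus
  exact (h.cos.smul_const _).add (h.sin.smul_const _)

lemma differentiable_vecMinus : Differentiable ℝ (vecMinus l v j q) := by
  have h := differentiable_angle (l := l) (v := v) (j := j) (q := q)
  unfold vecMinus
  exact (h.sin.neg.smul_const _).add (h.cos.smul_const _)

lemma differentiable_invGap (hq : v q ≠ 0) : Differentiable ℝ (invGap l v j q) := by
  have h := (differentiable_halfGap (l := l) (j := j) hq).const_mul 2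
  unfold invGap
  refine h.inv (fun t => ?_)
  rw [halfGap_eq]
  have := split_pos (norm_pos_iff.2 hq) (halfDiff l j q t)
  positivity

/-- A bounded sequence of real numbers. -/
def bdd (f : Lat n → ℝ) (C : ℝ) (h : ∀ i, |f i| ≤ C) : BoundedContinuousFunction (Lat n) ℝ :=
  BoundedContinuousFunction.ofNormedAddCommGroupDiscrete f C h

@[simp] lemma bdd_apply (f : Lat n → ℝ) (C : ℝ) (h) (i : Lat n) : bdd f C h i = f i := rfl

/-- The normalised unperturbed eigenvalues `p_i^{2l}(t) / (1 + p_i^2(t₀))^l` depend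
differentiably on `t`, uniformly in `i`. -/
lemma exists_weighted_freeEig (l : ℕ) (t₀ : Sp n) :
    ∃ F : Sp n → BoundedContinuousFunction (Lat n) ℝ, Differentiable ℝ F ∧
      ∀ t i, F t i = ((1 + ‖mom i t₀‖ ^ 2)⁻¹) ^ l * freeEig l i t := by
  have hpos : ∀ i : Lat n, 0 < 1 + ‖mom i t₀‖ ^ 2 := fun i => by positivity
  let A : BoundedContinuousFunction (Lat n) ℝ :=
    bdd (fun i => (1 + ‖mom i t₀‖ ^ 2)⁻¹ * ‖mom i t₀‖ ^ 2) 1 (fun i => by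
      rw [abs_of_nonneg (by positivity), inv_mul_le_iff₀ (hpos i)]; linarith)
  let B : Fin n → BoundedContinuousFunction (Lat n) ℝ := fun s =>
    bdd (fun i => (1 + ‖mom i t₀‖ ^ 2)⁻¹ * (2 * mom i t₀ s)) 1 (fun i => by
      have h1 : |mom i t₀ s| ≤ ‖mom i t₀‖ := PiLp.norm_apply_le (mom i t₀) s
      rw [abs_mul, abs_of_nonneg (by have := hpos i; positivity), inv_mul_le_iff₀ (hpos i), abs_mul,
        abs_two]
      nlinarith [sq_nonneg (‖mom i t₀‖ - 1)])
  let C : BoundedContinuousFunction (Lat n) ℝ :=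
    bdd (fun i => (1 + ‖mom i t₀‖ ^ 2)⁻¹) 1 (fun i => by
      rw [abs_of_nonneg (by positivity)]
      exact inv_le_one_of_one_le₀ (by nlinarith [sq_nonneg ‖mom i t₀‖]))
  -- The expansion of `|P_i(t₀) + h|²` in `h = t - t₀` has coefficients of order at most `1 +
  -- p_i²(t₀)`. After division by this weight it is a polynomial in `h` whose coefficients are
  -- bounded sequences.
  refine ⟨fun t => (A + ∑ s, (t s - t₀ s) • B s + (‖t - t₀‖ ^ 2) • C) ^ l, ?_, ?_⟩
  · have h1 : ∀ s, Differentiable ℝ fun t : Sp n => t s := fun s => by fun_prop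
    have h2 : Differentiable ℝ fun t : Sp n => ‖t - t₀‖ ^ 2 :=
      (differentiable_id.sub_const t₀).norm_sq ℝ
    have h3 : Differentiable ℝ fun t : Sp n =>
        A + ∑ s, (t s - t₀ s) • B s + (‖t - t₀‖ ^ 2) • C := by fun_prop
    exact h3.pow l
  · intro t i
    have h1 : ‖mom i t‖ ^ 2 = ‖mom i t₀‖ ^ 2 + ∑ s, (t s - t₀ s) * (2 * mom i t₀ s)
        + ‖t - t₀‖ ^ 2 := by
      have e : mom i t = mom i t₀ + (t - t₀) := by rw [mom_eq, mom_eq i t₀]; abel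
      rw [e, norm_add_sq_real, PiLp.inner_apply, Finset.mul_sum]
      congr 2
      refine Finset.sum_congr rfl fun s _ => ?_
      simp; ring
    rw [freeEig_eq, ← mul_pow, h1]
    rw [BoundedContinuousFunction.pow_apply, BoundedContinuousFunction.add_apply,
      BoundedContinuousFunction.add_apply, BoundedContinuousFunction.coe_sum, Finset.sum_apply]
    simp only [BoundedContinuousFunction.smul_apply, A, B, C, bdd_apply, smul_eq_mul]
    rw [mul_add, mul_add, Finset.mul_sum]
    congr 2
    · congr 1
      exact Finset.sum_congr rfl fun s _ => by ring
    · ring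

lemma ringInverse_apply {y : BoundedContinuousFunction (Lat n) ℝ} (hy : IsUnit y) (i : Lat n) :
    Ring.inverse y i = (y i)⁻¹ := by
  have h := congrArg (fun z : BoundedContinuousFunction (Lat n) ℝ => z i) (Ring.mul_inverse_cancel y hy)
  simp only [BoundedContinuousFunction.mul_apply, BoundedContinuousFunction.coe_one,
    Pi.one_apply] at h
  exact eq_inv_of_mul_eq_one_right h

/-- Differentiability must be uniform in `i` although the eigenvalues are unbounded. The weighted
differences `p_i^{2l} - λ⁺` form a differentiable curve in the Banach algebra of bounded sequences,
invertible at `t₀` by coercivity, and inversion is differentiable there. -/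
lemma Gaps.differentiableAt_res (h : Gaps l v j q U L ε) (hq : v q ≠ 0) {t₀ : Sp n}
    (hU : U ∈ 𝓝 t₀) : DifferentiableAt ℝ (res l v j q) t₀ := by
  classical
  have ht₀ := mem_of_mem_nhds hU
  obtain ⟨F, hF, hF'⟩ := exists_weighted_freeEig (n := n) l t₀
  obtain ⟨c, hc, hcoer⟩ := h.coer
  have hpos : ∀ i : Lat n, 0 < 1 + ‖mom i t₀‖ ^ 2 := fun i => by positivity
  have hwle : ∀ i : Lat n, ((1 + ‖mom i t₀‖ ^ 2)⁻¹) ^ l ≤ 1 := fun i =>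
    pow_le_one₀ (inv_nonneg.2 (hpos i).le)
      (inv_le_one_of_one_le₀ (by nlinarith [sq_nonneg ‖mom i t₀‖]))
  have hwnn : ∀ i : Lat n, 0 < ((1 + ‖mom i t₀‖ ^ 2)⁻¹) ^ l := fun i => by
    have := hpos i; positivity
  let W : BoundedContinuousFunction (Lat n) ℝ := bdd (fun i => ((1 + ‖mom i t₀‖ ^ 2)⁻¹) ^ l) 1
    (fun i => by rw [abs_of_pos (hwnn i)]; exact hwle i)
  let χ : BoundedContinuousFunction (Lat n) ℝ := bdd (fun i => if i = j ∨ i = j - q then 0 else 1) 1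
    (fun i => by split_ifs <;> simp)
  -- The entries on the block are set to 1 to keep `Y` invertible; the final factor `χ` removes them
  -- again.
  let Y : Sp n → BoundedContinuousFunction (Lat n) ℝ := fun t =>
    χ * (F t - lamPlus l v j q t • W) + (1 - χ)
  have hYd : Differentiable ℝ Y := by
    have h1 := differentiable_lamPlus (l := l) (j := j) hq
    have h2 : Differentiable ℝ fun t => F t - lamPlus l v j q t • W := hF.sub (h1.smul_const W)
    exact (h2.const_mul χ).add_const _
  have hYon : ∀ t i, (i = j ∨ i = j - q) → Y t i = 1 := by
    intro t i hi; simp [Y, χ, hi]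
  have hYoff : ∀ t i, ¬(i = j ∨ i = j - q) →
      Y t i = ((1 + ‖mom i t₀‖ ^ 2)⁻¹) ^ l * (freeEig l i t - lamPlus l v j q t) := by
    intro t i hi; simp [Y, χ, hi, W, hF']; ring
  have hlow : ∀ i, min c 1 ≤ |Y t₀ i| := by
    intro i
    by_cases hi : i = j ∨ i = j - q
    · rw [hYon _ _ hi]; simp
    · rw [hYoff _ _ hi, abs_mul, abs_of_pos (hwnn i)]
      push Not at hi
      have h1 := hcoer t₀ ht₀ i hi.1 hi.2
      refine (min_le_left _ _).trans ?_
      rw [inv_pow, inv_mul_eq_div, le_div_iff₀ (pow_pos (hpos i) l)]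
      exact h1
  have hc1 : 0 < min c 1 := lt_min hc one_pos
  have hYne : ∀ i, Y t₀ i ≠ 0 := fun i => abs_pos.1 (hc1.trans_le (hlow i))
  have hunit : IsUnit (Y t₀) := by
    let Z : BoundedContinuousFunction (Lat n) ℝ := bdd (fun i => (Y t₀ i)⁻¹) (min c 1)⁻¹
      (fun i => by rw [abs_inv]; exact inv_anti₀ hc1 (hlow i))
    have hZ : Y t₀ * Z = 1 := by
      ext i; simp [Z, hYne i]
    exact IsUnit.of_mul_eq_one Z hZ
  have hev : ∀ᶠ t in 𝓝 t₀, IsUnit (Y t) :=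
    hYd.continuous.continuousAt.eventually (Units.isOpen.mem_nhds hunit)
  have hd : DifferentiableAt ℝ (fun t => χ * W * Ring.inverse (Y t)) t₀ :=
    (DifferentiableAt.comp t₀ (differentiableAt_inverse (𝕜 := ℝ) hunit) (hYd t₀)).const_mul _
  refine hd.congr_of_eventuallyEq ?_
  filter_upwards [hev, hU] with t hut ht
  ext i
  rw [h.res_apply ht, BoundedContinuousFunction.mul_apply, BoundedContinuousFunction.mul_apply,
    ringInverse_apply hut]
  by_cases hi : i = j ∨ i = j - q
  · simp [resEntry, χ, hi]
  · rw [hYoff _ _ hi]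
    simp only [resEntry, χ, hi, W, bdd_apply, if_false, one_mul]
    have := (hwnn i).ne'
    rw [mul_inv, mul_inv_cancel_left₀ this]

end Differentiability

end Resolvent

/-! ### Self-adjointness -/

section Symmetry
variable {ι : Type*} [AddCommGroup ι]

/-- In the variables `(m, m - a)` the kernel is dominated by `f ⊗ w` times a constant. This
justifies Fubini when one of the two vectors is merely bounded. -/
lemma summable_kernel (w f : L1 ι) {g : ι → ℂ} {C : ℝ} (hg : ∀ m, ‖g m‖ ≤ C) :
    Summable fun x : ι × ι => conj (f x.1) * (w (x.1 - x.2) * g x.2) := by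
  have h1 : Summable fun x : ι × ι => ‖L1.tens f w x‖ := L1.summable_norm _
  let e : ι × ι ≃ ι × ι :=
    { toFun := fun x => (x.1, x.1 - x.2), invFun := fun x => (x.1, x.1 - x.2)
      left_inv := fun x => by simp, right_inv := fun x => by simp }
  refine Summable.of_norm_bounded (((e.summable_iff).2 h1).mul_right C) fun x => ?_
  simp only [norm_mul, RCLike.norm_conj, Function.comp_apply, e, Equiv.coe_fn_mk, L1.tens_apply]
  rw [mul_assoc]
  gcongr
  exact hg _

lemma summable_conv_bdd (w : L1 ι) {g : ι → ℂ} {C : ℝ} (hg : ∀ m, ‖g m‖ ≤ C) (m : ι) :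
    Summable fun a => w (m - a) * g a := by
  have h1 : Summable fun a => ‖w (m - a)‖ :=
    ((Equiv.subLeft m).summable_iff (f := fun x => ‖w x‖)).2 (L1.summable_norm w)
  refine Summable.of_norm_bounded (h1.mul_right C) fun x => ?_
  rw [norm_mul]; gcongr; exact hg _

lemma norm_conv_bdd_le (w : L1 ι) {g : ι → ℂ} {C : ℝ} (hg : ∀ m, ‖g m‖ ≤ C) (m : ι) :
    ‖∑' a, w (m - a) * g a‖ ≤ ‖w‖ * C := by
  have h1 : Summable fun a => ‖w (m - a)‖ :=
    ((Equiv.subLeft m).summable_iff (f := fun x => ‖w x‖)).2 (L1.summable_norm w)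
  have h2 : ∑' a, ‖w (m - a)‖ = ‖w‖ := by
    rw [L1.norm_eq]; exact (Equiv.subLeft m).tsum_eq (f := fun x => ‖w x‖)
  rw [← h2, ← tsum_mul_right]
  refine tsum_of_norm_bounded (h1.mul_right C).hasSum fun x => ?_
  rw [norm_mul]; gcongr; exact hg _

/-- Green's identity for the operator with the diagonal `p` and the potential `w`. -/
lemma green {w : L1 ι} (hw : ∀ a, w (-a) = conj (w a)) {p : ι → ℝ} {f y : L1 ι} {g z : ι → ℂ}
    {C : ℝ} (hg : ∀ m, ‖g m‖ ≤ C) (hz : ∀ m, ‖z m‖ ≤ C) {μ ν : ℝ}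
    (hf : ∀ m, p m * f m + ∑' a, w (m - a) * f a = μ * f m + y m)
    (hg2 : ∀ m, p m * g m + ∑' a, w (m - a) * g a = ν * g m + z m) :
    ((ν - μ : ℝ) : ℂ) * ∑' m, conj (f m) * g m
      = ∑' m, conj (y m) * g m - ∑' m, conj (f m) * z m := by
  have hs : ∀ (f : L1 ι) {g : ι → ℂ}, (∀ m, ‖g m‖ ≤ C) → Summable fun m => conj (f m) * g m := by
    intro f g hg
    refine Summable.of_norm_bounded ((L1.summable_norm f).mul_right C) fun x => ?_
    rw [norm_mul, RCLike.norm_conj]; gcongr; exact hg _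
  have hk := summable_kernel w f hg
  -- Exchanging the sums and using `w_{-a} = conj w_a` moves the potential from `g` to `f`.
  have e1 : ∑' m, conj (f m) * ∑' a, w (m - a) * g a
      = ∑' a, conj (∑' m, w (a - m) * f m) * g a := by
    have h1 := hk.tsum_prod
    have h2 := ((Equiv.prodComm ι ι).summable_iff.2 hk).tsum_prod
    have h3 := (Equiv.prodComm ι ι).tsum_eq
      (fun x : ι × ι => conj (f x.1) * (w (x.1 - x.2) * g x.2))
    calc _ = ∑' m, ∑' a, conj (f m) * (w (m - a) * g a) := by simp_rw [tsum_mul_left]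
      _ = ∑' a, ∑' m, conj (f m) * (w (m - a) * g a) := by
        rw [← h1, ← h3]; exact h2
      _ = _ := by
        congr 1; ext a
        rw [Complex.conj_tsum, ← tsum_mul_right]
        congr 1; ext m
        rw [map_mul, ← hw, neg_sub]; ring
  have s1 : Summable fun m => conj (f m) * ∑' a, w (m - a) * g a := by
    simpa only [tsum_mul_left] using hk.prod
  have s2 : Summable fun a => conj (∑' m, w (a - m) * f m) * g a :=
    hs (L1.conv w f) hg
  -- The real diagonal cancels entry by entry, so no summability of `p f` or `p g` is needed.
  have e2 : ∀ m, conj (f m) * ∑' a, w (m - a) * g a - conj (∑' a, w (m - a) * f a) * g m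
      = ((ν - μ : ℝ) : ℂ) * (conj (f m) * g m) + conj (f m) * z m - conj (y m) * g m := by
    intro m
    have a1 : ∑' a, w (m - a) * g a = ν * g m + z m - p m * g m := by rw [← hg2]; ring
    have a2 : ∑' a, w (m - a) * f a = μ * f m + y m - p m * f m := by rw [← hf]; ring
    rw [a1, a2]
    simp only [map_sub, map_add, map_mul, Complex.conj_ofReal]
    push_cast; ring
  have e3 : ∑' m, (conj (f m) * ∑' a, w (m - a) * g a - conj (∑' a, w (m - a) * f a) * g m) = 0 := by
    rw [s1.tsum_sub s2, e1, sub_self]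
  simp_rw [e2] at e3
  rw [(((hs f hg).mul_left _).add (hs f hz)).tsum_sub (hs y hg),
    ((hs f hg).mul_left _).tsum_add (hs f hz), tsum_mul_left] at e3
  linear_combination e3

/-- Potentials with `w_{-a} = conj w_a`. -/
def IsReal (w : L1 ι) : Prop := ∀ a, w (-a) = conj (w a)

lemma isReal_density (j : ι) (τ : ℝ) (f : L1 ι) : IsReal (density j τ f) := by
  intro m
  simp only [density, L1.rsmul_apply, map_mul, Complex.conj_ofReal, L1.conv_apply]
  congr 1
  rw [Complex.conj_tsum, ← (Equiv.subRight m).tsum_eq]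
  congr 1; ext a
  simp only [Equiv.subRight_apply, L1.refl_apply, map_mul, Complex.conj_conj]
  rw [show -m - (a - m) = -a by abel, show -(a - m) = m - a by abel, mul_comm]

lemma IsReal.add {w w' : L1 ι} (h : IsReal w) (h' : IsReal w') : IsReal (w + w') := by
  intro a; simp [h a, h' a]

end Symmetry

/-! ### From fixed points to eigenvectors -/

section Eigenpairs
variable {n l : ℕ} {v : Lat n →₀ ℂ} {j q : Lat n} {U : Set (Sp n)} {L ε : ℝ}

lemma hamiltonian_ser (w : L1 (Lat n)) (t : Sp n) (f : Lat n → ℂ) (m : Lat n) :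
    hamiltonian l (ser w) t f m = (freeEig l m t : ℂ) * f m + ∑' a, w (m - a) * f a := by
  simp only [hamiltonian, fourierCoef_ser]

/-- Since `v 0 = 0`, the potential restricted to the pair only exchanges the two sites: it is the
off-diagonal part of the model matrix. -/
lemma conv_coefs_block (hv0 : v 0 = 0) {f : L1 (Lat n)}
    (hf : ∀ i, i ≠ j → i ≠ j - q → f i = 0) :
    L1.conv (coefs v) f j = v q * f (j - q) ∧ L1.conv (coefs v) f (j - q) = v (-q) * f j := by
  have key : ∀ m, L1.conv (coefs v) f m
      = ∑ a ∈ ({j, j - q} : Finset (Lat n)), v (m - a) * f a := by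
    intro m
    rw [L1.conv_apply, tsum_eq_sum (s := {j, j - q})]
    · rfl
    · intro a ha
      simp only [Finset.mem_insert, Finset.mem_singleton, not_or] at ha
      rw [hf a ha.1 ha.2, mul_zero]
  rw [key, key]
  by_cases hq0 : q = 0
  · simp [hq0, hv0]
  · have hne : j ≠ j - q := (by simpa using hq0 : j - q ≠ j).symm
    rw [Finset.sum_pair hne, Finset.sum_pair hne]
    simp [hv0]

/-- Fixed points of `eigMap` solve the eigenvalue equation up to a multiple of `vecPlus`. -/
lemma Gaps.eigen_eq (h : Gaps l v j q U L ε) (hv0 : v 0 = 0) (hreal : ∀ a, v (-a) = conj (v a))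
    (hq : v q ≠ 0) {t : Sp n} (ht : t ∈ U) {S : L1 (Lat n)} {x : Unk (Lat n)}
    (hx : eigMap (vecPlus l v j q t) (vecMinus l v j q t) (res l v j q t) (invGap l v j q t)
      (coefs v) S x = x) :
    (x.2.2 j = 0 ∧ x.2.2 (j - q) = 0) ∧
    ∃ y : ℝ, ∀ m, (freeEig l m t : ℂ) * trial (vecPlus l v j q t) (vecMinus l v j q t) x m
      + ∑' a, (coefs v + S) (m - a) * trial (vecPlus l v j q t) (vecMinus l v j q t) x a
      = ((lamPlus l v j q t + x.1 : ℝ) : ℂ) * trial (vecPlus l v j q t) (vecMinus l v j q t) x m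
        + ((y * Complex.I) • vecPlus l v j q t) m := by
  have hq0 : q ≠ 0 := by rintro rfl; exact hq hv0
  have hne : j - q ≠ j := by simpa using hq0
  obtain ⟨μ, α, g⟩ := x
  set ep := vecPlus l v j q t with hep
  set em := vecMinus l v j q t with hem
  set f := trial ep em (μ, α, g) with hf
  have h1 := congrArg Prod.fst hx
  have h2 := congrArg (fun z => z.2.1) hx
  have h3 : offUpd ep em (res l v j q t) (coefs v) S (μ, α, g) = g := congrArg (fun z => z.2.2) hx
  simp only [eigMap] at h1 h2
  set X := resid ep em (res l v j q t) (coefs v) S (μ, α, g) with hX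
  have hg : ∀ i, (resEntry l v j q t i : ℂ) * (μ * g i - L1.conv (coefs v + S) f i) = g i := by
    intro i
    have := congrArg (fun z : L1 (Lat n) => z i) h3
    simp only [offUpd, L1.mulB_apply, L1.sub_apply, h.res_apply ht, L1.rsmul_apply] at this
    exact this
  have hgj : g j = 0 := by rw [← hg j]; simp [resEntry]
  have hgq : g (j - q) = 0 := by rw [← hg (j - q)]; simp [resEntry]
  -- The unknown `μ` is real, so the fixed point controls only the real part of `⟨e₊, X⟩`. The
  -- imaginary part is the defect `y`, removed later by self-adjointness.
  refine ⟨⟨hgj, hgq⟩, (L1.pair ep X).im, ?_⟩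
  have hXe : L1.conv (coefs v + S) f = L1.conv (coefs v) (ep + α • em) + X := by
    rw [hX, resid, h3]
    simp only [hf, trial, map_add, add_apply]; abel
  have hblk := conv_coefs_block (v := v) (j := j) (q := q) hv0 (f := ep + α • em) (by
    intro i hi1 hi2
    simp [hep, hem, vecPlus_apply_ne t hi1 hi2, vecMinus_apply_ne t hi1 hi2])
  set D := halfDiff l j q t with hD
  set θ := angle ‖v q‖ D with hθ
  set B := split ‖v q‖ D with hB
  have hw : 0 < ‖v q‖ := norm_pos_iff.2 hq
  have hB0 : 0 < B := split_pos hw D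
  have ec : D * Real.cos θ + ‖v q‖ * Real.sin θ = B * Real.cos θ := eig_cos hw D
  have es : ‖v q‖ * Real.cos θ - D * Real.sin θ = B * Real.sin θ := eig_sin hw D
  have cs := Real.cos_sq_add_sin_sq θ
  have ec' : (D : ℂ) * Real.cos θ + ‖v q‖ * Real.sin θ = B * Real.cos θ := by exact_mod_cast ec
  have es' : (‖v q‖ : ℂ) * Real.cos θ - D * Real.sin θ = B * Real.sin θ := by exact_mod_cast es
  have cs' : (Real.cos θ : ℂ) ^ 2 + (Real.sin θ : ℂ) ^ 2 = 1 := by exact_mod_cast cs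
  have hlam : lamPlus l v j q t = (freeEig l j t + freeEig l (j - q) t) / 2 + B := by
    rw [lamPlus, halfGap_eq]
  have ha : freeEig l j t = lamPlus l v j q t + D - B := by
    rw [hlam, hD, halfDiff]; ring
  have hb : freeEig l (j - q) t = lamPlus l v j q t - D - B := by
    rw [hlam, hD, halfDiff]; ring
  have p1 : L1.pair ep X = Real.cos θ * X j + Real.sin θ * conj (phase v q) * X (j - q) :=
    pair_vecPlus hq0 t X
  have p2 : L1.pair em X = -Real.sin θ * X j + Real.cos θ * conj (phase v q) * X (j - q) :=
    pair_vecMinus hq0 t X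
  have hph := phase_mul_conj (v := v) hq
  have k1 : L1.pair ep X = μ + ((L1.pair ep X).im : ℂ) * Complex.I := by
    conv_lhs => rw [← Complex.re_add_im (L1.pair ep X), h1]
  have k2 : L1.pair em X = 2 * B * α + μ * α := by
    -- Multiplication by the gap `2 * B` undoes the factor `β` in the second component.
    rw [invGap, halfGap_eq] at h2
    simp only [Complex.real_smul] at h2
    rw [← hB] at h2
    have hBc : (2 * B : ℂ) ≠ 0 := by exact_mod_cast (by positivity : (2 * B : ℝ) ≠ 0)
    have h4 : (2 * B : ℂ) * ((((2 * B)⁻¹ : ℝ) : ℂ) * (L1.pair em X - μ * α)) = 2 * B * α := by rw [h2]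
    push_cast at h4
    rw [mul_inv_cancel_left₀ hBc] at h4
    linear_combination h4
  set η := ((L1.pair ep X).im : ℂ) * Complex.I with hη
  have xj : X j = Real.cos θ * L1.pair ep X - Real.sin θ * L1.pair em X := by
    rw [p1, p2]; linear_combination -(X j) * cs'
  have xq : X (j - q) = phase v q * (Real.sin θ * L1.pair ep X + Real.cos θ * L1.pair em X) := by
    rw [p1, p2]
    linear_combination -(X (j - q)) * hph - (X (j - q)) * conj (phase v q) * phase v q * cs'
  have epj : ep j = Real.cos θ := vecPlus_apply_j hq0 t
  have epq : ep (j - q) = Real.sin θ * phase v q := vecPlus_apply_jq hq0 t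
  have emj : em j = -Real.sin θ := vecMinus_apply_j hq0 t
  have emq : em (j - q) = Real.cos θ * phase v q := vecMinus_apply_jq hq0 t
  have fj : f j = Real.cos θ - α * Real.sin θ := by
    simp [hf, trial, epj, emj, hgj]; ring
  have fq : f (j - q) = (Real.sin θ + α * Real.cos θ) * phase v q := by
    simp only [hf, trial, L1.add_apply, L1.smul_apply, epq, emq, hgq]; ring
  have hvp := mul_phase (v := v) hq
  have hvn : v (-q) = ‖v q‖ * phase v q := by rw [hreal, norm_mul_phase hq]
  intro m
  have hc : ∑' a, (coefs v + S) (m - a) * f a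
      = L1.conv (coefs v) (ep + α • em) m + X m := by
    rw [← L1.conv_apply, hXe, L1.add_apply]
  rw [hc]
  by_cases hm1 : m = j
  · rw [hm1, hblk.1, L1.smul_apply, L1.add_apply, L1.smul_apply, epj, epq, emq, fj, xj, k1, k2, ha]
    simp only [Complex.ofReal_add, Complex.ofReal_sub]
    linear_combination (Real.sin θ + α * Real.cos θ) * hvp + ec' + α * es'
  · by_cases hm2 : m = j - q
    · rw [hm2, hblk.2, L1.smul_apply, L1.add_apply, L1.smul_apply, epj, epq, emj, fq, xq, k1, k2,
        hvn, hb]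
      simp only [Complex.ofReal_add, Complex.ofReal_sub]
      linear_combination (phase v q) * es' - α * phase v q * ec'
    · have h5 : f m = g m := by
        simp [hf, trial, hep, hem, vecPlus_apply_ne t hm1 hm2, vecMinus_apply_ne t hm1 hm2]
      have h6 := hg m
      have hgap := abs_pos.1 (h.gap_pos ht hm1 hm2)
      have hgap' : ((freeEig l m t : ℂ) - lamPlus l v j q t) ≠ 0 := by exact_mod_cast hgap
      rw [L1.smul_apply, hep, vecPlus_apply_ne t hm1 hm2, ← hep, mul_zero, add_zero, h5]
      have h7 : L1.conv (coefs v) (ep + α • em) m + X m = L1.conv (coefs v + S) f m := by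
        rw [hXe, L1.add_apply]
      rw [h7]
      simp only [resEntry, hm1, hm2, or_self, if_false] at h6
      push_cast at h6 ⊢
      field_simp at h6
      linear_combination -h6

end Eigenpairs

/-! ### Uniqueness and simplicity of the eigenvalue -/

section Uniqueness
variable {n l : ℕ} {v : Lat n →₀ ℂ} {j q : Lat n} {U : Set (Sp n)} {L ε V w s₀ r τ : ℝ}

/-- Smallness conditions for the uniqueness of the eigenvalue. -/
structure Tight (v : Lat n →₀ ℂ) (q : Lat n) (V w ε s₀ r : ℝ) : Prop where
  hw : 0 < w
  hwq : w ≤ ‖v q‖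
  hV : ‖coefs v‖ ≤ V
  s_le : s₀ ≤ 1
  s_w : s₀ ≤ w / 64
  ε_V : ε * (V + 1) ≤ 1 / 16
  ε_V2 : ε * (V + 1) ^ 2 ≤ w / 64
  r_le : r ≤ 1 / 8
  r_w : r ≤ w / 20

lemma Tight.hq (h : Tight v q V w ε s₀ r) : v q ≠ 0 := norm_pos_iff.1 (h.hw.trans_le h.hwq)

/-- The component of `g` along `vecPlus`. -/
def compPlus (l : ℕ) (v : Lat n →₀ ℂ) (j q : Lat n) (t : Sp n) (g : Lat n → ℂ) : ℂ :=
  Real.cos (angle ‖v q‖ (halfDiff l j q t)) * g j +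
    Real.sin (angle ‖v q‖ (halfDiff l j q t)) * conj (phase v q) * g (j - q)

/-- The component of `g` along `vecMinus`. -/
def compMinus (l : ℕ) (v : Lat n →₀ ℂ) (j q : Lat n) (t : Sp n) (g : Lat n → ℂ) : ℂ :=
  -Real.sin (angle ‖v q‖ (halfDiff l j q t)) * g j +
    Real.cos (angle ‖v q‖ (halfDiff l j q t)) * conj (phase v q) * g (j - q)

lemma norm_rot_le {a b : ℝ} (ha : |a| ≤ 1) (hb : |b| ≤ 1) (z x y : ℂ) (hz : ‖z‖ = 1) :
    ‖(a : ℂ) * x + b * z * y‖ ≤ ‖x‖ + ‖y‖ := by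
  refine (norm_add_le _ _).trans ?_
  rw [norm_mul, norm_mul, norm_mul, hz, Complex.norm_real, Complex.norm_real, mul_one]
  simp only [Real.norm_eq_abs]
  nlinarith [norm_nonneg x, norm_nonneg y]

/-- Off the block and along `vecMinus`, solutions are small. -/
lemma Gaps.small_components (h : Gaps l v j q U L ε) (hT : Tight v q V w ε s₀ r) (hv0 : v 0 = 0)
    (hreal : ∀ a, v (-a) = conj (v a)) {t : Sp n} (ht : t ∈ U) {S : L1 (Lat n)} (hS : ‖S‖ ≤ s₀)
    {ν : ℝ} (hν : |ν - lamPlus l v j q t| ≤ radius v q) {g : Lat n → ℂ}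
    (hg : ∀ m, (freeEig l m t : ℂ) * g m + ∑' a, (coefs v + S) (m - a) * g a = ν * g m)
    {G : ℝ} (hG : ∀ m, ‖g m‖ ≤ G) :
    (∀ i, i ≠ j → i ≠ j - q → ‖g i‖ ≤ G / 4) ∧ ‖compMinus l v j q t g‖ ≤ G / 4 := by
  classical
  have hq := hT.hq
  have hw := hT.hw
  have hε := h.hε
  have hq0 : q ≠ 0 := by rintro rfl; exact hq hv0
  have hne : j - q ≠ j := by simpa using hq0
  have hG0 : 0 ≤ G := (norm_nonneg _).trans (hG 0)
  have hs0 : 0 ≤ s₀ := (norm_nonneg _).trans hS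
  have hV0 : 0 ≤ V := (norm_nonneg _).trans hT.hV
  have hvq : ‖v q‖ ≤ V := (L1.norm_apply_le (coefs v) q).trans hT.hV
  have hW : ‖coefs v + S‖ ≤ V + 1 :=
    (norm_add_le _ _).trans (add_le_add hT.hV (hS.trans hT.s_le))
  -- The window is at most half the spectral gap, so `ν` stays at distance `ε⁻¹ / 2` from every
  -- eigenvalue off the block.
  have hd : radius v q ≤ ε⁻¹ / 2 := by
    have h1 : ε * (V / 10) ≤ 1 / 2 := by nlinarith [hT.ε_V]
    have h2 : V / 10 ≤ ε⁻¹ / 2 := by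
      rw [inv_eq_one_div, div_div, le_div_iff₀ (by positivity)]; nlinarith
    unfold radius; linarith
  have hoff : ∀ i, i ≠ j → i ≠ j - q → ‖g i‖ ≤ 2 * ε * (V + 1) * G := by
    intro i h1 h2
    have e1 : ((freeEig l i t - ν : ℝ) : ℂ) * g i = -∑' a, (coefs v + S) (i - a) * g a := by
      push_cast; linear_combination hg i
    have e2 := congrArg norm e1
    rw [norm_mul, norm_neg, Complex.norm_real, Real.norm_eq_abs] at e2
    have e3 := norm_conv_bdd_le (coefs v + S) hG i
    have e4 : ε⁻¹ / 2 ≤ |freeEig l i t - ν| := by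
      have := h.gap t ht i h1 h2
      have h5 := abs_sub_abs_le_abs_sub (freeEig l i t - lamPlus l v j q t)
        (ν - lamPlus l v j q t)
      rw [show freeEig l i t - lamPlus l v j q t - (ν - lamPlus l v j q t)
        = freeEig l i t - ν by ring] at h5
      linarith
    have e5 : ε⁻¹ / 2 * ‖g i‖ ≤ (V + 1) * G := by
      calc _ ≤ |freeEig l i t - ν| * ‖g i‖ := by gcongr
        _ ≤ ‖coefs v + S‖ * G := e2 ▸ e3
        _ ≤ _ := by gcongr
    calc ‖g i‖ = 2 * ε * (ε⁻¹ / 2 * ‖g i‖) := by field_simp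
      _ ≤ 2 * ε * ((V + 1) * G) := by gcongr
      _ = _ := by ring
  have hεG : 2 * ε * (V + 1) * G ≤ G / 8 := by nlinarith [hT.ε_V]
  refine ⟨fun i h1 h2 => (hoff i h1 h2).trans (by linarith), ?_⟩
  -- the block components
  set X : Lat n → ℂ := fun m => ∑' a, (coefs v + S) (m - a) * g a - v (m - j) * g j
    - v (m - (j - q)) * g (j - q) with hX
  have hXb : ∀ m, ‖X m‖ ≤ (2 * ε * (V + 1) ^ 2 + 2 * s₀) * G := by
    intro m
    set gb : Lat n → ℂ := fun i => if i = j ∨ i = j - q then g i else 0 with hgb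
    set go : Lat n → ℂ := fun i => if i = j ∨ i = j - q then 0 else g i with hgo
    have hgbG : ∀ i, ‖gb i‖ ≤ G := fun i => by
      simp only [hgb]; split_ifs
      · exact hG i
      · simpa using hG0
    have hgoG : ∀ i, ‖go i‖ ≤ 2 * ε * (V + 1) * G := fun i => by
      simp only [hgo]; split_ifs with hi
      · rw [norm_zero]; positivity
      · push Not at hi; exact hoff i hi.1 hi.2
    have e1 : ∑' a, (coefs v + S) (m - a) * g a = ∑' a, (coefs v + S) (m - a) * gb a
        + ∑' a, (coefs v + S) (m - a) * go a := by
      rw [← (summable_conv_bdd _ hgbG m).tsum_add (summable_conv_bdd _ hgoG m)]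
      congr 1; ext a
      simp only [hgb, hgo]; split_ifs <;> ring
    have e2 : ∑' a, (coefs v + S) (m - a) * gb a
        = (coefs v + S) (m - j) * g j + (coefs v + S) (m - (j - q)) * g (j - q) := by
      rw [tsum_eq_sum (s := {j, j - q}), Finset.sum_pair hne.symm]
      · simp [hgb]
      · intro a ha
        simp only [Finset.mem_insert, Finset.mem_singleton] at ha
        simp [hgb, ha]
    have e3 : X m = S (m - j) * g j + S (m - (j - q)) * g (j - q)
        + ∑' a, (coefs v + S) (m - a) * go a := by
      simp only [hX]
      rw [e1, e2, L1.add_apply, L1.add_apply, coefs_apply, coefs_apply]; ring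
    rw [e3]
    have b1 : ‖S (m - j) * g j‖ ≤ s₀ * G := by
      rw [norm_mul]; gcongr
      exacts [(L1.norm_apply_le _ _).trans hS, hG _]
    have b2 : ‖S (m - (j - q)) * g (j - q)‖ ≤ s₀ * G := by
      rw [norm_mul]; gcongr
      exacts [(L1.norm_apply_le _ _).trans hS, hG _]
    have b3 : ‖∑' a, (coefs v + S) (m - a) * go a‖ ≤ (V + 1) * (2 * ε * (V + 1) * G) :=
      (norm_conv_bdd_le _ hgoG m).trans (by gcongr)
    refine (norm_add₃_le).trans ?_
    linarith
  set D := halfDiff l j q t with hD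
  set θ := angle ‖v q‖ D with hθ
  set B := split ‖v q‖ D with hB
  have hvq0 : 0 < ‖v q‖ := norm_pos_iff.2 hq
  have hBw : ‖v q‖ ≤ B := le_split _ _
  have ec : D * Real.cos θ + ‖v q‖ * Real.sin θ = B * Real.cos θ := eig_cos hvq0 D
  have es : ‖v q‖ * Real.cos θ - D * Real.sin θ = B * Real.sin θ := eig_sin hvq0 D
  have ec' : (D : ℂ) * Real.cos θ + ‖v q‖ * Real.sin θ = B * Real.cos θ := by exact_mod_cast ec
  have es' : (‖v q‖ : ℂ) * Real.cos θ - D * Real.sin θ = B * Real.sin θ := by exact_mod_cast es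
  have hlam : lamPlus l v j q t = (freeEig l j t + freeEig l (j - q) t) / 2 + B := by
    rw [lamPlus, halfGap_eq]
  have ha : (freeEig l j t : ℂ) = lamPlus l v j q t + D - B := by
    rw [hlam, hD, halfDiff]; push_cast; ring
  have hb : (freeEig l (j - q) t : ℂ) = lamPlus l v j q t - D - B := by
    rw [hlam, hD, halfDiff]; push_cast; ring
  have hph := phase_mul_conj (v := v) hq
  have hvn : v (-q) = ‖v q‖ * phase v q := by rw [hreal, norm_mul_phase hq]
  have hvp : v q = ‖v q‖ * conj (phase v q) := by
    have := congrArg conj hvn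
    rw [← hreal, neg_neg] at this
    calc v q = conj ((‖v q‖ : ℂ) * phase v q) := this
      _ = _ := by rw [map_mul, Complex.conj_ofReal]
  have gj := hg j
  have gq := hg (j - q)
  have xj : X j = ∑' a, (coefs v + S) (j - a) * g a - v q * g (j - q) := by
    simp [hX, hv0]
  have xq : X (j - q) = ∑' a, (coefs v + S) (j - q - a) * g a - v (-q) * g j := by
    simp [hX, hv0]
  -- Pairing with `e₋` diagonalises the model matrix; its other eigenvalue is `λ⁻ = λ⁺ - 2 * B`.
  have key : ((lamPlus l v j q t - 2 * B - ν : ℝ) : ℂ) * compMinus l v j q t g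
      = -(((-Real.sin θ : ℝ) : ℂ) * X j + Real.cos θ * conj (phase v q) * X (j - q)) := by
    rw [compMinus, ← hD, ← hθ, xj, xq, hvn]
    rw [ha] at gj
    rw [hb] at gq
    simp only [Complex.ofReal_sub, Complex.ofReal_mul, Complex.ofReal_ofNat, Complex.ofReal_neg]
    linear_combination (-Real.sin θ : ℂ) * gj + (Real.cos θ : ℂ) * conj (phase v q) * gq
      - (Real.cos θ : ℂ) * ‖v q‖ * g j * hph - g j * es' + conj (phase v q) * g (j - q) * ec'
      + (Real.sin θ : ℂ) * g (j - q) * hvp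
  have hn := congrArg norm key
  rw [norm_mul, norm_neg, Complex.norm_real, Real.norm_eq_abs] at hn
  have n1 : ‖((-Real.sin θ : ℝ) : ℂ) * X j + Real.cos θ * conj (phase v q) * X (j - q)‖
      ≤ ‖X j‖ + ‖X (j - q)‖ :=
    norm_rot_le (by rw [abs_neg]; exact Real.abs_sin_le_one θ) (Real.abs_cos_le_one θ) _ _ _
      (by rw [RCLike.norm_conj]; exact norm_phase hq)
  -- The lower eigenvalue lies `2 * B ≥ 2 |v_q|` below `λ⁺`, and the window has radius only `|v_q| /
  -- 10`.
  have n2 : w ≤ |lamPlus l v j q t - 2 * B - ν| := by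
    have h1 := (abs_le.1 hν).1
    have h2 : radius v q = ‖v q‖ / 10 := rfl
    rw [abs_of_nonpos (by linarith)]
    linarith [hT.hwq]
  have n3 : w * ‖compMinus l v j q t g‖ ≤ 2 * ((2 * ε * (V + 1) ^ 2 + 2 * s₀) * G) := by
    calc _ ≤ |lamPlus l v j q t - 2 * B - ν| * ‖compMinus l v j q t g‖ := by gcongr
      _ ≤ ‖X j‖ + ‖X (j - q)‖ := hn ▸ n1
      _ ≤ _ := by linarith [hXb j, hXb (j - q)]
  have n4 : 2 * ((2 * ε * (V + 1) ^ 2 + 2 * s₀) * G) ≤ w * (G / 4) := by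
    have := hT.ε_V2
    have := hT.s_w
    nlinarith
  exact le_of_mul_le_mul_left (n3.trans n4) hw

/-- A bounded solution with small component along `vecPlus` vanishes. -/
lemma Gaps.eq_zero (h : Gaps l v j q U L ε) (hT : Tight v q V w ε s₀ r) (hv0 : v 0 = 0)
    (hreal : ∀ a, v (-a) = conj (v a)) {t : Sp n} (ht : t ∈ U) {S : L1 (Lat n)} (hS : ‖S‖ ≤ s₀)
    {ν : ℝ} (hν : |ν - lamPlus l v j q t| ≤ radius v q) {g : Lat n → ℂ}
    (hg : ∀ m, (freeEig l m t : ℂ) * g m + ∑' a, (coefs v + S) (m - a) * g a = ν * g m)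
    {C : ℝ} (hC : ∀ m, ‖g m‖ ≤ C)
    (hp : ∀ G, (∀ m, ‖g m‖ ≤ G) → ‖compPlus l v j q t g‖ ≤ G / 4) : g = 0 := by
  have hq := hT.hq
  -- On the block `g` is a rotation of its two components, each at most `G / 4`. Every bound is thus
  -- halved, and applying this to the supremum forces it to be zero.
  have half : ∀ G, (∀ m, ‖g m‖ ≤ G) → ∀ m, ‖g m‖ ≤ G / 2 := by
    intro G hG m
    obtain ⟨h1, h2⟩ := h.small_components hT hv0 hreal ht hS hν hg hG
    have h3 := hp G hG
    have hG0 : 0 ≤ G := (norm_nonneg _).trans (hG 0)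
    set θ := angle ‖v q‖ (halfDiff l j q t) with hθ
    have cs' : (Real.cos θ : ℂ) ^ 2 + (Real.sin θ : ℂ) ^ 2 = 1 := by
      exact_mod_cast Real.cos_sq_add_sin_sq θ
    have hph := phase_mul_conj (v := v) hq
    by_cases hm1 : m = j
    · have e : g j = (Real.cos θ : ℂ) * compPlus l v j q t g
          + ((-Real.sin θ : ℝ) : ℂ) * 1 * compMinus l v j q t g := by
        rw [compPlus, compMinus, ← hθ, Complex.ofReal_neg]; linear_combination -(g j) * cs'
      rw [hm1, e]
      refine (norm_rot_le (Real.abs_cos_le_one θ) (by rw [abs_neg]; exact Real.abs_sin_le_one θ)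
        _ _ _ (by simp)).trans (by linarith)
    · by_cases hm2 : m = j - q
      · have e : g (j - q) = phase v q * ((Real.sin θ : ℂ) * compPlus l v j q t g
          + Real.cos θ * 1 * compMinus l v j q t g) := by
          rw [compPlus, compMinus, ← hθ]
          linear_combination -(g (j - q)) * hph - g (j - q) * conj (phase v q) * phase v q * cs'
        rw [hm2, e, norm_mul, norm_phase hq, one_mul]
        refine (norm_rot_le (Real.abs_sin_le_one θ) (Real.abs_cos_le_one θ)
          _ _ _ (by simp)).trans (by linarith)
      · exact (h1 m hm1 hm2).trans (by linarith)
  have hbdd : BddAbove (Set.range fun m => ‖g m‖) := ⟨C, by rintro _ ⟨m, rfl⟩; exact hC m⟩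
  have hle : ∀ m, ‖g m‖ ≤ ⨆ m, ‖g m‖ := fun m => le_ciSup hbdd m
  have h2 : ⨆ m, ‖g m‖ ≤ (⨆ m, ‖g m‖) / 2 := ciSup_le (half _ hle)
  ext m
  have h3 := hle m
  have h4 := norm_nonneg (g m)
  have : ‖g m‖ = 0 := by linarith
  simpa using this

/-- Splits the pairing with the trial vector when `g` is only bounded, so that `L1.pair` does not
apply. -/
lemma tsum_conj_trial (hq0 : q ≠ 0) {t : Sp n} {x : Unk (Lat n)} {g : Lat n → ℂ} {G : ℝ}
    (hG : ∀ m, ‖g m‖ ≤ G) :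
    ∑' m, conj (trial (vecPlus l v j q t) (vecMinus l v j q t) x m) * g m
      = compPlus l v j q t g + conj x.2.1 * compMinus l v j q t g + ∑' m, conj (x.2.2 m) * g m := by
  have hne : j - q ≠ j := by simpa using hq0
  have s2 : Summable fun m => conj (x.2.2 m) * g m := by
    refine Summable.of_norm_bounded ((L1.summable_norm x.2.2).mul_right G) fun m => ?_
    rw [norm_mul, RCLike.norm_conj]; gcongr; exact hG _
  have hz : ∀ m ∉ ({j, j - q} : Finset (Lat n)),
      conj ((vecPlus l v j q t + x.2.1 • vecMinus l v j q t) m) * g m = 0 := by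
    intro m hm
    simp only [Finset.mem_insert, Finset.mem_singleton, not_or] at hm
    simp [vecPlus_apply_ne t hm.1 hm.2, vecMinus_apply_ne t hm.1 hm.2]
  have s1 : Summable fun m =>
      conj ((vecPlus l v j q t + x.2.1 • vecMinus l v j q t) m) * g m := summable_of_ne_finset_zero hz
  have e : ∀ m, conj (trial (vecPlus l v j q t) (vecMinus l v j q t) x m) * g m
      = conj ((vecPlus l v j q t + x.2.1 • vecMinus l v j q t) m) * g m
        + conj (x.2.2 m) * g m := by
    intro m; rw [trial, L1.add_apply, map_add, add_mul]
  simp_rw [e]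
  rw [s1.tsum_add s2, tsum_eq_sum hz, Finset.sum_pair hne.symm]
  congr 1
  simp only [L1.add_apply, L1.smul_apply, vecPlus_apply_j hq0, vecPlus_apply_jq hq0,
    vecMinus_apply_j hq0, vecMinus_apply_jq hq0, map_add, map_mul, map_neg, Complex.conj_ofReal,
    compPlus, compMinus]
  ring

/-- The fixed point of `eigMap` gives the spectral pair of the operator. -/
lemma Gaps.isSpectralPair (h : Gaps l v j q U L ε) (hT : Tight v q V w ε s₀ r) (hv0 : v 0 = 0)
    (hreal : ∀ a, v (-a) = conj (v a)) {t : Sp n} (ht : t ∈ U) {S : L1 (Lat n)} (hS : ‖S‖ ≤ s₀)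
    (hSr : IsReal S) {x : Unk (Lat n)} (hxr : ‖x‖ ≤ r)
    (hm : 1 / 2 ≤ mass (trial (vecPlus l v j q t) (vecMinus l v j q t) x))
    (hx : eigMap (vecPlus l v j q t) (vecMinus l v j q t) (res l v j q t) (invGap l v j q t)
      (coefs v) S x = x) :
    IsSpectralPair l (ser (coefs v + S)) t (lamPlus l v j q t) (radius v q)
      (fun p r => projMat (trial (vecPlus l v j q t) (vecMinus l v j q t) x) (p, r))
      (lamPlus l v j q t + x.1) := by
  have hq := hT.hq
  have hq0 : q ≠ 0 := by rintro rfl; exact hq hv0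
  obtain ⟨⟨hgj, hgq⟩, y, hy⟩ := h.eigen_eq hv0 hreal hq ht hx
  set f := trial (vecPlus l v j q t) (vecMinus l v j q t) x with hf
  have hw : IsReal (coefs v + S) := IsReal.add (fun a => hreal a) hSr
  have hpf : L1.pair (vecPlus l v j q t) f = 1 := by
    have e1 : L1.pair (vecPlus l v j q t) (x.2.1 • vecMinus l v j q t) = 0 := by
      have := pair_plus_minus (l := l) (j := j) hq0 hq t
      rw [pair_vecPlus hq0] at this ⊢
      simp only [L1.smul_apply]
      linear_combination x.2.1 * this
    have e2 : L1.pair (vecPlus l v j q t) x.2.2 = 0 := by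
      rw [pair_vecPlus hq0, hgj, hgq]; ring
    rw [hf, trial, map_add, map_add, pair_plus_plus hq0 hq, e1, e2]; ring
  -- Green's identity for `f` against itself has left side zero, and the defect `i y e₊` enters on
  -- the right as `-i y - i y` because `⟨e₊, f⟩ = 1`.
  have hy0 : y = 0 := by
    set z := (y * Complex.I) • vecPlus l v j q t with hz
    have hg := green hw (p := fun m => freeEig l m t) (f := f) (y := z) (g := f) (z := z)
      (C := ‖f‖ + ‖z‖) (fun m => (L1.norm_apply_le f m).trans (by linarith [norm_nonneg z]))
      (fun m => (L1.norm_apply_le z m).trans (by linarith [norm_nonneg f])) hy hy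
    rw [sub_self, Complex.ofReal_zero, zero_mul] at hg
    have e1 : ∑' m, conj (z m) * f m = -(y * Complex.I) * 1 := by
      rw [← hpf, L1.pair_apply, ← tsum_mul_left]
      congr 1; ext m
      rw [hz, L1.smul_apply]; simp; ring
    have e2 : ∑' m, conj (f m) * z m = (y * Complex.I) * 1 := by
      have : L1.pair f (vecPlus l v j q t) = 1 := by rw [← L1.pair_conj, hpf, map_one]
      rw [← this, L1.pair_apply, ← tsum_mul_left]
      congr 1; ext m
      rw [hz, L1.smul_apply]; ring
    rw [e1, e2] at hg
    have : (y : ℂ) * Complex.I = 0 := by linear_combination hg / 2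
    simpa using this
  have hfe : ∀ m, (freeEig l m t : ℂ) * f m + ∑' a, (coefs v + S) (m - a) * f a
      = ((lamPlus l v j q t + x.1 : ℝ) : ℂ) * f m := by
    intro m; rw [hy m, hy0]; simp
  have hμ : |x.1| ≤ r := (norm_fst_le x).trans hxr
  have hrad : radius v q = ‖v q‖ / 10 := rfl
  have hμ2 : |lamPlus l v j q t + x.1 - lamPlus l v j q t| < radius v q := by
    rw [add_sub_cancel_left]
    linarith [hT.r_w, hT.hw, hT.hwq]
  have hm0 : 0 < mass f := by linarith
  set N := √(mass f) with hN
  have hN0 : 0 < N := Real.sqrt_pos.2 hm0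
  have hN2 : N * N = mass f := Real.mul_self_sqrt hm0.le
  have hNc : (N : ℂ) ≠ 0 := by exact_mod_cast hN0.ne'
  set F : L1 (Lat n) := (N⁻¹ : ℝ) • f with hF
  have hFa : ∀ m, F m = (N : ℂ)⁻¹ * f m := fun m => by rw [hF, L1.rsmul_apply]; push_cast; rfl
  refine ⟨hμ2, F, ⟨L1.summable_sq F, fun m => ?_⟩, ?_, fun p r => ?_, ?_⟩
  · rw [hamiltonian_ser]
    have e1 : ∑' a, (coefs v + S) (m - a) * F a
        = (N : ℂ)⁻¹ * ∑' a, (coefs v + S) (m - a) * f a := by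
      rw [← tsum_mul_left]; congr 1; ext a; rw [hFa]; ring
    rw [e1, hFa]; linear_combination (N : ℂ)⁻¹ * hfe m
  · have : ∀ m, ‖F m‖ ^ 2 = (mass f)⁻¹ * ‖f m‖ ^ 2 := by
      intro m
      rw [hFa, norm_mul, norm_inv, Complex.norm_real, Real.norm_of_nonneg hN0.le, ← hN2]
      field_simp
    simp_rw [this]
    rw [tsum_mul_left, ← mass_eq, inv_mul_cancel₀ hm0.ne']
  · change projMat f (p, r) = _
    rw [projMat_apply, hFa, hFa, ← hN2]
    simp only [map_mul, map_inv₀, Complex.conj_ofReal]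
    push_cast; field_simp
  · intro ν g hν hg hg0
    have hgb : ∀ m, ‖g m‖ ≤ √(∑' m, ‖g m‖ ^ 2) := fun m =>
      Real.le_sqrt_of_sq_le (hg.1.le_tsum m fun _ _ => by positivity)
    have hge : ∀ m, (freeEig l m t : ℂ) * g m + ∑' a, (coefs v + S) (m - a) * g a = ν * g m := by
      intro m; rw [← hamiltonian_ser]; exact hg.2 m
    have hνμ : ν = lamPlus l v j q t + x.1 := by
      by_contra hne
      -- For `ν ≠ μ` the solution is orthogonal to `f`. As `f` is close to `e₊`, the `e₊` component
      -- of `g` is at most `r * (G / 4) + r * G ≤ G / 4`.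
      refine hg0 (h.eq_zero hT hv0 hreal ht hS hν hge hgb fun G hG => ?_)
      have hgr := green hw (p := fun m => freeEig l m t) (f := f) (y := 0) (g := g) (z := 0)
        (μ := lamPlus l v j q t + x.1) (ν := ν)
        hgb (fun m => by simp) (fun m => by rw [hfe m]; simp) (fun m => by rw [hge m]; simp)
      simp only [L1.zero_apply, map_zero, zero_mul, Pi.zero_apply, mul_zero, tsum_zero,
        sub_zero] at hgr
      have h0 : ∑' m, conj (f m) * g m = 0 :=
        (mul_eq_zero.1 hgr).resolve_left (by exact_mod_cast sub_ne_zero.2 hne)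
      rw [hf, tsum_conj_trial hq0 hG] at h0
      have hcm := (h.small_components hT hv0 hreal ht hS hν hge hG).2
      have hG0 : 0 ≤ G := (norm_nonneg _).trans (hG 0)
      have hα : ‖x.2.1‖ ≤ r := (norm_fst_le _).trans ((norm_snd_le _).trans hxr)
      have hh : ‖x.2.2‖ ≤ r := (norm_snd_le _).trans ((norm_snd_le _).trans hxr)
      have hr0 : 0 ≤ r := (norm_nonneg _).trans hα
      have b1 : ‖conj x.2.1 * compMinus l v j q t g‖ ≤ r * (G / 4) := by
        rw [norm_mul, RCLike.norm_conj]; gcongr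
      have b2 : ‖∑' m, conj (x.2.2 m) * g m‖ ≤ r * G := by
        calc _ ≤ ‖x.2.2‖ * G := by
              rw [L1.norm_eq, ← tsum_mul_right]
              refine tsum_of_norm_bounded ((L1.summable_norm x.2.2).mul_right G).hasSum fun m => ?_
              rw [norm_mul, RCLike.norm_conj]; gcongr; exact hG m
          _ ≤ r * G := by gcongr
      have e : compPlus l v j q t g
          = -(conj x.2.1 * compMinus l v j q t g) - ∑' m, conj (x.2.2 m) * g m := by
        linear_combination h0
      rw [e]
      refine (norm_sub_le _ _).trans ?_
      rw [norm_neg]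
      nlinarith [hT.r_le]
    -- Subtracting `u f`, with `u` the `e₊` component of `g`, leaves a solution with no `e₊`
    -- component, which vanishes. The factor `N` converts `f` to the unit vector `F`.
    refine ⟨hνμ, compPlus l v j q t g * N, ?_⟩
    set u := compPlus l v j q t g with hu
    have hz : (fun m => g m - u * f m) = 0 := by
      refine h.eq_zero hT hv0 hreal ht hS hν (C := √(∑' m, ‖g m‖ ^ 2) + ‖u‖ * ‖f‖) ?_ ?_ ?_
      · intro m
        have e1 : ∑' a, (coefs v + S) (m - a) * (g a - u * f a)
            = ∑' a, (coefs v + S) (m - a) * g a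
              - u * ∑' a, (coefs v + S) (m - a) * f a := by
          rw [← tsum_mul_left, ← (summable_conv_bdd (coefs v + S) hgb m).tsum_sub
            ((summable_conv_bdd (coefs v + S) (L1.norm_apply_le f) m).mul_left u)]
          congr 1; ext a; ring
        rw [e1]
        have h1 := hge m
        have h2 := hfe m
        rw [← hνμ] at h2
        linear_combination h1 - u * h2
      · intro m
        refine (norm_sub_le _ _).trans (add_le_add (hgb m) ?_)
        rw [norm_mul]; gcongr; exact L1.norm_apply_le f m
      · intro G hG
        have : compPlus l v j q t (fun m => g m - u * f m) = 0 := by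
          have h1 : compPlus l v j q t (fun m => g m - u * f m)
              = u - u * L1.pair (vecPlus l v j q t) f := by
            rw [pair_vecPlus hq0]; rw [hu, compPlus, compPlus]; ring
          rw [h1, hpf]; ring
        rw [this, norm_zero]
        have : 0 ≤ G := (norm_nonneg _).trans (hG 0)
        positivity
    intro m
    have := congrFun hz m
    simp only [Pi.zero_apply] at this
    rw [hFa]
    field_simp
    linear_combination this

end Uniqueness

/-! ### Successive approximations in terms of Fourier coefficients -/

section Iteration
variable {n l : ℕ} {v : Lat n →₀ ℂ} {j q : Lat n} {U : Set (Sp n)} {L ε V w s₀ r τ : ℝ}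

/-- Two unit eigenvectors differ by a phase, which cancels in `f_p conj f_r`. Hence the choice made
in `specProj` is immaterial. -/
lemma IsSpectralPair.eq_of_eq {W : Sp n → ℂ} {t : Sp n} {c d μ μ' : ℝ}
    {E E' : Lat n → Lat n → ℂ} (h : IsSpectralPair l W t c d E μ)
    (h' : IsSpectralPair l W t c d E' μ') : E' = E := by
  obtain ⟨-, f, hf, hf1, hE, hu⟩ := h
  obtain ⟨hμ', f', hf', hf1', hE', -⟩ := h'
  have hne : f' ≠ 0 := by
    rintro rfl
    simp at hf1'
  obtain ⟨-, a, ha⟩ := hu μ' f' hμ'.le hf' hne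
  have ha1 : ‖a‖ ^ 2 = 1 := by
    simp_rw [ha, norm_mul, mul_pow] at hf1'
    rwa [tsum_mul_left, hf1, mul_one] at hf1'
  have ha2 : a * conj a = 1 := by rw [Complex.mul_conj']; exact_mod_cast ha1
  ext p r
  rw [hE', hE, ha, ha, map_mul]
  linear_combination f p * conj (f r) * ha2

lemma specProj_eq {W : Sp n → ℂ} {t : Sp n} {c d μ : ℝ} {E : Lat n → Lat n → ℂ}
    (h : IsSpectralPair l W t c d E μ) : specProj l W t c d = E := by
  have hex : ∃ E : Lat n → Lat n → ℂ, ∃ μ : ℝ, IsSpectralPair l W t c d E μ := ⟨E, μ, h⟩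
  rw [specProj, dif_pos hex]
  obtain ⟨μ', h'⟩ := hex.choose_spec
  exact h.eq_of_eq h'

lemma column_apply (f : L1 (Lat n)) (s : Lat n) : column j f s = projMat f (s, j) := by
  rw [projMat_apply, column, L1.rsmul_apply, L1.smul_apply]; ring

/-- One step of the iteration, on the side of the Fourier coefficients. -/
lemma potMap_ser {t : Sp n} {S f : L1 (Lat n)} {μ : ℝ} {σ : ℝ} {A : ℂ}
    (h : IsSpectralPair l (ser (coefs v + S)) t (lamPlus l v j q t) (radius v q)
      (fun p r => projMat f (p, r)) μ) :
    potMap l v j q σ A t (ser (coefs v + S)) = ser (coefs v + density j (σ * ‖A‖ ^ 2) f) := by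
  ext x
  have h1 : solU l v j q A t (ser (coefs v + S)) x
      = A * ∑' s, column j f s * planeWave (mom s t) x := by
    rw [solU, specProj_eq h]
    simp_rw [column_apply]
  rw [potMap, h1, trigPoly_eq, ser_add, density]
  congr 1
  rw [Complex.ofReal_mul, normSq_planeWave_series]
  have h2 : ∀ (c : ℝ) (f : L1 (Lat n)), c • f = (c : ℂ) • f := fun c f => by
    apply L1.ext; intro i; rw [L1.rsmul_apply, L1.smul_apply]
  rw [h2, ser_smul]
  push_cast; ring

/-- The successive approximations, on the side of the Fourier coefficients. -/
lemma iterPot_eq {t : Sp n} {σ : ℝ} {A : ℂ} {F : L1 (Lat n) → L1 (Lat n)}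
    (hF : ∀ S, ‖S‖ ≤ s₀ → IsReal S → ∃ μ, IsSpectralPair l (ser (coefs v + S)) t (lamPlus l v j q t)
      (radius v q) (fun p r => projMat (F S) (p, r)) μ)
    (hS : ∀ m, ‖(fun S => density j (σ * ‖A‖ ^ 2) (F S))^[m] 0‖ ≤ s₀) (m : ℕ) :
    IsReal ((fun S => density j (σ * ‖A‖ ^ 2) (F S))^[m] 0) ∧
    iterPot l v j q σ A t m
      = ser (coefs v + (fun S => density j (σ * ‖A‖ ^ 2) (F S))^[m] 0) := by
  induction m with
  | zero => exact ⟨fun a => by simp, by simp [iterPot, trigPoly_eq]⟩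
  | succ m ih =>
    rw [Function.iterate_succ_apply', iterPot, ih.2]
    obtain ⟨μ, hμ⟩ := hF _ (hS m) ih.1
    exact ⟨isReal_density _ _ _, potMap_ser hμ⟩

end Iteration

/-! ### Gradients of matrix-valued functions -/

section Gradients
variable {n : ℕ}

/-- The entries of the gradient of a matrix-valued function with the derivative `D`. -/
def gradEntry (D : Sp n →L[ℝ] L1 (Lat n × Lat n)) (p r : Lat n) : EuclideanSpace ℂ (Fin n) :=
  WithLp.toLp 2 fun s => D (EuclideanSpace.single s 1) (p, r)

lemma sum_gradEntry (D : Sp n →L[ℝ] L1 (Lat n × Lat n)) (p r : Lat n) (h : Sp n) :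
    ∑ s, ((h s : ℝ) : ℂ) * gradEntry D p r s = D h (p, r) := by
  have h1 : h = ∑ s, h s • EuclideanSpace.single s (1 : ℝ) := by
    ext i
    simp [Pi.single_apply]
  have h2 : D h (p, r) = L1.coord (p, r) (D h) := rfl
  rw [h2]
  conv_rhs => rw [h1]
  simp only [map_sum, map_smul, Complex.real_smul]
  rfl

/-- One row sum and one column sum are each at most the sum over all entries, and `norm0` takes half
of their total. Estimates in `ℓ¹(ℤⁿ × ℤⁿ)` are therefore sufficient. -/
lemma norm0_le (T : L1 (Lat n × Lat n)) : norm0 (fun p r => T (p, r)) ≤ ENNReal.ofReal ‖T‖ := by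
  have htot : ENNReal.ofReal ‖T‖ = ∑' x : Lat n × Lat n, ‖T x‖ₑ := by
    rw [L1.norm_eq, ENNReal.ofReal_tsum_of_nonneg (fun _ => norm_nonneg _) (L1.summable_norm T)]
    simp_rw [ofReal_norm]
  have h1 : ∑' p : Lat n, ∑' r, ‖T (p, r)‖ₑ = ENNReal.ofReal ‖T‖ := by
    rw [htot]; exact (ENNReal.tsum_prod (f := fun p r => ‖T (p, r)‖ₑ)).symm
  have h2 : ∑' r : Lat n, ∑' p, ‖T (p, r)‖ₑ = ENNReal.ofReal ‖T‖ := by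
    rw [ENNReal.tsum_comm, h1]
  unfold norm0
  refine ENNReal.div_le_of_le_mul ?_
  refine iSup_le fun r => ?_
  rw [ENNReal.tsum_add, mul_comm, two_mul]
  refine add_le_add ?_ ?_
  · rw [← h2]; exact ENNReal.le_tsum (f := fun r => ∑' p, ‖T (p, r)‖ₑ) r
  · rw [← h1]; exact ENNReal.le_tsum (f := fun p => ∑' r, ‖T (p, r)‖ₑ) r

/-- Each of the `n` coordinate directions is a unit vector and contributes at most `‖D‖`. -/
lemma norm0_gradEntry_le (D : Sp n →L[ℝ] L1 (Lat n × Lat n)) :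
    norm0 (gradEntry D) ≤ ENNReal.ofReal (n * ‖D‖) := by
  have hent : ∀ p r, ‖gradEntry D p r‖ ≤ ∑ s, ‖D (EuclideanSpace.single s 1) (p, r)‖ := by
    intro p r
    have e : gradEntry D p r = ∑ s, EuclideanSpace.single s (D (EuclideanSpace.single s 1) (p, r)) := by
      ext i; simp [gradEntry, Pi.single_apply]
    rw [e]
    exact (norm_sum_le _ _).trans (by simp)
  have hs : Summable fun x : Lat n × Lat n => ∑ s, ‖D (EuclideanSpace.single s 1) x‖ :=
    summable_sum fun s _ => L1.summable_norm _
  let T : L1 (Lat n × Lat n) :=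
    L1.mk (fun x => ((∑ s, ‖D (EuclideanSpace.single s 1) x‖ : ℝ) : ℂ)) (by
      refine hs.congr fun x => ?_
      rw [Complex.norm_real, Real.norm_of_nonneg (Finset.sum_nonneg fun _ _ => norm_nonneg _)])
  have hT : ‖T‖ ≤ n * ‖D‖ := by
    have e1 : ‖T‖ = ∑ s, ‖D (EuclideanSpace.single s 1)‖ := by
      simp_rw [L1.norm_eq]
      rw [← Summable.tsum_finsetSum fun s _ => L1.summable_norm _]
      congr 1; ext x
      simp only [T, L1.mk_apply]
      rw [Complex.norm_real, Real.norm_of_nonneg (Finset.sum_nonneg fun _ _ => norm_nonneg _)]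
    rw [e1]
    calc _ ≤ ∑ _s : Fin n, ‖D‖ := by
          refine Finset.sum_le_sum fun s _ => ?_
          refine (D.le_opNorm _).trans ?_
          simp
      _ = _ := by simp
  refine le_trans ?_ ((norm0_le T).trans (ENNReal.ofReal_le_ofReal hT))
  have hle : ∀ p r, ‖gradEntry D p r‖ₑ ≤ ‖T (p, r)‖ₑ := by
    intro p r
    rw [← ofReal_norm, ← ofReal_norm]
    refine ENNReal.ofReal_le_ofReal ((hent p r).trans ?_)
    simp only [T, L1.mk_apply]
    rw [Complex.norm_real]
    exact le_abs_self _
  unfold norm0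
  gcongr
  · exact hle _ _
  · exact hle _ _

lemma hasMatrixGradient {T : Sp n → L1 (Lat n × Lat n)} {T' : Sp n → Lat n → Lat n → ℂ} {t : Sp n}
    (hT : DifferentiableAt ℝ T t) (hTT : ∀ᶠ s in 𝓝 t, ∀ p r, T' s p r = T s (p, r)) :
    HasMatrixGradient T' (gradEntry (fderiv ℝ T t)) t := by
  have h1 := (hasFDerivAt_iff_isLittleO_nhds_zero.1 hT.hasFDerivAt)
  have h2 : Tendsto (fun h => ENNReal.ofReal (‖T (t + h) - T t - fderiv ℝ T t h‖ / ‖h‖)) (𝓝[≠] 0)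
      (𝓝 0) := by
    have := (h1.norm_left.norm_right.tendsto_div_nhds_zero).mono_left
      (nhdsWithin_le_nhds (s := {0}ᶜ))
    simpa using ENNReal.tendsto_ofReal this
  refine tendsto_of_tendsto_of_tendsto_of_le_of_le' tendsto_const_nhds h2
    (Eventually.of_forall fun _ => zero_le) ?_
  have hadd : Tendsto (fun h => t + h) (𝓝[≠] 0) (𝓝 t) := by
    have : ContinuousAt (fun h => t + h) 0 := by fun_prop
    simpa using this.tendsto.mono_left (nhdsWithin_le_nhds (s := {0}ᶜ))
  filter_upwards [hadd.eventually hTT, self_mem_nhdsWithin] with h hh hne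
  have hpos : 0 < ‖h‖ := norm_pos_iff.2 hne
  rw [ENNReal.ofReal_div_of_pos hpos, ← ofReal_norm h]
  gcongr
  refine le_trans (le_of_eq ?_) (norm0_le _)
  congr 1
  ext p r
  rw [sum_gradEntry, hh, hTT.self_of_nhds]; rfl

end Gradients

/-! ### Spectral gaps near a resonant quasimomentum -/

section NearResonance
variable {n l : ℕ} {v : Lat n →₀ ℂ} {j q i : Lat n} {t₀ t t' : Sp n} {k ρ η ε : ℝ}

lemma abs_norm_mom_sub_le (i : Lat n) (t t' : Sp n) : |‖mom i t‖ - ‖mom i t'‖| ≤ dist t t' := by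
  refine (abs_norm_sub_norm_le _ _).trans (le_of_eq ?_)
  rw [mom_eq, mom_eq i t', add_sub_add_left_eq_sub, dist_eq_norm]

/-- Used with `x = p_i²`, `y = p_j²` or `p_{j-q}²` to turn a gap between squares into a gap between
`2l`-th powers, gaining a factor of order `k^(2l-2)`. -/
lemma abs_sub_mul_pow_le {x y : ℝ} (hx : 0 ≤ x) (hy : 0 ≤ y) (m : ℕ) :
    |x - y| * y ^ m ≤ |x ^ (m + 1) - y ^ (m + 1)| := by
  rcases le_total y x with h | h
  · rw [abs_of_nonneg (by linarith), abs_of_nonneg (by have := pow_le_pow_left₀ hy h (m + 1); linarith),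
      pow_succ, pow_succ]
    have := pow_le_pow_left₀ hy h m
    nlinarith
  · rw [abs_sub_comm, abs_sub_comm (x ^ (m + 1)), abs_of_nonneg (by linarith),
      abs_of_nonneg (by have := pow_le_pow_left₀ hx h (m + 1); linarith), pow_succ, pow_succ]
    have := pow_le_pow_left₀ hx h m
    nlinarith

lemma abs_pow_sub_pow_le_of_le {x y B : ℝ} (hx : 0 ≤ x) (hy : 0 ≤ y) (hxB : x ≤ B) (hyB : y ≤ B)
    (m : ℕ) : |x ^ (m + 1) - y ^ (m + 1)| ≤ (m + 1) * B ^ m * |x - y| := by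
  have h := abs_pow_sub_pow_le x y (m + 1)
  rw [abs_of_nonneg hx, abs_of_nonneg hy, Nat.add_sub_cancel] at h
  have hB := pow_le_pow_left₀ (hx.trans (le_max_left x y)) (max_le hxB hyB) m
  calc _ ≤ |x - y| * ((m + 1 : ℕ) : ℝ) * max x y ^ m := h
    _ ≤ |x - y| * ((m + 1 : ℕ) : ℝ) * B ^ m := by gcongr
    _ = _ := by push_cast; ring

/-- A quasimomentum at which the indices `j`, `j - q` are in resonance and all others are not:
`η` measures the distance to the others, `ρ` is the radius of the neighbourhood to consider. -/
structure NearRes (k ρ η : ℝ) (q j : Lat n) (t₀ : Sp n) : Prop where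
  k_ge : 100 ≤ k
  ρ_pos : 0 < ρ
  kρ : k * ρ ≤ 1
  ρη : 11 * (k * ρ) ≤ η
  at_j : ‖mom j t₀‖ = k
  at_jq : |‖mom (j - q) t₀‖ ^ 2 - k ^ 2| ≤ 1
  off : ∀ i : Lat n, i ≠ j → i ≠ j - q →
    2 * η ≤ |‖mom j t₀‖ ^ 2 - ‖mom i t₀‖ ^ 2| ∧ 2 * η ≤ |‖mom (j - q) t₀‖ ^ 2 - ‖mom i t₀‖ ^ 2|

namespace NearRes

lemma ρ_le (h : NearRes k ρ η q j t₀) : ρ ≤ 1 / 100 := by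
  have := h.k_ge
  have := h.kρ
  have := h.ρ_pos
  nlinarith

lemma at_jq_le (h : NearRes k ρ η q j t₀) : ‖mom (j - q) t₀‖ ≤ k + 1 := by
  have := (abs_le.1 h.at_jq).2
  have := h.k_ge
  nlinarith [norm_nonneg (mom (j - q) t₀)]

lemma sq_change (h : NearRes k ρ η q j t₀) (ht : t ∈ ball t₀ ρ) (i : Lat n) {c : ℝ}
    (hi : ‖mom i t₀‖ ≤ c * k) : |‖mom i t‖ ^ 2 - ‖mom i t₀‖ ^ 2| ≤ (2 * c + 1) * (k * ρ) := by
  have h1 := (abs_norm_mom_sub_le i t t₀).trans (mem_ball.1 ht).le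
  have h2 := h.ρ_pos
  have h3 := h.ρ_le
  have h4 := h.k_ge
  have h5 := norm_nonneg (mom i t₀)
  have h6 := norm_nonneg (mom i t)
  have h7 := (abs_le.1 h1).2
  have e : ‖mom i t‖ ^ 2 - ‖mom i t₀‖ ^ 2
    = (‖mom i t‖ - ‖mom i t₀‖) * (‖mom i t‖ + ‖mom i t₀‖) := by ring
  rw [e, abs_mul, abs_of_nonneg (add_nonneg h6 h5)]
  calc _ ≤ ρ * ((2 * c + 1) * k) := by gcongr; linarith
    _ = _ := by ring

lemma sq_j (h : NearRes k ρ η q j t₀) (ht : t ∈ ball t₀ ρ) : |‖mom j t‖ ^ 2 - k ^ 2| ≤ 5 := by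
  have h1 := h.sq_change ht j (c := 1) (by rw [h.at_j, one_mul])
  rw [h.at_j] at h1
  linarith [h.kρ]

lemma sq_jq (h : NearRes k ρ η q j t₀) (ht : t ∈ ball t₀ ρ) :
    |‖mom (j - q) t‖ ^ 2 - k ^ 2| ≤ 5 := by
  have h1 := abs_le.1 (h.sq_change ht (j - q) (c := 3 / 2) (by linarith [h.at_jq_le, h.k_ge]))
  have h2 := abs_le.1 h.at_jq
  have := h.kρ
  rw [abs_le]; constructor <;> linarith [h1.1, h1.2, h2.1, h2.2]

lemma mom_le (h : NearRes k ρ η q j t₀) (ht : t ∈ ball t₀ ρ) (hi : ‖mom i t₀‖ ≤ 3 * k) :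
    ‖mom i t‖ ≤ 4 * k := by
  have h1 := (abs_le.1 ((abs_norm_mom_sub_le i t t₀).trans (mem_ball.1 ht).le)).2
  linarith [h.k_ge, h.ρ_le]

lemma le_mom (h : NearRes k ρ η q j t₀) (ht : t ∈ ball t₀ ρ) (hi : 3 * k < ‖mom i t₀‖) :
    29 / 10 * k ≤ ‖mom i t‖ := by
  have h1 := (abs_le.1 ((abs_norm_mom_sub_le i t t₀).trans (mem_ball.1 ht).le)).1
  linarith [h.k_ge, h.ρ_le]

/-- Moving from `t₀` to `t` changes `p_i²` by at most `7 k ρ` and the block value by at most `4 k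
ρ`. The total `11 k ρ ≤ η` leaves a gap `η` out of `2 η`. -/
lemma freeEig_near (h : NearRes k ρ η q j t₀) {m : ℕ} {p : Lat n}
    (hp : ‖mom p t₀‖ ≤ 3 / 2 * k) (hpk : |‖mom p t‖ ^ 2 - k ^ 2| ≤ 5)
    (hoff : 2 * η ≤ |‖mom p t₀‖ ^ 2 - ‖mom i t₀‖ ^ 2|)
    (ht : t ∈ ball t₀ ρ) (hi : ‖mom i t₀‖ ≤ 3 * k) :
    η * (k ^ 2 / 2) ^ m ≤ |freeEig (m + 1) i t - freeEig (m + 1) p t| := by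
  have h1 := abs_le.1 (h.sq_change ht i hi)
  have h2 := abs_le.1 (h.sq_change ht p hp)
  have h0 := h.k_ge
  have hη : η ≤ |‖mom i t‖ ^ 2 - ‖mom p t‖ ^ 2| := by
    rw [abs_sub_comm]
    have := h.ρη
    rcases le_abs.1 hoff with h3 | h3
    · exact le_abs.2 (Or.inl (by linarith [h1.1, h1.2, h2.1, h2.2]))
    · exact le_abs.2 (Or.inr (by linarith [h1.1, h1.2, h2.1, h2.2]))
  have hy : k ^ 2 / 2 ≤ ‖mom p t‖ ^ 2 := by
    have := (abs_le.1 hpk).1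
    nlinarith
  rw [freeEig_eq, freeEig_eq]
  refine le_trans ?_ (abs_sub_mul_pow_le (sq_nonneg _) (sq_nonneg _) m)
  gcongr

lemma freeEig_le (h : NearRes k ρ η q j t₀) {p : Lat n} (l : ℕ)
    (hpk : |‖mom p t‖ ^ 2 - k ^ 2| ≤ 5) : freeEig l p t ≤ (2 * k ^ 2) ^ l := by
  rw [freeEig_eq]
  have := (abs_le.1 hpk).2
  have := h.k_ge
  exact pow_le_pow_left₀ (sq_nonneg _) (by nlinarith) l

lemma le_freeEig (h : NearRes k ρ η q j t₀) (l : ℕ) (ht : t ∈ ball t₀ ρ)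
    (hi : 3 * k < ‖mom i t₀‖) : 4 ^ l * (2 * k ^ 2) ^ l ≤ freeEig l i t := by
  rw [freeEig_eq, ← mul_pow]
  have h1 := h.le_mom ht hi
  have := h.k_ge
  exact pow_le_pow_left₀ (by positivity) (by nlinarith) l

end NearRes

/-- Level repulsion: `λ⁺` lies above both diagonal entries, and exceeds the larger one by at most
`|v_q|` because `√(w² + D²) ≤ |D| + w`. -/
lemma lamPlus_mem (hq : v q ≠ 0) (t : Sp n) :
    (freeEig l j t ≤ lamPlus l v j q t ∧ freeEig l (j - q) t ≤ lamPlus l v j q t) ∧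
    (lamPlus l v j q t ≤ freeEig l j t + ‖v q‖ ∨
      lamPlus l v j q t ≤ freeEig l (j - q) t + ‖v q‖) := by
  have hw := norm_pos_iff.2 hq
  have h1 := abs_le.1 (abs_le_split (w := ‖v q‖) (halfDiff l j q t))
  have h2 := split_le hw (halfDiff l j q t)
  rw [lamPlus, halfGap_eq]
  set B := split ‖v q‖ (halfDiff l j q t)
  unfold halfDiff at *
  refine ⟨⟨by linarith [h1.1, h1.2], by linarith [h1.1, h1.2]⟩, ?_⟩
  rcases abs_cases ((freeEig l j t - freeEig l (j - q) t) / 2) with h | h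
  · left; linarith [h.1]
  · right; linarith [h.1]

/-- A number far from both diagonal entries is far from the larger eigenvalue. -/
lemma le_abs_sub_lamPlus (hq : v q ≠ 0) {x g : ℝ} (h1 : g ≤ |x - freeEig l j t|)
    (h2 : g ≤ |x - freeEig l (j - q) t|) : g - ‖v q‖ ≤ |x - lamPlus l v j q t| := by
  obtain ⟨⟨a1, a2⟩, a3⟩ := lamPlus_mem (l := l) (j := j) hq t
  have key : ∀ y, y ≤ lamPlus l v j q t → lamPlus l v j q t ≤ y + ‖v q‖ → g ≤ |x - y| →
      g - ‖v q‖ ≤ |x - lamPlus l v j q t| := by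
    intro y h3 h4 h5
    have h6 : |x - y| ≤ |x - lamPlus l v j q t| + |lamPlus l v j q t - y| := abs_sub_le _ _ _
    rw [abs_of_nonneg (sub_nonneg.2 h3)] at h6
    linarith
  rcases a3 with a3 | a3
  · exact key _ a1 a3 h1
  · exact key _ a2 a3 h2

lemma abs_freeEig_sub_le {m : ℕ} {B : ℝ} (i : Lat n) (h1 : ‖mom i t‖ ≤ B) (h2 : ‖mom i t'‖ ≤ B) :
    |freeEig (m + 1) i t - freeEig (m + 1) i t'| ≤ 2 * (m + 1) * B ^ (2 * m + 1) * dist t t' := by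
  have h := abs_pow_sub_pow_le_of_le (norm_nonneg _) (norm_nonneg _) h1 h2 (2 * m + 1)
  have hB := (norm_nonneg _).trans h1
  unfold freeEig
  rw [show 2 * (m + 1) = 2 * m + 1 + 1 by ring]
  calc _ ≤ ((2 * m + 1 : ℕ) + 1) * B ^ (2 * m + 1) * |‖mom i t‖ - ‖mom i t'‖| := h
    _ ≤ ((2 * m + 1 : ℕ) + 1) * B ^ (2 * m + 1) * dist t t' := by
      gcongr; exact abs_norm_mom_sub_le i t t'
    _ = _ := by push_cast; ring

namespace NearRes

lemma gap_near (h : NearRes k ρ η q j t₀) (hq : v q ≠ 0) {m : ℕ}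
    (hε : ε⁻¹ + ‖v q‖ ≤ η * (k ^ 2 / 2) ^ m) (ht : t ∈ ball t₀ ρ) (h1 : i ≠ j) (h2 : i ≠ j - q)
    (hi : ‖mom i t₀‖ ≤ 3 * k) : ε⁻¹ ≤ |freeEig (m + 1) i t - lamPlus (m + 1) v j q t| := by
  have hk := h.k_ge
  refine le_trans (by linarith) (le_abs_sub_lamPlus (g := η * (k ^ 2 / 2) ^ m) hq
    (h.freeEig_near ?_ (h.sq_j ht) (h.off i h1 h2).1 ht hi)
    (h.freeEig_near ?_ (h.sq_jq ht) (h.off i h1 h2).2 ht hi))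
  · rw [h.at_j]; linarith
  · linarith [h.at_jq_le]

/-- Here `p_i² ≥ 8 k²`, whereas `λ⁺ ≤ (2 k²)^(m+1) + k ≤ 2 (2 k²)^(m+1)`, at most half of the
eigenvalue at `i`. -/
lemma gap_far (h : NearRes k ρ η q j t₀) (hq : v q ≠ 0) {m : ℕ} (hvk : ‖v q‖ ≤ k)
    (ht : t ∈ ball t₀ ρ) (hi : 3 * k < ‖mom i t₀‖) :
    freeEig (m + 1) i t / 2 ≤ freeEig (m + 1) i t - lamPlus (m + 1) v j q t := by
  have hk := h.k_ge
  have h1 := h.freeEig_le (m + 1) (h.sq_j ht)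
  have h2 := h.freeEig_le (m + 1) (h.sq_jq ht)
  have h3 := h.le_freeEig (m + 1) ht hi
  have h4 : (4 : ℝ) ≤ 4 ^ (m + 1) := by
    rw [pow_succ]; linarith [one_le_pow₀ (M₀ := ℝ) (a := 4) (by norm_num) (n := m)]
  have h5 : k ≤ (2 * k ^ 2) ^ (m + 1) := by
    have : (1 : ℝ) ≤ 2 * k ^ 2 := by nlinarith
    calc k ≤ 2 * k ^ 2 := by nlinarith
      _ ≤ _ := le_self_pow₀ this (by omega)
  have h6 : 4 * (2 * k ^ 2) ^ (m + 1) ≤ freeEig (m + 1) i t := le_trans (by gcongr) h3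
  rcases (lamPlus_mem (l := m + 1) (j := j) hq t).2 with h7 | h7 <;> linarith

/-- The gap conditions hold near a resonant quasimomentum. -/
lemma gaps (h : NearRes k ρ η q j t₀) (hq : v q ≠ 0) {m : ℕ} (hvk : ‖v q‖ ≤ k) (hε0 : 0 < ε)
    (hε1 : ε ≤ 1) (hε : ε⁻¹ + ‖v q‖ ≤ η * (k ^ 2 / 2) ^ m) (hεk : ε⁻¹ ≤ k ^ (2 * (m + 1))) :
    Gaps (m + 1) v j q (ball t₀ ρ) (2 * (m + 1) * (4 * k) ^ (2 * m + 1)) ε := by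
  have hk := h.k_ge
  have hk0 : 0 < k := by linarith
  have hfar : ∀ {t : Sp n} {i : Lat n}, t ∈ ball t₀ ρ → 3 * k < ‖mom i t₀‖ →
      freeEig (m + 1) i t ≤ 2 * |freeEig (m + 1) i t - lamPlus (m + 1) v j q t| := by
    intro t i ht hi
    linarith [le_abs_self (freeEig (m + 1) i t - lamPlus (m + 1) v j q t),
      h.gap_far (m := m) hq hvk ht hi]
  have hgap : ∀ t ∈ ball t₀ ρ, ∀ i, i ≠ j → i ≠ j - q →
      ε⁻¹ ≤ |freeEig (m + 1) i t - lamPlus (m + 1) v j q t| := by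
    intro t ht i h1 h2
    rcases le_or_gt ‖mom i t₀‖ (3 * k) with hi | hi
    · exact h.gap_near hq hε ht h1 h2 hi
    · have h3 := hfar ht hi
      have h4 := h.le_freeEig (m + 1) ht hi
      have h5 : 2 * k ^ (2 * (m + 1)) ≤ 4 ^ (m + 1) * (2 * k ^ 2) ^ (m + 1) := by
        rw [mul_pow 2 (k ^ 2), ← pow_mul, ← mul_assoc, ← mul_pow]
        gcongr
        calc (2 : ℝ) ≤ 4 * 2 := by norm_num
          _ ≤ _ := le_self_pow₀ (by norm_num) (by omega)
      linarith
  refine ⟨⟨by positivity, fun t ht t' ht' => ?_, fun t ht t' ht' => ?_⟩, hε0, hε1, hgap, ?_, ?_⟩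
  · exact abs_freeEig_sub_le j (h.mom_le ht (by rw [h.at_j]; linarith))
      (h.mom_le ht' (by rw [h.at_j]; linarith))
  · exact abs_freeEig_sub_le (j - q) (h.mom_le ht (by linarith [h.at_jq_le]))
      (h.mom_le ht' (by linarith [h.at_jq_le]))
  -- For moderate momenta the speed is at most `L` and the gap at least 1. For large momenta the
  -- speed is of order `p_i^(2l-1) ≤ p_i^(2l)`, which the gap itself dominates.
  · intro t ht t' ht' i h1 h2
    have hg := ((one_le_inv₀ hε0).2 hε1).trans (hgap t ht i h1 h2)
    rcases le_or_gt ‖mom i t₀‖ (3 * k) with hi | hi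
    · refine (abs_freeEig_sub_le i (h.mom_le ht hi) (h.mom_le ht' hi)).trans ?_
      exact mul_le_mul_of_nonneg_right (le_mul_of_one_le_right (by positivity) hg) dist_nonneg
    · have h3 := hfar ht hi
      have h4 := h.le_mom ht hi
      have h5 : ‖mom i t'‖ ≤ 2 * ‖mom i t‖ := by
        have h6 := (abs_le.1 (abs_norm_mom_sub_le i t' t)).2
        have h7 : dist t' t ≤ 2 * ρ := by
          linarith [dist_triangle_right t' t t₀, mem_ball.1 ht, mem_ball.1 ht']
        linarith [h.ρ_le]
      refine (abs_freeEig_sub_le (m := m) i (B := 2 * ‖mom i t‖)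
        (by linarith [norm_nonneg (mom i t)]) h5).trans ?_
      refine mul_le_mul_of_nonneg_right ?_ dist_nonneg
      rw [mul_assoc (2 * ((m : ℝ) + 1))]
      refine mul_le_mul_of_nonneg_left ?_ (by positivity)
      have h8 : ‖mom i t‖ ^ (2 * m + 1) ≤ 2 * |freeEig (m + 1) i t - lamPlus (m + 1) v j q t| := by
        refine le_trans ?_ h3
        unfold freeEig
        exact pow_le_pow_right₀ (by linarith) (by omega)
      have h9 : (2 : ℝ) ^ (2 * m + 1) * 2 ≤ (4 * k) ^ (2 * m + 1) := by
        calc (2 : ℝ) ^ (2 * m + 1) * 2 ≤ 2 ^ (2 * m + 1) * 2 ^ (2 * m + 1) := by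
              gcongr; exact le_self_pow₀ (by norm_num) (by omega)
          _ = 4 ^ (2 * m + 1) := by rw [← mul_pow]; norm_num
          _ ≤ _ := by gcongr; linarith
      rw [mul_pow]
      calc _ ≤ 2 ^ (2 * m + 1) * (2 * |freeEig (m + 1) i t - lamPlus (m + 1) v j q t|) := by gcongr
        _ = 2 ^ (2 * m + 1) * 2 * |freeEig (m + 1) i t - lamPlus (m + 1) v j q t| := by ring
        _ ≤ _ := by gcongr
  -- This constant may depend on `k`: coercivity serves differentiability only and enters no
  -- estimate.
  · refine ⟨(2 * (1 + (4 * k) ^ 2) ^ (m + 1))⁻¹, by positivity, fun t ht i h1 h2 => ?_⟩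
    have hg := ((one_le_inv₀ hε0).2 hε1).trans (hgap t ht i h1 h2)
    rw [inv_mul_le_iff₀ (by positivity)]
    rcases le_or_gt ‖mom i t₀‖ (3 * k) with hi | hi
    · have h3 := h.mom_le ht hi
      calc (1 + ‖mom i t‖ ^ 2) ^ (m + 1) ≤ (1 + (4 * k) ^ 2) ^ (m + 1) := by gcongr
        _ ≤ (2 * (1 + (4 * k) ^ 2) ^ (m + 1)) * 1 := by
          have : 0 < (1 + (4 * k) ^ 2) ^ (m + 1) := by positivity
          linarith
        _ ≤ _ := by gcongr
    · have h3 := hfar ht hi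
      have h4 := h.le_mom ht hi
      have h5 : (1 + ‖mom i t‖ ^ 2) ^ (m + 1) ≤ 2 ^ (m + 1) * freeEig (m + 1) i t := by
        rw [freeEig_eq, ← mul_pow]
        gcongr
        nlinarith
      have h6 : (2 : ℝ) ^ (m + 1) ≤ (1 + (4 * k) ^ 2) ^ (m + 1) := by gcongr; nlinarith
      calc _ ≤ 2 ^ (m + 1) * freeEig (m + 1) i t := h5
        _ ≤ (1 + (4 * k) ^ 2) ^ (m + 1) * (2 * |freeEig (m + 1) i t - lamPlus (m + 1) v j q t|) :=
          mul_le_mul h6 h3 (by unfold freeEig; positivity) (by positivity)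
        _ = _ := by ring

end NearRes

end NearResonance

/-! ### Length of the gradient of the model eigenvalue -/

section GradientLength
variable {n l m : ℕ} {v : Lat n →₀ ℂ} {j q i : Lat n} {t₀ t : Sp n} {k ρ η : ℝ}

lemma hasGradientAt_freeEig (i : Lat n) (t : Sp n) :
    HasGradientAt (freeEig (m + 1) i) ((2 * (m + 1) * (‖mom i t‖ ^ 2) ^ m) • mom i t) t := by
  have h1 : HasFDerivAt (fun s : Sp n => mom i s) (ContinuousLinearMap.id ℝ (Sp n)) t := by
    have : (fun s : Sp n => mom i s) = fun s => mom i 0 + s := funext fun s => mom_eq i s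
    rw [this]
    exact (hasFDerivAt_id t).const_add _
  have h2 := (h1.norm_sq).pow (m + 1)
  have e : freeEig (m + 1) i = fun s : Sp n => (‖mom i s‖ ^ 2) ^ (m + 1) :=
    funext fun s => freeEig_eq i s
  rw [hasGradientAt_iff_hasFDerivAt, e]
  refine h2.congr_fderiv ?_
  ext s
  simp
  ring

/-- The weight of the index `j - q` in the model eigenvector. -/
def weight (l : ℕ) (v : Lat n →₀ ℂ) (j q : Lat n) (t : Sp n) : ℝ :=
  (1 - halfDiff l j q t / halfGap l v j q t) / 2

lemma weight_mem (hq : v q ≠ 0) (t : Sp n) :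
    0 ≤ weight l v j q t ∧ weight l v j q t ≤ 1 := by
  have h1 := abs_le.1 (abs_le_split (w := ‖v q‖) (halfDiff l j q t))
  have h2 := split_pos (norm_pos_iff.2 hq) (halfDiff l j q t)
  unfold weight
  rw [halfGap_eq]
  have h3 : halfDiff l j q t / split ‖v q‖ (halfDiff l j q t) ≤ 1 := (div_le_one h2).2 h1.2
  have h4 : -1 ≤ halfDiff l j q t / split ‖v q‖ (halfDiff l j q t) := by
    rw [le_div_iff₀ h2]; linarith [h1.1]
  constructor <;> linarith

/-- The Hellmann–Feynman formula: the weights are the squared moduli `cos² θ`, `sin² θ` of the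
entries of the model eigenvector. -/
lemma hasGradientAt_lamPlus (hq : v q ≠ 0) {a b : Sp n} (ha : HasGradientAt (freeEig l j) a t)
    (hb : HasGradientAt (freeEig l (j - q)) b t) :
    HasGradientAt (lamPlus l v j q) ((1 - weight l v j q t) • a + weight l v j q t • b) t := by
  rw [hasGradientAt_iff_hasFDerivAt] at ha hb ⊢
  have hD : HasFDerivAt (halfDiff l j q) _ t := (ha.sub hb).mul_const (2⁻¹ : ℝ)
  have h2 := split_pos (norm_pos_iff.2 hq) (halfDiff l j q t)
  have hB := ((hD.pow 2).const_add (‖v q‖ ^ 2)).sqrt (by have := norm_pos_iff.2 hq; positivity)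
  have h := ((ha.add hb).mul_const (2⁻¹ : ℝ)).add hB
  have e : lamPlus l v j q = fun s => (freeEig l j s + freeEig l (j - q) s) * 2⁻¹
      + √(‖v q‖ ^ 2 + halfDiff l j q s ^ 2) := by
    ext s; rw [lamPlus, halfGap_eq, split]; ring
  rw [e]
  refine h.congr_fderiv ?_
  ext s
  rw [weight, halfGap_eq]
  simp only [map_add, map_smul, add_apply, smul_apply,
    sub_apply, smul_eq_mul, split]
  rw [split] at h2
  field_simp
  ring

lemma mom_sub (j q : Lat n) (t : Sp n) : mom (j - q) t = mom j t - mom q (0 : Sp n) := by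
  ext s; simp [mom]; ring

/-- At resonance the difference of squares is bounded, so `P_j` is nearly orthogonal to `q` when `k`
is large, and moving along `q` changes its squared length by `O(1)` only. -/
lemma two_inner_mom (j q : Lat n) (t : Sp n) :
    2 * inner ℝ (mom j t) (mom q 0) = ‖mom q (0 : Sp n)‖ ^ 2 + ‖mom j t‖ ^ 2 - ‖mom (j - q) t‖ ^ 2 := by
  rw [mom_sub, norm_sub_sq_real]; ring

/-- The length of the gradient of the model eigenvalue. -/
lemma NearRes.norm_gradient_lamPlus (h : NearRes k ρ η q j t₀) (hq : v q ≠ 0) {Q : ℝ}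
    (hQ : ‖mom q (0 : Sp n)‖ ≤ Q) (ht : t ∈ ball t₀ ρ) :
    |‖gradient (lamPlus (m + 1) v j q) t‖ - 2 * (m + 1) * k ^ (2 * m + 1)|
      ≤ 2 * (m + 1) * k ^ (2 * m + 1) * ((15 + Q ^ 2 + 10 * m * 2 ^ m) / k ^ 2) := by
  have hk := h.k_ge
  have hk0 : 0 < k := by linarith
  rw [(hasGradientAt_lamPlus hq (hasGradientAt_freeEig j t)
    (hasGradientAt_freeEig (j - q) t)).gradient]
  obtain ⟨hs0, hs1⟩ := weight_mem (l := m + 1) (j := j) hq t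
  set s := weight (m + 1) v j q t
  have hx := h.sq_j ht
  have hy := h.sq_jq ht
  set P := mom j t with hP
  set R := mom (j - q) t with hR
  set Z := (1 - s) • P + s • R with hZ
  have hx' := abs_le.1 hx
  have hy' := abs_le.1 hy
  -- the direction
  have hZsq : |‖Z‖ ^ 2 - k ^ 2| ≤ 15 + Q ^ 2 := by
    have e : Z = P - s • mom q (0 : Sp n) := by
      rw [hZ, hR, mom_sub, ← hP]; module
    have e2 : ‖Z‖ ^ 2 = ‖P‖ ^ 2 - s * (‖mom q (0 : Sp n)‖ ^ 2 + ‖P‖ ^ 2 - ‖R‖ ^ 2)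
        + s ^ 2 * ‖mom q (0 : Sp n)‖ ^ 2 := by
      rw [e, norm_sub_sq_real, real_inner_smul_right, norm_smul, Real.norm_of_nonneg hs0,
        ← two_inner_mom]
      ring
    have hQ2 : ‖mom q (0 : Sp n)‖ ^ 2 ≤ Q ^ 2 := pow_le_pow_left₀ (norm_nonneg _) hQ 2
    have h1 : 0 ≤ ‖mom q (0 : Sp n)‖ ^ 2 := sq_nonneg _
    have h2 : 0 ≤ s * (1 - s) := mul_nonneg hs0 (by linarith)
    have h3 : s * (1 - s) ≤ 1 := by nlinarith
    have h4 : |s * (‖P‖ ^ 2 - ‖R‖ ^ 2)| ≤ 10 := by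
      rw [abs_mul, abs_of_nonneg hs0]
      have : |‖P‖ ^ 2 - ‖R‖ ^ 2| ≤ 10 := by
        rw [abs_le]; constructor <;> linarith [hx'.1, hx'.2, hy'.1, hy'.2]
      nlinarith [abs_nonneg (‖P‖ ^ 2 - ‖R‖ ^ 2)]
    have h4' := abs_le.1 h4
    have h5 : 0 ≤ s * (1 - s) * ‖mom q (0 : Sp n)‖ ^ 2 := mul_nonneg h2 h1
    have h6 : s * (1 - s) * ‖mom q (0 : Sp n)‖ ^ 2 ≤ Q ^ 2 := by nlinarith
    -- The terms in `q` combine to `s (1 - s) |q|²`, so `|Z|² = k² + O(1)` and `|Z| = k + O(1/k)`: a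
    -- relative error of order `k⁻²`.
    have e3 : ‖Z‖ ^ 2 - k ^ 2 = (‖P‖ ^ 2 - k ^ 2) - s * (‖P‖ ^ 2 - ‖R‖ ^ 2)
        - s * (1 - s) * ‖mom q (0 : Sp n)‖ ^ 2 := by rw [e2]; ring
    rw [e3, abs_le]
    constructor <;> nlinarith [sq_nonneg Q]
  have hZk : |‖Z‖ - k| ≤ (15 + Q ^ 2) / k := by
    rw [le_div_iff₀ hk0]
    refine le_trans ?_ hZsq
    have e : ‖Z‖ ^ 2 - k ^ 2 = (‖Z‖ - k) * (‖Z‖ + k) := by ring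
    rw [e, abs_mul, abs_of_nonneg (a := ‖Z‖ + k) (by positivity)]
    gcongr
    linarith [norm_nonneg Z]
  -- the lengths of the momenta
  have hlen : ∀ X : Sp n, |‖X‖ ^ 2 - k ^ 2| ≤ 5 →
      |(‖X‖ ^ 2) ^ m - (k ^ 2) ^ m| * ‖X‖ ≤ k ^ (2 * m + 1) * (10 * m * 2 ^ m / k ^ 2) := by
    intro X hX
    have hX' := (abs_le.1 hX).2
    have hX2 : ‖X‖ ≤ 2 * k := by nlinarith [norm_nonneg X]
    rcases m with _ | m
    · simp
    have h1 := abs_pow_sub_pow_le_of_le (x := ‖X‖ ^ 2) (y := k ^ 2) (B := 2 * k ^ 2) (sq_nonneg _)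
      (sq_nonneg _) (by nlinarith) (by nlinarith) m
    calc _ ≤ ((m + 1) * (2 * k ^ 2) ^ m * 5) * (2 * k) := by
          refine mul_le_mul (h1.trans ?_) hX2 (norm_nonneg _) (by positivity)
          gcongr
      _ = k ^ (2 * (m + 1) + 1) * (10 * ((m + 1 : ℕ) : ℝ) * 2 ^ m / k ^ 2) := by
        rw [mul_pow, ← pow_mul]; field_simp; push_cast; ring
      _ ≤ _ := by gcongr <;> norm_num
  set c : ℝ := 2 * (m + 1) with hc
  have hc0 : 0 ≤ c := by positivity
  set e1 := (‖P‖ ^ 2) ^ m - (k ^ 2) ^ m with he1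
  set e2 := (‖R‖ ^ 2) ^ m - (k ^ 2) ^ m with he2
  -- Main part: both momenta carry the common factor `k^(2m)`. The rest measures how far their
  -- lengths differ from `k`.
  have hdec : (1 - s) • ((c * (‖P‖ ^ 2) ^ m) • P) + s • ((c * (‖R‖ ^ 2) ^ m) • R)
      = (c * (k ^ 2) ^ m) • Z + c • ((1 - s) • (e1 • P) + s • (e2 • R)) := by
    rw [hZ, he1, he2]; module
  rw [hdec]
  have hrem : ‖(1 - s) • (e1 • P) + s • (e2 • R)‖ ≤ k ^ (2 * m + 1) * (10 * m * 2 ^ m / k ^ 2) := by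
    refine (norm_add_le _ _).trans ?_
    rw [norm_smul, norm_smul, norm_smul, norm_smul, Real.norm_of_nonneg hs0,
      Real.norm_of_nonneg (sub_nonneg.2 hs1), Real.norm_eq_abs, Real.norm_eq_abs]
    have := hlen P hx
    have := hlen R hy
    nlinarith
  have hmain : |‖(c * (k ^ 2) ^ m) • Z‖ - c * k ^ (2 * m + 1)|
      ≤ c * k ^ (2 * m + 1) * ((15 + Q ^ 2) / k ^ 2) := by
    rw [norm_smul, Real.norm_of_nonneg (by positivity)]
    have e : c * (k ^ 2) ^ m * ‖Z‖ - c * k ^ (2 * m + 1) = c * (k ^ 2) ^ m * (‖Z‖ - k) := by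
      rw [← pow_mul]; ring
    rw [e, abs_mul, abs_of_nonneg (by positivity)]
    calc _ ≤ c * (k ^ 2) ^ m * ((15 + Q ^ 2) / k) := by gcongr
      _ = _ := by rw [← pow_mul]; field_simp; ring
  set X := (c * (k ^ 2) ^ m) • Z
  set Y := (1 - s) • (e1 • P) + s • (e2 • R)
  have h1 : |‖X + c • Y‖ - ‖X‖| ≤ c * ‖Y‖ := by
    have := abs_norm_sub_norm_le (X + c • Y) X
    rwa [add_sub_cancel_left, norm_smul c, Real.norm_of_nonneg hc0] at this
  calc _ ≤ |‖X + c • Y‖ - ‖X‖| + |‖X‖ - c * k ^ (2 * m + 1)| := abs_sub_le _ _ _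
    _ ≤ c * (k ^ (2 * m + 1) * (10 * m * 2 ^ m / k ^ 2))
        + c * k ^ (2 * m + 1) * ((15 + Q ^ 2) / k ^ 2) :=
      add_le_add (h1.trans (by gcongr)) hmain
    _ = _ := by ring

end GradientLength

/-! ### Solution of the nonlinear problem near a resonance -/

section Assembly
variable {n l : ℕ} {v : Lat n →₀ ℂ} {j q : Lat n} {U : Set (Sp n)} {L ε V w s₀ r M σ : ℝ} {A : ℂ}

/-- Solution of the nonlinear problem on an open set on which the gap conditions hold. -/
lemma Gaps.exists_solution (h : Gaps l v j q U L ε) (hU : IsOpen U) (hT : Tight v q V w ε s₀ r)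
    (hS : Small V (w⁻¹ + (w⁻¹) ^ 2) ε r s₀ (σ * ‖A‖ ^ 2)) (hM : L * (3 + w⁻¹) ≤ M)
    (hv0 : v 0 = 0) (hreal : ∀ a, v (-a) = conj (v a)) {ρ : ℝ}
    (hρ : 2 * (eigConst V (w⁻¹ + (w⁻¹) ^ 2) * (densConst * |σ * ‖A‖ ^ 2| + ε)) ≤ ρ)
    (hρ8 : ρ ≤ 1 / 8) :
    ∃ (W : Sp n → Sp n → ℂ) (E : Sp n → Lat n → Lat n → ℂ) (lam : Sp n → ℝ), ∀ t ∈ U,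
      (∀ m : ℕ, ∃ (E' : Lat n → Lat n → ℂ) (μ : ℝ),
        IsSpectralPair l (iterPot l v j q σ A t m) t (lamPlus l v j q t) (radius v q) E' μ) ∧
      Continuous (W t) ∧ IsPeriodic (W t) ∧
      Tendsto (fun m : ℕ => starNorm (fun x => iterPot l v j q σ A t m x - W t x)) atTop (𝓝 0) ∧
      IsSpectralPair l (W t) t (lamPlus l v j q t) (radius v q) (E t) (lam t) ∧
      (∃ G : Lat n → Lat n → EuclideanSpace ℂ (Fin n),
        HasMatrixGradient (fun t' p r => E t' p r - modelProj l v j q t' p r) G t ∧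
        norm0 G ≤ ENNReal.ofReal (n * (1199520 * ρ * M))) ∧
      DifferentiableAt ℝ lam t ∧
      ‖gradient lam t - gradient (lamPlus l v j q) t‖ ≤ ρ * M := by
  have hq := hT.hq
  have hq0 : q ≠ 0 := by rintro rfl; exact hq hv0
  have F := h.frame hq0 hT.hw hT.hwq hM
  have hM0 : 0 ≤ M := F.hp.hM
  set τ := σ * ‖A‖ ^ 2
  choose! x hx1 hx2 hx3 hx4 using fun t (ht : t ∈ U) => F.exists_nl hS hT.hV j ht
  have hbl : BL U M ρ x := (F.nl_bl hM0 hS hT.hV j hx3).mono hρ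
  have hxd : ∀ t ∈ U, DifferentiableAt ℝ x t := fun t ht =>
    F.differentiableAt hS hT.hV j (hU.mem_nhds ht) (differentiable_vecPlus t)
      (differentiable_vecMinus t) (h.differentiableAt_res hq (hU.mem_nhds ht))
      (differentiable_invGap hq t) (fun s hs => ⟨hx1 s hs, hx2 s hs⟩) hbl
  let f : Sp n → L1 (Lat n) := fun t => trial (vecPlus l v j q t) (vecMinus l v j q t) (x t)
  let T : Sp n → L1 (Lat n × Lat n) := fun t => projMat (f t) - projMat (vecPlus l v j q t)
  have hTbl : BL U M (1199520 * ρ) T := bl_projMat_sub F hbl hρ8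
  refine ⟨fun t => ser (coefs v + density j τ (f t)), fun t p r => projMat (f t) (p, r),
    fun t => lamPlus l v j q t + (x t).1, fun t ht => ?_⟩
  -- `Y S` solves the linear problem for a given potential at the fixed `t`; it generates the
  -- successive approximations, while `x` solves the nonlinear problem directly.
  choose! Y hY1 hY2 hY3 hY4 using fun S (hs : ‖S‖ ≤ s₀) => F.exists_eig hS hT.hV ht hs
  obtain ⟨i1, i2, i3, i4⟩ := F.tendsto_iterate hS hT.hV j ht
    (fun S hs => ⟨hY1 S hs, hY2 S hs⟩) (hx1 t ht).le (hx2 t ht)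
  have hpair : ∀ S, ‖S‖ ≤ s₀ → IsReal S → IsSpectralPair l (ser (coefs v + S)) t
      (lamPlus l v j q t) (radius v q)
      (fun p r => projMat (trial (vecPlus l v j q t) (vecMinus l v j q t) (Y S)) (p, r))
      (lamPlus l v j q t + (Y S).1) := fun S hs hr =>
    h.isSpectralPair hT hv0 hreal ht hs hr (hY1 S hs) (F.half_le_mass hT.r_le ht (hY1 S hs))
      (hY2 S hs)
  have hit := iterPot_eq (σ := σ) (A := A) (fun S hs hr => ⟨_, hpair S hs hr⟩) i1
  have hfpair := hpair _ i2 (isReal_density _ _ _)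
  rw [i3] at hfpair
  have hmd : DifferentiableAt ℝ (lamPlus l v j q) t := differentiable_lamPlus hq t
  have hx1d : DifferentiableAt ℝ (fun s => (x s).1) t := (hxd t ht).fst
  have hTd : DifferentiableAt ℝ T t := by
    have hm := F.half_le_mass hT.r_le ht (hx1 t ht).le
    refine DifferentiableAt.sub ?_ ?_
    · refine differentiableAt_projMat (differentiableAt_trial (differentiable_vecPlus t)
        (differentiable_vecMinus t) (hxd t ht)) ?_
      exact (by linarith : (0 : ℝ) < _).ne'
    · refine differentiableAt_projMat (differentiable_vecPlus t) ?_
      rw [mass, pair_plus_plus hq0 hq, Complex.one_re]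
      exact one_ne_zero
  refine ⟨fun m => ?_, continuous_ser _, isPeriodic_ser _, ?_, hfpair, ⟨_, hasMatrixGradient hTd
    (Eventually.of_forall fun s p r => ?_), ?_⟩, hmd.add hx1d, ?_⟩
  · rw [(hit m).2]
    exact ⟨_, _, hpair _ (i1 m) (hit m).1⟩
  · have e : ∀ m, starNorm (fun y => iterPot l v j q σ A t m y - ser (coefs v + density j τ (f t)) y)
        = ENNReal.ofReal ‖(fun S => density j τ (trial (vecPlus l v j q t) (vecMinus l v j q t)
          (Y S)))^[m] 0 - density j τ (f t)‖ := by
      intro m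
      rw [← starNorm_ser]
      congr 1
      ext y
      rw [(hit m).2, ← ser_sub, add_sub_add_left_eq_sub]
    simp_rw [e]
    have := tendsto_iff_norm_sub_tendsto_zero.1 i4
    simpa using ENNReal.tendsto_ofReal this
  · rw [← projMat_vecPlus hreal hq0 hq]; rfl
  · refine (norm0_gradEntry_le _).trans (ENNReal.ofReal_le_ofReal ?_)
    gcongr
    exact hTbl.fderiv_le (hU.mem_nhds ht)
  -- The difference of the two eigenvalues is the coordinate `μ` of the fixed point, whose gradient
  -- is bounded by its Lipschitz constant.
  · have e : gradient (fun t => lamPlus l v j q t + (x t).1) t - gradient (lamPlus l v j q) t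
        = (InnerProductSpace.toDual ℝ (Sp n)).symm (fderiv ℝ (fun s => (x s).1) t) := by
      unfold gradient
      rw [← map_sub, fderiv_fun_add hmd hx1d, add_sub_cancel_left]
    rw [e, LinearIsometryEquiv.norm_map]
    exact hbl.fst.fderiv_le (hU.mem_nhds ht)

/-- In dimensions `0` and `1` there are no resonances at large energies. -/
lemma two_le_of_mem_resonantSet {k δ Q : ℝ} {t₀ : Sp n} (hδ : 0 < δ) (hk : 1 ≤ k) (hq0 : q ≠ 0)
    (hQ : ‖mom q (0 : Sp n)‖ ≤ Q) (hQk : Q < k) (ht : t₀ ∈ resonantSet k δ q j) : 2 ≤ n := by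
  obtain ⟨-, h1, h2, -⟩ := ht
  match n with
  | 0 => exact absurd (Subsingleton.elim q 0) hq0
  | 1 =>
    exfalso
    have h3 := two_inner_mom j q t₀
    have hnorm : ∀ x : Sp 1, ‖x‖ = |x 0| := fun x => by
      rw [EuclideanSpace.norm_eq, Fin.sum_univ_one, Real.norm_eq_abs, sq_abs, Real.sqrt_sq_eq_abs]
    have hin : |inner ℝ (mom j t₀) (mom q (0 : Sp 1))| = k * ‖mom q (0 : Sp 1)‖ := by
      rw [← h1, hnorm, hnorm, PiLp.inner_apply, Fin.sum_univ_one]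
      simp [abs_mul, mul_comm]
    have hq1 : 1 ≤ ‖mom q (0 : Sp 1)‖ := by
      rw [hnorm]
      have : q 0 ≠ 0 := fun h => hq0 (funext fun s => by rw [Subsingleton.elim s 0, h]; rfl)
      have := Int.one_le_abs this
      simp only [mom, PiLp.zero_apply, add_zero]
      exact_mod_cast this
    have h4 : k ^ (-((1 : ℕ) : ℝ) + 2 - δ) ≤ k := by
      calc _ ≤ k ^ (1 : ℝ) := Real.rpow_le_rpow_of_exponent_le hk (by push_cast; linarith)
        _ = k := Real.rpow_one k
    have h5 := abs_lt.1 (h2.trans_le h4)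
    set N := ‖mom q (0 : Sp 1)‖
    -- This contradicts `1 ≤ N < k`, which gives `N ^ 2 < k * N` and `k ≤ k * N`.
    have h6 : 2 * (k * N) ≤ N ^ 2 + k := by
      rw [← hin]
      rcases abs_cases (inner ℝ (mom j t₀) (mom q (0 : Sp 1))) with h | h
      · rw [h.1]; linarith [h5.1]
      · rw [h.1]; nlinarith [h5.2]
    nlinarith
  | m + 2 => omega

/-- Dimension at least 2 makes the exponents `-n + 2 - 7δ` and `-n + 2 - δ` nonpositive. The surplus
`k^δ` of the separation over `k` times the radius absorbs the factor 11. -/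
lemma nearRes_of_mem_resonantSet {k δ Q : ℝ} {t₀ : Sp n} (hδ : 0 < δ) (hk : 100 ≤ k)
    (hkδ : 11 ≤ k ^ δ) (hq0 : q ≠ 0) (hQ : ‖mom q (0 : Sp n)‖ ≤ Q) (hQk : Q < k)
    (ht : t₀ ∈ resonantSet k δ q j) :
    NearRes k (k ^ (-(n : ℝ) + 1 - 7 * δ)) (k ^ (-(n : ℝ) + 2 - 6 * δ)) q j t₀ := by
  have hn := two_le_of_mem_resonantSet hδ (by linarith) hq0 hQ hQk ht
  have hn' : (2 : ℝ) ≤ n := by exact_mod_cast hn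
  obtain ⟨-, h1, h2, h3⟩ := ht
  have hk0 : 0 < k := by linarith
  have e : k * k ^ (-(n : ℝ) + 1 - 7 * δ) = k ^ (-(n : ℝ) + 2 - 7 * δ) := by
    nth_rewrite 1 [← Real.rpow_one k]
    rw [← Real.rpow_add hk0]; congr 1; ring
  refine ⟨hk, by positivity, ?_, ?_, h1, ?_, fun i hi hi' =>
    ⟨(h3 i hi hi').1.le, (h3 i hi hi').2.le⟩⟩
  · rw [e]
    exact Real.rpow_le_one_of_one_le_of_nonpos (by linarith) (by linarith)
  · rw [e]
    calc 11 * k ^ (-(n : ℝ) + 2 - 7 * δ) ≤ k ^ δ * k ^ (-(n : ℝ) + 2 - 7 * δ) := by gcongr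
      _ = _ := by rw [← Real.rpow_add hk0]; congr 1; ring
  · rw [← h1]
    refine h2.le.trans ?_
    exact Real.rpow_le_one_of_one_le_of_nonpos (by linarith) (by linarith)

end Assembly

/-! ### Choice of the constants -/

section Constants
variable {n l m : ℕ} {v : Lat n →₀ ℂ} {j q : Lat n} {V w : ℝ}

/-- All smallness conditions hold once the reciprocal gap and the coupling are small. -/
lemma exists_smallness (hV : 0 ≤ V) (hw : 0 < w) (c : ℝ) (hc : 0 < c) :
    ∃ r s₀ ε₁ : ℝ, 0 < ε₁ ∧ ∀ ε τ : ℝ, 0 < ε → ε ≤ ε₁ → |τ| ≤ ε →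
      Small V (w⁻¹ + (w⁻¹) ^ 2) ε r s₀ τ ∧ c * ε ≤ 1 / 8 ∧
      ∀ {n : ℕ} (v : Lat n →₀ ℂ) (q : Lat n), w ≤ ‖v q‖ → ‖coefs v‖ ≤ V →
        Tight v q V w ε s₀ r := by
  set b := w⁻¹ + (w⁻¹) ^ 2 with hb
  have hb0 : 0 < b := by positivity
  have he := eigConst_pos hV hb0.le
  set e := eigConst V b
  have hd : 0 < densConst := by unfold densConst; positivity
  -- The order of choices is `r` from `b` and `w`, then the potential radius `s` from `r`, then
  -- `ε₁`. Both `s` and `ε` are at most `r / (8 * e)`, which together gives `r / 4`.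
  obtain ⟨r, hr⟩ : ∃ r, r = min (1 / 8) (min (1 / (8 * b)) (w / 20)) := ⟨_, rfl⟩
  have hr0 : 0 < r := by rw [hr]; positivity
  have hr1 : r ≤ 1 / 8 := hr ▸ min_le_left _ _
  have hr2 : r ≤ 1 / (8 * b) := hr ▸ (min_le_right _ _).trans (min_le_left _ _)
  have hr3 : r ≤ w / 20 := hr ▸ (min_le_right _ _).trans (min_le_right _ _)
  obtain ⟨s, hs⟩ : ∃ s, s = min 1 (min (w / 64) (r / (8 * e))) := ⟨_, rfl⟩
  have hs0 : 0 < s := by rw [hs]; positivity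
  have hs1 : s ≤ 1 := hs ▸ min_le_left _ _
  have hs2 : s ≤ w / 64 := hs ▸ (min_le_right _ _).trans (min_le_left _ _)
  have hs3 : s ≤ r / (8 * e) := hs ▸ (min_le_right _ _).trans (min_le_right _ _)
  have hsum : ∀ x ∈ [r / (8 * e), s / (2 * densConst), 1 / (16 * (V + 1)),
      w / (64 * (V + 1) ^ 2), 1 / (8 * c)], 0 < x := by
    simp only [List.mem_cons, List.not_mem_nil, or_false, forall_eq_or_imp, forall_eq]
    exact ⟨by positivity, by positivity, by positivity, by positivity, by positivity⟩
  obtain ⟨ε₁, hε₁, hle⟩ : ∃ ε₁ : ℝ, 0 < ε₁ ∧ ∀ x ∈ [r / (8 * e), s / (2 * densConst),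
      1 / (16 * (V + 1)), w / (64 * (V + 1) ^ 2), 1 / (8 * c)], ε₁ ≤ x := by
    generalize [r / (8 * e), s / (2 * densConst), 1 / (16 * (V + 1)),
      w / (64 * (V + 1) ^ 2), 1 / (8 * c)] = L at hsum
    induction L with
    | nil => exact ⟨1, one_pos, by simp⟩
    | cons a L ih =>
      obtain ⟨y, hy, hy2⟩ := ih fun x hx => hsum x (List.mem_cons_of_mem _ hx)
      refine ⟨min a y, lt_min (hsum a List.mem_cons_self) hy, fun x hx => ?_⟩
      rcases List.mem_cons.1 hx with rfl | hx
      · exact min_le_left _ _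
      · exact (min_le_right _ _).trans (hy2 x hx)
  simp only [List.mem_cons, List.not_mem_nil, or_false, forall_eq_or_imp, forall_eq] at hle
  obtain ⟨h1, h2, h3, h4, h5⟩ := hle
  refine ⟨r, s, ε₁, hε₁, fun ε τ hε hε1 hτ => ?_⟩
  have g1 := (le_div_iff₀ (by positivity)).1 (hε1.trans h1)
  have g2 := (le_div_iff₀ (by positivity)).1 ((hτ.trans hε1).trans h2)
  have g3 := (le_div_iff₀ (by positivity)).1 (hε1.trans h3)
  have g4 := (le_div_iff₀ (by positivity)).1 (hε1.trans h4)
  have g5 := (le_div_iff₀ (by positivity)).1 (hε1.trans h5)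
  have g6 := (le_div_iff₀ (by positivity)).1 hr2
  have g7 := (le_div_iff₀ (by positivity)).1 hs3
  exact ⟨⟨hV, hb0.le, hr0, hr1, by linarith, hs0, hs1, by linarith, by linarith⟩, by linarith,
    fun _ _ hq hv => ⟨hw, hq, hv, hs1, hs2, by linarith, by linarith, hr1, hr3⟩⟩

/-- Only finitely many coefficients are nonzero; a common lower bound makes all constants
independent of `q`. -/
lemma exists_pos_le_coef (v : Lat n →₀ ℂ) : ∃ w : ℝ, 0 < w ∧ ∀ q, v q ≠ 0 → w ≤ ‖v q‖ := by
  rcases v.support.eq_empty_or_nonempty with h | h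
  · exact ⟨1, one_pos, fun q hq => by simp [Finsupp.support_eq_empty.1 h] at hq⟩
  · obtain ⟨q₀, hq₀, hmin⟩ := v.support.exists_min_image (fun q => ‖v q‖) h
    exact ⟨‖v q₀‖, norm_pos_iff.2 (Finsupp.mem_support_iff.1 hq₀),
      fun q hq => hmin q (Finsupp.mem_support_iff.2 hq)⟩

lemma exists_mom_le (v : Lat n →₀ ℂ) : ∃ Q : ℝ, ∀ q, v q ≠ 0 → ‖mom q (0 : Sp n)‖ ≤ Q :=
  ⟨∑ q ∈ v.support, ‖mom q (0 : Sp n)‖, fun q hq =>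
    Finset.single_le_sum (f := fun q => ‖mom q (0 : Sp n)‖) (fun _ _ => norm_nonneg _)
      (Finsupp.mem_support_iff.2 hq)⟩

lemma gam_pos {δ γ₂ : ℝ} (hl : 0 < l) (hδ : 9 * δ < 2 * (l : ℝ) - n) (hδ0 : 0 < δ) (hγ : 0 < γ₂) :
    0 < gam n l δ γ₂ := by
  have : (0 : ℝ) < l := by exact_mod_cast hl
  exact lt_min (by linarith) (by positivity)

/-- The conditions on `k`. -/
lemma eventually_large (V Q : ℝ) {ε₁ δ γ₂ : ℝ} (hV : 0 ≤ V) (hε₁ : 0 < ε₁) (hδ0 : 0 < δ)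
    (hδ : 9 * δ < 2 * ((m + 1 : ℕ) : ℝ) - n) (hγ : 0 < γ₂) :
    ∀ᶠ k : ℝ in atTop, 100 ≤ k ∧ V ≤ k ∧ Q < k ∧ 11 ≤ k ^ δ ∧
      k ^ (-gam n (m + 1) δ γ₂) ≤ ε₁ ∧
      k ^ gam n (m + 1) δ γ₂ + V ≤ k ^ (-(n : ℝ) + 2 - 6 * δ) * (k ^ 2 / 2) ^ m ∧
      k ^ gam n (m + 1) δ γ₂ ≤ k ^ (2 * (m + 1)) := by
  have hγ0 := gam_pos m.succ_pos hδ hδ0 hγ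
  have hγ1 : gam n (m + 1) δ γ₂ ≤ (2 * ((m + 1 : ℕ) : ℝ) - n - 8 * δ) / 2 := min_le_left _ _
  set γ := gam n (m + 1) δ γ₂
  have hn : (0 : ℝ) ≤ n := n.cast_nonneg
  push_cast at hδ hγ1
  -- As `γ` is at most `(2l - n - 8δ) / 2`, this exponent is at least `(2l - n) / 2 - 2δ`; its
  -- positivity absorbs the factor `(1 + V) * 2 ^ m`.
  have hβ : 0 < (2 * ((m : ℝ) + 1) - n - 6 * δ) - γ := by linarith
  filter_upwards [eventually_ge_atTop 100, eventually_ge_atTop V, eventually_gt_atTop Q,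
    (tendsto_rpow_atTop hδ0).eventually_ge_atTop 11,
    (tendsto_rpow_neg_atTop hγ0).eventually_le_const hε₁,
    (tendsto_rpow_atTop hβ).eventually_ge_atTop ((1 + V) * 2 ^ m)] with k h1 h2 h3 h4 h5 h6
  have hk0 : 0 < k := by linarith
  refine ⟨h1, h2, h3, h4, h5, ?_, ?_⟩
  · have e1 : k ^ (-(n : ℝ) + 2 - 6 * δ) * (k ^ 2 / 2) ^ m
        = k ^ ((2 * ((m : ℝ) + 1) - n - 6 * δ) - γ) * k ^ γ / 2 ^ m := by
      rw [div_pow, ← mul_div_assoc, ← pow_mul, ← Real.rpow_natCast k (2 * m), ← Real.rpow_add hk0,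
        ← Real.rpow_add hk0]
      congr 2
      push_cast; ring
    have e2 : 1 ≤ k ^ γ := Real.one_le_rpow (by linarith) hγ0.le
    rw [e1, le_div_iff₀ (by positivity)]
    calc (k ^ γ + V) * 2 ^ m ≤ (k ^ γ + V * k ^ γ) * 2 ^ m := by
          gcongr; exact le_mul_of_one_le_right hV e2
      _ = ((1 + V) * 2 ^ m) * k ^ γ := by ring
      _ ≤ _ := by gcongr
  · rw [← Real.rpow_natCast]
    refine Real.rpow_le_rpow_of_exponent_le (by linarith) ?_
    push_cast
    linarith

end Constants

end Polyharmonic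

end

/-! ### The theorem -/

theorem mainTheorem3 (n l : ℕ) (hl : n < 2 * l) (v : Polyharmonic.Lat n →₀ ℂ)
    (hv0 : v 0 = 0) (hreal : ∀ a, v (-a) = conj (v a)) :
    ∃ C : ℝ, 0 < C ∧ ∀ δ γ₂ : ℝ, 0 < δ → 9 * δ < 2 * (l : ℝ) - n → 0 < γ₂ →
    ∃ k₀ : ℝ, 0 < k₀ ∧ ∀ k : ℝ, k₀ < k →
    ∀ q : Polyharmonic.Lat n, v q ≠ 0 →
    ∀ (j : Polyharmonic.Lat n) (t₀ : Polyharmonic.Sp n),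
      t₀ ∈ Polyharmonic.resonantSet k δ q j →
    ∀ (σ : ℝ) (A : ℂ), |σ| * ‖A‖ ^ 2 < k ^ (-(2 * (l : ℝ) * γ₂)) →
    ∃ (W : Polyharmonic.Sp n → Polyharmonic.Sp n → ℂ)
      (E : Polyharmonic.Sp n → Polyharmonic.Lat n → Polyharmonic.Lat n → ℂ)
      (lam : Polyharmonic.Sp n → ℝ),
    ∀ t ∈ ball t₀ (k ^ (-(n : ℝ) + 1 - 7 * δ)),
      -- every approximation has a single eigenvalue near the model one
      (∀ m : ℕ, ∃ (E' : Polyharmonic.Lat n → Polyharmonic.Lat n → ℂ) (μ : ℝ),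
        Polyharmonic.IsSpectralPair l (Polyharmonic.iterPot l v j q σ A t m) t
          (Polyharmonic.lamPlus l v j q t) (Polyharmonic.radius v q) E' μ) ∧
      -- the approximations converge to the continuous periodic potential `W t`
      Continuous (W t) ∧ Polyharmonic.IsPeriodic (W t) ∧
      Tendsto (fun m : ℕ => Polyharmonic.starNorm
        (fun x => Polyharmonic.iterPot l v j q σ A t m x - W t x)) atTop (𝓝 0) ∧
      -- eigenvalue and spectral projection of the operator with potential `W t`
      Polyharmonic.IsSpectralPair l (W t) t
        (Polyharmonic.lamPlus l v j q t) (Polyharmonic.radius v q) (E t) (lam t) ∧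
      -- gradient of the projection
      (∃ G : Polyharmonic.Lat n → Polyharmonic.Lat n → EuclideanSpace ℂ (Fin n),
        Polyharmonic.HasMatrixGradient
          (fun t' p r => E t' p r - Polyharmonic.modelProj l v j q t' p r) G t ∧
        Polyharmonic.norm0 G <
          ENNReal.ofReal (C * k ^ (-(Polyharmonic.gam n l δ γ₂) + 2 * (l : ℝ) - 1))) ∧
      -- gradient of the eigenvalue
      DifferentiableAt ℝ lam t ∧
      DifferentiableAt ℝ (Polyharmonic.lamPlus l v j q) t ∧
      ‖gradient lam t - gradient (Polyharmonic.lamPlus l v j q) t‖ <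
        C * k ^ (-(Polyharmonic.gam n l δ γ₂) + 2 * (l : ℝ) - 1) ∧
      -- its length
      |‖gradient lam t‖ - 2 * (l : ℝ) * k ^ (2 * (l : ℝ) - 1)| ≤
        2 * (l : ℝ) * k ^ (2 * (l : ℝ) - 1) *
          (C * k ^ (-(min (Polyharmonic.gam n l δ γ₂) 2))) := by
  open Polyharmonic in
  obtain ⟨m, rfl⟩ : ∃ m, l = m + 1 := ⟨l - 1, by omega⟩
  obtain ⟨w, hw, hwv⟩ := exists_pos_le_coef v
  obtain ⟨Q, hQ⟩ := exists_mom_le v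
  have hV : 0 ≤ ‖coefs v‖ := norm_nonneg _
  set V := ‖coefs v‖ with hVdef
  have hd : 0 < densConst := by unfold densConst; positivity
  have he := eigConst_pos (b := w⁻¹ + (w⁻¹) ^ 2) hV (by positivity)
  -- The solution has size `C₁ k^(-γ)`: resolvent and coupling are both at most `k^(-γ)`.
  set C₁ := 2 * (eigConst V (w⁻¹ + (w⁻¹) ^ 2) * (densConst + 1)) with hC₁
  have hC₁0 : 0 < C₁ := by positivity
  obtain ⟨r, s₀, ε₁, hε₁, hsmall⟩ := exists_smallness hV hw C₁ hC₁0
  -- The data vary at rate `C₂ k^(2l-1)`, which is `L * (3 + w⁻¹)` for the speed `L` supplied by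
  -- `NearRes.gaps`.
  set C₂ := 2 * ((m : ℝ) + 1) * 4 ^ (2 * m + 1) * (3 + w⁻¹) with hC₂
  have hC₂0 : 0 < C₂ := by positivity
  set C₅ := 15 + Q ^ 2 + 10 * (m : ℝ) * 2 ^ m with hC₅
  have hC₅0 : 0 < C₅ := by positivity
  have hC₃0 : 0 ≤ (n : ℝ) * (1199520 * C₁ * C₂) := by positivity
  have hC₄0 : 0 < C₁ * C₂ := by positivity
  -- The summands serve the projection, the eigenvalue and the length of the model gradient; the
  -- final 1 makes the inequalities strict.
  refine ⟨n * (1199520 * C₁ * C₂) + C₁ * C₂ + C₅ + 1, by positivity,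
    fun δ γ₂ hδ0 hδ hγ => ?_⟩
  obtain ⟨K, hK⟩ := eventually_atTop.1 (eventually_large V Q hV hε₁ hδ0 hδ hγ)
  refine ⟨max K 1, by positivity, fun k hk q hq j t₀ ht₀ σ A hσ => ?_⟩
  obtain ⟨k1, k2, k3, k4, k5, k6, k7⟩ := hK k ((le_max_left _ _).trans hk.le)
  have hγ0 := gam_pos m.succ_pos hδ hδ0 hγ
  have hγ2 : gam n (m + 1) δ γ₂ ≤ 2 * ((m + 1 : ℕ) : ℝ) * γ₂ := min_le_right _ _
  set γ := gam n (m + 1) δ γ₂ with hγdef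
  have hk0 : 0 < k := by linarith
  have hk1 : 1 ≤ k := by linarith
  have hq0 : q ≠ 0 := by rintro rfl; exact hq hv0
  have hε : 0 < k ^ (-γ) := Real.rpow_pos_of_pos hk0 _
  have hε1 : k ^ (-γ) ≤ 1 := Real.rpow_le_one_of_one_le_of_nonpos hk1 (by linarith)
  have hinv : (k ^ (-γ))⁻¹ = k ^ γ := by rw [Real.rpow_neg hk0.le, inv_inv]
  have hvV : ‖v q‖ ≤ V := L1.norm_apply_le (coefs v) q
  have hτ : |σ * ‖A‖ ^ 2| ≤ k ^ (-γ) := by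
    rw [abs_mul, abs_of_nonneg (sq_nonneg ‖A‖)]
    exact hσ.le.trans (Real.rpow_le_rpow_of_exponent_le hk1 (by linarith))
  have hres := nearRes_of_mem_resonantSet hδ0 k1 k4 hq0 (hQ q hq) k3 ht₀
  have hgaps := hres.gaps (m := m) hq (hvV.trans k2) hε hε1 (by rw [hinv]; linarith)
    (by rw [hinv]; exact k7)
  obtain ⟨hS, hρ8, hT⟩ := hsmall _ _ hε k5 hτ
  obtain ⟨W, E, lam, hsol⟩ := hgaps.exists_solution isOpen_ball (hT v q (hwv q hq) le_rfl) hS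
    (M := C₂ * k ^ (2 * m + 1)) (le_of_eq (by rw [hC₂, mul_pow]; ring)) hv0 hreal
    (ρ := C₁ * k ^ (-γ)) (by
      calc _ ≤ 2 * (eigConst V (w⁻¹ + (w⁻¹) ^ 2) * (densConst * k ^ (-γ) + k ^ (-γ))) := by gcongr
        _ = _ := by rw [hC₁]; ring) hρ8
  have hpow : k ^ (2 * ((m + 1 : ℕ) : ℝ) - 1) = k ^ (2 * m + 1) := by
    rw [← Real.rpow_natCast]; congr 1; push_cast; ring
  have hpow2 : k ^ (-γ + 2 * ((m + 1 : ℕ) : ℝ) - 1) = k ^ (-γ) * k ^ (2 * m + 1) := by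
    rw [← hpow, ← Real.rpow_add hk0]; congr 1; ring
  have hX : 0 < k ^ (-γ) * k ^ (2 * m + 1) := by positivity
  refine ⟨W, E, lam, fun t ht => ?_⟩
  obtain ⟨a1, a2, a3, a4, a5, ⟨G, hG, hG2⟩, a7, a8⟩ := hsol t ht
  have a8' : ‖gradient lam t - gradient (lamPlus (m + 1) v j q) t‖
      ≤ C₁ * C₂ * (k ^ (-γ) * k ^ (2 * m + 1)) := a8.trans (le_of_eq (by ring))
  refine ⟨a1, a2, a3, a4, a5, ⟨G, hG, hG2.trans_lt ?_⟩, a7, differentiable_lamPlus hq t, ?_, ?_⟩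
  · rw [hpow2, ENNReal.ofReal_lt_ofReal_iff (by positivity)]
    calc _ = (n * (1199520 * C₁ * C₂)) * (k ^ (-γ) * k ^ (2 * m + 1)) := by ring
      _ < _ := by gcongr; linarith
  · rw [hpow2]
    refine a8'.trans_lt ?_
    gcongr
    linarith
  · have hlen := hres.norm_gradient_lamPlus (m := m) hq (hQ q hq) ht
    -- The interaction contributes `k^(-γ)` and the geometry of the model gradient `k⁻²`; both are
    -- dominated by `k^(-min γ 2)`.
    have hmin1 : k ^ (-γ) ≤ k ^ (-(min γ 2)) :=
      Real.rpow_le_rpow_of_exponent_le hk1 (neg_le_neg (min_le_left _ _))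
    have hmin2 : 1 / k ^ 2 ≤ k ^ (-(min γ 2)) := by
      rw [one_div, ← Real.rpow_two, ← Real.rpow_neg hk0.le]
      exact Real.rpow_le_rpow_of_exponent_le hk1 (neg_le_neg (min_le_right _ _))
    have hdiff := (abs_norm_sub_norm_le (gradient lam t)
      (gradient (lamPlus (m + 1) v j q) t)).trans a8'
    have hm : (0 : ℝ) ≤ m := m.cast_nonneg
    rw [hpow]
    push_cast
    set c := 2 * ((m : ℝ) + 1) with hc
    have hc1 : 1 ≤ c := by linarith
    set X := k ^ (2 * m + 1)
    have hX0 : 0 < X := by positivity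
    set Z := k ^ (-(min γ 2))
    have hZ0 : 0 < Z := by positivity
    calc _ ≤ |‖gradient lam t‖ - ‖gradient (lamPlus (m + 1) v j q) t‖|
          + |‖gradient (lamPlus (m + 1) v j q) t‖ - c * X| := abs_sub_le _ _ _
      _ ≤ C₁ * C₂ * (k ^ (-γ) * X) + c * X * (C₅ / k ^ 2) := add_le_add hdiff hlen
      _ = 1 * (C₁ * C₂ * (k ^ (-γ) * X)) + c * X * (C₅ * (1 / k ^ 2)) := by ring
      _ ≤ c * (C₁ * C₂ * (Z * X)) + c * X * (C₅ * Z) := by gcongr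
      _ = c * X * ((C₁ * C₂ + C₅) * Z) := by ring
      _ ≤ _ := mul_le_mul_of_nonneg_left (mul_le_mul_of_nonneg_right (by linarith) hZ0.le)
        (by positivity)
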